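/- Let $V$ be a complex vector space (complexified space-time, e.g. $\mathbb{C}^d$) with a symmetric bilinear form $v\cdot w$, and $\mathfrak g$ a finite-dimensional complex Lie algebra with a nondegenerate symmetric invariant form $\mathrm{tr}(st)=s\cdot t$. Let $\sigma_1,\dots,\sigma_n\in\mathbb{C}$ be distinct, $\sigma_{ij}=\sigma_i-\sigma_j$. Particle $i$ has momentum $k_i$ and is a graviton (polarization $\epsilon_i$), an untilded gluon or a tilded gluon (colour $t_i\in\mathfrak g$). Put $P(\sigma_i)=\sum_{j\ne i}k_j/\sigma_{ij}$ and assume $k_i^2=0$, $\epsilon_a\cdot k_a=0$ for every graviton $a$, $\sum_ik_i=0$, and the scattering equations $k_i\cdot P(\sigma_i)=0$. Let $h$ be the set of gravitons, $g$ the set of gluons, $m$ the number of untilded gluons. The system $S_{CS,\Psi}$ consists of free worldsheet fields: fermions $\Psi\in V$, $\rho,\tilde\rho\in\mathfrak g$ and bosons $q,y\in\mathfrak g$, with $$v\cdot\Psi(z)\,w\cdot\Psi(0)\sim\tfrac{v\cdot w}{z},\quad s\cdot\rho(z)\,t\cdot\tilde\rho(0)\sim\tfrac{s\cdot t}{z},\quad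 s\cdot y(z)\,t\cdot q(0)\sim\tfrac{s\cdot t}{z},$$ and a ghost $\gamma\in T^{1/2}$ with two zero modes (bosonized $\beta\gamma$ system with background charge 2, $\delta(\gamma)$ of charge $-1$, so that $\langle\delta(\gamma)_a\delta(\gamma)_b\rangle=1/\sigma_{ab}$, and a correlator with any other number of factors $\delta(\gamma)$ vanishes). Each particle contributes one vertex operator, either fixed, $$u_\epsilon=\delta(\gamma)\,\epsilon\cdot\Psi,\quad u_t=\delta(\gamma)\,t\cdot\rho,\quad \tilde u_t=\delta(\gamma)\,t\cdot\tilde\rho,$$ or integrated (normal ordered), $$v_\epsilon=\epsilon\cdot P+k\cdot\Psi\,\epsilon\cdot\Psi,\quad v_t=k\cdot\Psi\,t\cdot\rho+\tfrac12t\cdot[\rho,\rho],\quad \tilde v_t=k\cdot\Psi\,t\cdot\tilde\rho+t\cdot([\rho,\tilde\rho]+[q,y]).$$ The correlator is the ghost correlator times the Wick expansion of the product of the matter parts, in the order of the labels. **Theorem.** If the correlator is nonzero, then exactly two of the vertex operators are fixed and the others are integrated. If exactly two are fixed (of any types), the correlator equals $$(-1)^{|g|+m(m+1)/2+|h|(|h|-1)/2}\sum_{\{T_1,\dots,T_m\}}\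 \sum_{c_i<d_i\in T_i}\mathcal K(c_1,d_1|T_1)\cdots\mathcal K(c_m,d_m|T_m)\ \mathrm{Pf}'M^{(c,d)},$$ where the outer sum is over all partitions $g=T_1\sqcup\dots\sqcup T_m$ with $|T_i|\ge2$ and exactly one untilded gluon in each $T_i$. Here $\mathcal K(i,j|T)=\sigma_{ji}\,\mathcal C(T)$, and for $T=\{1<\dots<r\}$ $$\mathcal C(T)=\frac{\mathrm{tr}(t_1[t_2,[\dots,[t_{r-1},t_r]\dots]])}{\sigma_{12}\sigma_{23}\cdots\sigma_{r1}}+\mathrm{Perm}(2,\dots,r-1).$$ $M^{(c,d)}$ is the skew matrix with rows and columns $(h;c_1,\dots,c_m;d_1,\dots,d_m\,|\,h)$ and blocks $$A_{ij}=\frac{k_i\cdot k_j}{\sigma_{ij}},\quad B_{ij}=\frac{\epsilon_i\cdot\epsilon_j}{\sigma_{ij}},\quad C_{ij}=\frac{\epsilon_i\cdot k_j}{\sigma_{ij}}\ (i\neq j),\quad A_{ii}=B_{ii}=0,\quad C_{ii}=-\epsilon_i\cdot P(\sigma_i),$$ arranged as $\begin{pmatrix}A&-C^T\\ C&B\end{pmatrix}$.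 The reduced Pfaffian may be formed in any of the following equivalent ways, where $(-1)^{x+y}$ refers to the positions of the removed rows $x<y$: 1. Remove the momentum rows and columns of two gravitons $a<b$: $\mathrm{Pf}'M=\frac{(-1)^{a+b}}{\sigma_{ab}}\mathrm{Pf}\,M_{a,b}$. 2. Remove the two rows and columns $c_i,d_i$ of one trace $T_i$ (which may depend on the partition), replacing the sum over $c_i<d_i$ and the factor $\mathcal K(c_i,d_i|T_i)$ by $\mathcal C(T_i)$, with sign $(-1)^{m+1}$. 3. Collect the sum over the $c_i<d_i$ into $\mathcal C(T_1)\cdots\mathcal C(T_m)\,\mathrm{Pf}'\Pi$. Here $\Pi$ is obtained from the skew matrix of all contractions by replacing the rows (and columns) $c_i,d_i$ by the combinations $i=\sum_{c\in T_i}c$ and $i'=\sum_{c\in T_i}\sigma_c\,c$, and $$\mathrm{Pf}'\Pi=\frac{(-1)^{a+b}}{\sigma_{ab}}\mathrm{Pf}\,\Pi_{a,b}=\frac{(-1)^{a+i}}{\sigma_a}\mathrm{Pf}\,\Pi_{a,i}=-(-1)^{a+j'}\mathrm{Pf}\,\Pi_{a,j'}=-(-1)^{i+j'}\mathrm{Pf}\,\Pi_{i,j'}$$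 for gravitons $a<b$ and arbitrary $i,j$ (the second form if $\sigma_a\ne0$). The rows removed may depend on the partition. -/

import Mathlib

open LinearMap (BilinForm)
open Module (Basis)

noncomputable section

namespace CombSusy

/-- The three kinds of particles: gravitons, untilded gluons (currents `u_t`, `v_t`) and tilded
gluons (currents built from the conjugate fermion). -/
inductive Species
  | graviton
  | gluon
  | gluonTilde
  deriving DecidableEq

/-- The data of `n` vertex operator insertions on the Riemann sphere in an affine coordinate. `V` is
complexified space-time and `𝔤` the gauge Lie algebra. Particle `i` sits at `σ i` and has momentum
`k i`; it carries a polarization `ε i` if it is a graviton and a colour `t i` if it is a gluon (the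
other entry is then not used). `fixed` is the set of fixed operators `u`; the others are
integrated operators `v`. -/
structure Insertions (n : ℕ) (V 𝔤 : Type*) where
  σ : Fin n → ℂ
  k : Fin n → V
  ε : Fin n → V
  t : Fin n → 𝔤
  species : Fin n → Species
  fixed : Finset (Fin n)

/-- The matter fields, contracted with constant vectors: `psi v` is `v · Ψ`, and `rho t`,
`rhoTilde t`, `q t`, `y t` are the components of `ρ`, `ρ̃`, `q`, `y` along `t`. -/
inductive Field (V 𝔤 : Type*)
  | psi (v : V)
  | rho (t : 𝔤)
  | rhoTilde (t : 𝔤)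
  | q (t : 𝔤)
  | y (t : 𝔤)

/-- The fields `Ψ`, `ρ`, `ρ̃` are fermionic, `q`, `y` are bosonic. -/
def Field.fermionic {V 𝔤 : Type*} : Field V 𝔤 → Bool
  | .psi _ => true
  | .rho _ => true
  | .rhoTilde _ => true
  | .q _ => false
  | .y _ => false

section Wick

variable {V 𝔤 : Type*} [AddCommGroup V] [Module ℂ V] [LieRing 𝔤] [LieAlgebra ℂ 𝔤]

/-- The coefficient of `1 / (z - w)` in the operator product expansion of two fields at `z` and
`w`. All expansions not listed are regular. -/
def opeCoeff (η : BilinForm ℂ V) (κ : BilinForm ℂ 𝔤) : Field V 𝔤 → Field V 𝔤 → ℂ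
  | .psi v, .psi w => η v w
  | .rho s, .rhoTilde t => κ s t
  | .rhoTilde s, .rho t => κ s t
  | .y s, .q t => κ s t
  | .q s, .y t => -κ s t
  | _, _ => 0

/-- The contraction of two fields inserted at the `i`-th and the `j`-th puncture. Composite
operators are normal ordered: fields at the same puncture are not contracted. -/
def contraction {n : ℕ} (η : BilinForm ℂ V) (κ : BilinForm ℂ 𝔤) (σ : Fin n → ℂ)
    (X Y : Field V 𝔤 × Fin n) : ℂ :=
  if X.2 = Y.2 then 0 else opeCoeff η κ X.1 Y.1 / (σ X.2 - σ Y.2)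

/-- The free-field vacuum expectation value of a word in the fields, by Wick's theorem: the first
field is contracted with each of the others in turn, with a sign for every fermion that a fermion
is moved past. -/
def wick {n : ℕ} (η : BilinForm ℂ V) (κ : BilinForm ℂ 𝔤) (σ : Fin n → ℂ) :
    List (Field V 𝔤 × Fin n) → ℂ
  | [] => 1
  | X :: w => ∑ j : Fin w.length,
      (if X.1.fermionic then (-1) ^ ((w.take j).countP fun Y => Y.1.fermionic) else 1) *
        contraction η κ σ X w[j] * wick η κ σ (w.eraseIdx j)
  termination_by w => w.length
  decreasing_by
    have := j.isLt
    simp [List.length_eraseIdx]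

/-- Polynomials in the (ordered) fields at the punctures. -/
abbrev FieldPoly (n : ℕ) (V 𝔤 : Type*) := FreeAlgebra ℂ (Field V 𝔤 × Fin n)

/-- The vacuum expectation value of the matter fields, extended linearly from words. -/
def matterCorrelator {n : ℕ} (η : BilinForm ℂ V) (κ : BilinForm ℂ 𝔤) (σ : Fin n → ℂ)
    (O : FieldPoly n V 𝔤) : ℂ :=
  (FreeAlgebra.equivMonoidAlgebraFreeMonoid O).coeff.sum fun w c => c * wick η κ σ w.toList

/-- A field as an element of the algebra of field polynomials. -/
def fld {n : ℕ} (X : Field V 𝔤) (i : Fin n) : FieldPoly n V 𝔤 := FreeAlgebra.ι ℂ (X, i)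

/-- The composite operator `t · [A, B]` at the puncture `i` for two `𝔤`-valued fields `A`, `B`, where
`t · x = κ(t, x)`. Here `A = ∑ a, (e^a · A) e_a` for a basis `e_a` with `κ`-dual basis `e^a`. -/
def bracketOp {n : ℕ} {ι : Type*} [Fintype ι] [DecidableEq ι] (κ : BilinForm ℂ 𝔤)
    (hκ : κ.Nondegenerate) (e : Basis ι ℂ 𝔤) (A B : 𝔤 → Field V 𝔤) (t : 𝔤) (i : Fin n) :
    FieldPoly n V 𝔤 :=
  ∑ a, ∑ b, κ t ⁅e a, e b⁆ •
    (fld (A (κ.dualBasis hκ e a)) i * fld (B (κ.dualBasis hκ e b)) i)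

end Wick

/-- The zero modes of the ghost `γ`, a section of `T^{1/2} = O(1)` on the sphere: polynomials of
degree less than two in the affine coordinate. -/
def ghostZeroModes : Submodule ℂ (Polynomial ℂ) := Polynomial.degreeLT ℂ 2

/-- The correlator of ghost operators of charges `Q i` at `σ i` in the bosonized `βγ` system: with
a background charge equal to the number of zero modes of `γ`, it vanishes unless the charges
add up to minus this number, and is `∏_{i<j} (σ_i - σ_j)^{-Q_i Q_j}` otherwise. -/
def ghostCorrelator {n : ℕ} (σ : Fin n → ℂ) (Q : Fin n → ℤ) : ℂ :=
  if ∑ i, Q i + (Module.finrank ℂ ghostZeroModes : ℤ) = 0 then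
    ∏ p : Fin n × Fin n with p.1 < p.2, (σ p.1 - σ p.2) ^ (-(Q p.1 * Q p.2))
  else 0

/-- The Pfaffian of the skew matrix `(M (l i) (l j))_{i,j}` whose rows and columns are labelled by
the list `l`, by expansion along the first row. -/
def pfaffian {R : Type*} (M : R → R → ℂ) : List R → ℂ
  | [] => 1
  | x :: l => ∑ j : Fin l.length, (-1) ^ (j : ℕ) * M x l[j] * pfaffian M (l.eraseIdx j)
  termination_by l => l.length
  decreasing_by
    have := j.isLt
    simp [List.length_eraseIdx]

/-- Labels of the rows of the matrix of field contractions: `mom i` stands for the momentum and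
`pol i` for the polarization of particle `i`. -/
inductive Row (n : ℕ)
  | mom (i : Fin n)
  | pol (i : Fin n)
  deriving DecidableEq

/-- Labels of the rows of the matrix `Π`: gravitons (`mom`, `pol`) and two rows for each trace. -/
inductive TraceRow (n : ℕ)
  | mom (a : Fin n)
  | trace (T : Finset (Fin n))
  | trace' (T : Finset (Fin n))
  | pol (a : Fin n)
  deriving DecidableEq

namespace Insertions

variable {n : ℕ} {V 𝔤 : Type*} [AddCommGroup V] [Module ℂ V] [LieRing 𝔤] [LieAlgebra ℂ 𝔤]

/-- The set `h` of gravitons. -/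
def gravitons (D : Insertions n V 𝔤) : Finset (Fin n) := {i | D.species i = .graviton}

/-- The set `g` of gluons of both types. -/
def gluons (D : Insertions n V 𝔤) : Finset (Fin n) := {i | D.species i ≠ .graviton}

/-- The set of untilded gluons. -/
def untilded (D : Insertions n V 𝔤) : Finset (Fin n) := {i | D.species i = .gluon}

/-- The value of the field `P` at the `i`-th puncture (its component along `k i`, which is singular
there, drops out of `ε i · P` because `ε i · k i = 0`). -/
def P (D : Insertions n V 𝔤) (i : Fin n) : V :=
  ∑ j ∈ Finset.univ.erase i, (D.σ i - D.σ j)⁻¹ • D.k j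

/-- Distinct punctures, null momenta, transverse polarizations, momentum conservation and the
scattering equations. -/
structure OnShell (D : Insertions n V 𝔤) (η : BilinForm ℂ V) : Prop where
  distinct : Function.Injective D.σ
  null : ∀ i, η (D.k i) (D.k i) = 0
  transverse : ∀ a ∈ D.gravitons, η (D.ε a) (D.k a) = 0
  conservation : ∑ i, D.k i = 0
  scattering : ∀ i, η (D.k i) (D.P i) = 0

/-- The picture charge of the `i`-th operator: `-1` for a factor `δ(γ)`, else `0`. -/
def charge (D : Insertions n V 𝔤) (i : Fin n) : ℤ := if i ∈ D.fixed then -1 else 0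

/-- The matter part of the `i`-th vertex operator. Fixed operators are `δ(γ)` times `ε · Ψ`, `t · ρ`
or `t · ρ̃`; integrated operators are `ε · P + k · Ψ ε · Ψ`, `k · Ψ t · ρ + ½ t · [ρ, ρ]` or
`k · Ψ t · ρ̃ + t · ([ρ, ρ̃] + [q, y])`. -/
def vertexMatter {ι : Type*} [Fintype ι] [DecidableEq ι] (D : Insertions n V 𝔤)
    (η : BilinForm ℂ V) (κ : BilinForm ℂ 𝔤) (hκ : κ.Nondegenerate) (e : Basis ι ℂ 𝔤)
    (i : Fin n) : FieldPoly n V 𝔤 :=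
  match D.species i with
  | .graviton =>
      if i ∈ D.fixed then fld (.psi (D.ε i)) i
      else algebraMap ℂ _ (η (D.ε i) (D.P i)) + fld (.psi (D.k i)) i * fld (.psi (D.ε i)) i
  | .gluon =>
      if i ∈ D.fixed then fld (.rho (D.t i)) i
      else fld (.psi (D.k i)) i * fld (.rho (D.t i)) i +
        (1 / 2 : ℂ) • bracketOp κ hκ e .rho .rho (D.t i) i
  | .gluonTilde =>
      if i ∈ D.fixed then fld (.rhoTilde (D.t i)) i
      else fld (.psi (D.k i)) i * fld (.rhoTilde (D.t i)) i +
        (bracketOp κ hκ e .rho .rhoTilde (D.t i) i + bracketOp κ hκ e .q .y (D.t i) i)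

/-- The correlator of the vertex operators, ordered by their labels. -/
def correlator {ι : Type*} [Fintype ι] [DecidableEq ι] (D : Insertions n V 𝔤)
    (η : BilinForm ℂ V) (κ : BilinForm ℂ 𝔤) (hκ : κ.Nondegenerate) (e : Basis ι ℂ 𝔤) : ℂ :=
  ghostCorrelator D.σ D.charge *
    matterCorrelator η κ D.σ (List.ofFn (D.vertexMatter η κ hκ e)).prod

/-- The nested commutator `[t_1, [t_2, …, [t_{r-1}, t_r] … ]]` along a word of labels. -/
def nested (D : Insertions n V 𝔤) : List (Fin n) → 𝔤
  | [] => 0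
  | [i] => D.t i
  | i :: j :: w => ⁅D.t i, nested D (j :: w)⁆

/-- For a word `1, …, r`, the comb `tr(t_1 [t_2, … [t_{r-1}, t_r] … ])` divided by
`σ_{12} σ_{23} ⋯ σ_{r1}`. -/
def combTerm (D : Insertions n V 𝔤) (κ : BilinForm ℂ 𝔤) (w : List (Fin n)) : ℂ :=
  κ ((w.head?.map D.t).getD 0) (D.nested w.tail) /
    (List.zipWith (fun i j => D.σ i - D.σ j) w (w.rotate 1)).prod

/-- The colour factor `𝒞(T)`: the labels of `T` are put in increasing order, and the comb term is
summed over all permutations of the labels other than the first and the last. -/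
def colour (D : Insertions n V 𝔤) (κ : BilinForm ℂ 𝔤) (T : Finset (Fin n)) : ℂ :=
  let w := T.sort (· ≤ ·)
  (w.tail.dropLast.permutations.map fun m =>
    D.combTerm κ (w.head?.toList ++ m ++ w.getLast?.toList)).sum

/-- `𝒦(i, j | T) = σ_{ji} 𝒞(T)`. -/
def comb (D : Insertions n V 𝔤) (κ : BilinForm ℂ 𝔤) (i j : Fin n) (T : Finset (Fin n)) : ℂ :=
  (D.σ j - D.σ i) * D.colour κ T

/-- The entries of the blocks `A`, `-Cᵀ`, `C`, `B`: `A_ij = k_i·k_j/σ_ij`, `B_ij = ε_i·ε_j/σ_ij`,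
`C_ij = ε_i·k_j/σ_ij` off the diagonal, `A_ii = B_ii = 0` and `C_ii = -ε_i·P(σ_i)`. -/
def matrixEntry (D : Insertions n V 𝔤) (η : BilinForm ℂ V) : Row n → Row n → ℂ
  | .mom i, .mom j => if i = j then 0 else η (D.k i) (D.k j) / (D.σ i - D.σ j)
  | .mom i, .pol j => -C j i
  | .pol i, .mom j => C i j
  | .pol i, .pol j => if i = j then 0 else η (D.ε i) (D.ε j) / (D.σ i - D.σ j)
where
  /-- The block `C`. -/
  C (i j : Fin n) : ℂ :=
    if i = j then -η (D.ε i) (D.P i) else η (D.ε i) (D.k j) / (D.σ i - D.σ j)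

/-- The allowed partitions of the gluons: `m` sets, where `m` is the number of untilded gluons, each
of at least two elements and with exactly one untilded gluon. -/
def allowedPartitions (D : Insertions n V 𝔤) : Finset (Finpartition D.gluons) :=
  {p | p.parts.card = D.untilded.card ∧
    ∀ T ∈ p.parts, 2 ≤ T.card ∧ (T ∩ D.untilded).card = 1}

/-- The choices of a pair `c < d` in every set `T` of a family `S`. -/
def pairChoices (S : Finset (Finset (Fin n))) : Finset (S → Fin n × Fin n) :=
  Fintype.piFinset fun T => {p ∈ T.1 ×ˢ T.1 | p.1 < p.2}

/-- The row labels of the matrix for a choice of pairs `c_i, d_i`, in the order: gravitons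
(momentum rows), `c_1, …, c_m`, `d_1, …, d_m`, gravitons (polarization rows). -/
def pairRows (D : Insertions n V 𝔤) (S : Finset (Finset (Fin n))) (cd : S → Fin n × Fin n) :
    List (Row n) :=
  (D.gravitons.sort (· ≤ ·)).map .mom ++ S.attach.toList.map (fun T => .mom (cd T).1) ++
    S.attach.toList.map (fun T => .mom (cd T).2) ++ (D.gravitons.sort (· ≤ ·)).map .pol

/-- The contribution of a partition, with the reduced Pfaffian formed by removing the momentum rows
and columns of the gravitons `a < b`:
`∑_{c_i < d_i ∈ T_i} ∏_i 𝒦(c_i, d_i | T_i) (-1)^{a+b} / σ_{ab} Pf(M without a, b)`. -/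
def contributionGravitons (D : Insertions n V 𝔤) (η : BilinForm ℂ V) (κ : BilinForm ℂ 𝔤)
    (p : Finpartition D.gluons) (a b : Fin n) : ℂ :=
  ∑ cd ∈ pairChoices p.parts, (∏ T, D.comb κ (cd T).1 (cd T).2 T) *
    ((-1) ^ ((D.pairRows p.parts cd).idxOf (.mom a) + (D.pairRows p.parts cd).idxOf (.mom b)) /
      (D.σ a - D.σ b) *
      pfaffian (D.matrixEntry η) (((D.pairRows p.parts cd).erase (.mom a)).erase (.mom b)))

/-- The contribution of a partition, with the reduced Pfaffian formed by removing the two rows and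
columns of the trace `T₀`; the factor `𝒦(c, d | T₀)` is then replaced by `𝒞(T₀)`. -/
def contributionTrace (D : Insertions n V 𝔤) (η : BilinForm ℂ V) (κ : BilinForm ℂ 𝔤)
    (p : Finpartition D.gluons) (T₀ : Finset (Fin n)) : ℂ :=
  D.colour κ T₀ *
    ∑ cd ∈ pairChoices (p.parts.erase T₀), (∏ T, D.comb κ (cd T).1 (cd T).2 T) *
      ((-1) ^ (p.parts.card + 1) *
        pfaffian (D.matrixEntry η) (D.pairRows (p.parts.erase T₀) cd))

/-- The rows of `Π` as combinations of rows of the matrix of contractions: the rows of a trace `T`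
are `∑_{c ∈ T} c` and `∑_{c ∈ T} σ_c c`. -/
def rowCombination (D : Insertions n V 𝔤) : TraceRow n → List (ℂ × Row n)
  | .mom a => [(1, .mom a)]
  | .trace T => (T.sort (· ≤ ·)).map fun c => (1, .mom c)
  | .trace' T => (T.sort (· ≤ ·)).map fun c => (D.σ c, .mom c)
  | .pol a => [(1, .pol a)]

/-- The entries of `Π`. -/
def piEntry (D : Insertions n V 𝔤) (η : BilinForm ℂ V) (r s : TraceRow n) : ℂ :=
  ((D.rowCombination r).map fun x =>
    ((D.rowCombination s).map fun y => x.1 * y.1 * D.matrixEntry η x.2 y.2).sum).sum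

/-- The rows of `Π` for a partition, in order. -/
def piRows (D : Insertions n V 𝔤) (p : Finpartition D.gluons) : List (TraceRow n) :=
  (D.gravitons.sort (· ≤ ·)).map .mom ++ p.parts.toList.map .trace ++
    p.parts.toList.map .trace' ++ (D.gravitons.sort (· ≤ ·)).map .pol

/-- The denominators of the reduced Pfaffian for the pairs of rows that may be removed: two
gravitons, a graviton and a trace row of either kind, or two trace rows of different kinds.
Other pairs get the value `0`. -/
def reductionFactor (D : Insertions n V 𝔤) : TraceRow n → TraceRow n → ℂ
  | .mom a, .mom b => D.σ a - D.σ b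
  | .mom a, .trace _ => D.σ a
  | .mom _, .trace' _ => -1
  | .trace _, .trace' _ => -1
  | _, _ => 0

/-- `Π` can be reduced by removing the row `x` and the later row `y`. -/
def Removable (D : Insertions n V 𝔤) (p : Finpartition D.gluons) (x y : TraceRow n) : Prop :=
  x ∈ D.piRows p ∧ y ∈ D.piRows p ∧ (D.piRows p).idxOf x < (D.piRows p).idxOf y ∧
    D.reductionFactor x y ≠ 0

/-- The reduced Pfaffian `Pf' Π`, formed by removing the rows and columns `x` and `y`. -/
def reducedPfaffian (D : Insertions n V 𝔤) (η : BilinForm ℂ V) (p : Finpartition D.gluons)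
    (x y : TraceRow n) : ℂ :=
  (-1) ^ ((D.piRows p).idxOf x + (D.piRows p).idxOf y) / D.reductionFactor x y *
    pfaffian (D.piEntry η) (((D.piRows p).erase x).erase y)

/-- The overall sign, fixed by the ordering of the fermions in the vertex operators and of the rows
of the matrices. It is the same for all partitions. -/
def overallSign (D : Insertions n V 𝔤) : ℂ :=
  (-1) ^ (D.gluons.card + D.untilded.card * (D.untilded.card + 1) / 2 +
    D.gravitons.card * (D.gravitons.card - 1) / 2)

end Insertions

end CombSusy

end

/-! The correlator is a Gaussian expectation value, and the proof separates it into a colour part,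
evaluated by a recursion, and a Pfaffian in the fermions `Ψ`.

Wick's theorem makes the expectation value descend to the quotient of the free algebra of letters by
the largest ideal on which it vanishes. There letters supercommute, fields are linear in their
labels, and contraction with a fermion is an odd derivation. Integrated vertex operators become even
and central, so their order is immaterial.

Colour. Write a tilded vertex as `θ t·ρ̃ + l J`, with `J = t·([ρ,ρ̃] + [q,y])`, for an odd
coefficient `θ` (here `k·Ψ`) and a number `l` (here 1); it is additive in the pair `(θ, l)`. There
is an odd symmetry with `q ↦ ρ`, `ρ̃ ↦ y`, for which `J` is exact and untilded vertices are closed;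
hence the contribution with only currents at the tilded gluons vanishes (`evEven_current_mul`).
Otherwise some tilded vertex `i` has `l = 0`, and its `ρ̃` is contracted: with a vertex `j` it
either replaces `(θ_j, l_j, t_j)` by `(θ_i, 0, [t_i,t_j])`, or it closes a trace with the `ρ` of an
untilded vertex and leaves `θ_i θ_j` (`dTheta_vertex`). Sums over comb chains obey the same
recursion (`trace_insert`, `traceSum_insert`), so each trace `T` contributes `± 𝒞(T) (∑ θ_c)(∑ σ_c
θ_c)` and contains exactly one untilded gluon (`evEven_prod_vertex`). That `𝒞(T)` may be computed
with any two labels as ends of the chains (`cyc_eq`) follows from `chain_insert`: an additional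
label acts on all others as an infinitesimal gauge transformation.

Pfaffians. Expectation values of products of `Ψ` are given by a functional `φ` on the exterior
algebra of the row space with `φ(u ∧ w) = φ(ι_{B u} w)`. Adding a form of rank two to `B` changes
`φ` by a double contraction (`IsPfaffian.add_wedge`); this accounts for the diagonal entries `ε·P`
and for the rows of the fixed operators. A partition contributes `φ` of a product `G` of two vectors
per graviton and two per trace.

Fixed operators. Space-time is extended by one direction of norm `-1`. Multiplying the fixed
operators at `a`, `b` by fermions along it turns them into the part of an integrated vertex that is
linear in its momentum vector. The part bilinear in two such vectors is the double contraction of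
`G` with the coordinates of the momentum rows `a` and `b` (`matterCorrelator_eq`).

Independence of the removed rows. By the scattering equations, momentum conservation, nullity and
transversality, `∑ row_i` and `∑ σ_i row_i` over all momentum rows lie in the kernel of `B`; both
also annihilate `G` by wedge multiplication. The Plücker relation then shows that `φ(ι_d ι_d' G)`,
divided by the minor of `d, d'` on these two vectors, does not depend on `d, d'` (`reduced_eq`).
Each form of the reduced Pfaffian arises from functionals dual to the removed rows. -/

noncomputable section
namespace CombSusy

/-! ### Twisted derivations of a free algebra -/

section TwistedDerivation

variable {G : Type*}

theorem freeAlgebra_left_induction (S : Submodule ℂ (FreeAlgebra ℂ G)) (h1 : 1 ∈ S)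
    (hmul : ∀ X b, b ∈ S → FreeAlgebra.ι ℂ X * b ∈ S) (a : FreeAlgebra ℂ G) : a ∈ S := by
  have key : ∀ a : FreeAlgebra ℂ G, ∀ b ∈ S, a * b ∈ S := by
    intro a
    induction a using FreeAlgebra.induction with
    | grade0 r => intro b hb; rw [← Algebra.smul_def]; exact S.smul_mem _ hb
    | grade1 X => exact hmul X
    | mul a b ha hb => intro x hx; rw [mul_assoc]; exact ha _ (hb _ hx)
    | add a b ha hb => intro x hx; rw [add_mul]; exact S.add_mem (ha _ hx) (hb _ hx)
  simpa using key a 1 h1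

/-- The upper triangular representation whose off-diagonal entry is a twisted derivation. -/
def twistedRep (τ : FreeAlgebra ℂ G →ₐ[ℂ] FreeAlgebra ℂ G) (d : G → FreeAlgebra ℂ G) :
    FreeAlgebra ℂ G →ₐ[ℂ] Matrix (Fin 2) (Fin 2) (FreeAlgebra ℂ G) :=
  FreeAlgebra.lift ℂ fun Y => !![τ (FreeAlgebra.ι ℂ Y), d Y; 0, FreeAlgebra.ι ℂ Y]

theorem twistedRep_entries (τ : FreeAlgebra ℂ G →ₐ[ℂ] FreeAlgebra ℂ G) (d : G → FreeAlgebra ℂ G)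
    (a : FreeAlgebra ℂ G) :
    twistedRep τ d a 0 0 = τ a ∧ twistedRep τ d a 1 0 = 0 ∧ twistedRep τ d a 1 1 = a := by
  induction a using FreeAlgebra.induction with
  | grade0 r => simp [Matrix.algebraMap_matrix_apply]
  | grade1 X => simp [twistedRep]
  | mul a b ha hb => simp [Matrix.mul_apply, Fin.sum_univ_two, ha, hb]
  | add a b ha hb => simp [ha, hb]

/-- The `τ`-twisted derivation with prescribed values on the generators. -/
def twistedDer (τ : FreeAlgebra ℂ G →ₐ[ℂ] FreeAlgebra ℂ G) (d : G → FreeAlgebra ℂ G) :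
    FreeAlgebra ℂ G →ₗ[ℂ] FreeAlgebra ℂ G where
  toFun a := twistedRep τ d a 0 1
  map_add' a b := by simp
  map_smul' r a := by simp

variable (τ : FreeAlgebra ℂ G →ₐ[ℂ] FreeAlgebra ℂ G) (d : G → FreeAlgebra ℂ G)

/-- The twisted Leibniz rule is the off-diagonal entry of a product of upper triangular matrices. -/
theorem twistedDer_mul (a b : FreeAlgebra ℂ G) :
    twistedDer τ d (a * b) = twistedDer τ d a * b + τ a * twistedDer τ d b := by
  have h := twistedRep_entries τ d
  simp [twistedDer, Matrix.mul_apply, Fin.sum_univ_two, h, add_comm]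

theorem twistedDer_ι (X : G) : twistedDer τ d (FreeAlgebra.ι ℂ X) = d X := by
  simp [twistedDer, twistedRep]

theorem twistedDer_one : twistedDer τ d 1 = 0 := by simp [twistedDer]

theorem twistedDer_ι_mul (X : G) (b : FreeAlgebra ℂ G) :
    twistedDer τ d (FreeAlgebra.ι ℂ X * b) =
      d X * b + τ (FreeAlgebra.ι ℂ X) * twistedDer τ d b := by
  rw [twistedDer_mul, twistedDer_ι]

/-- The span of the words of length at most `N`. -/
def degLE (G : Type*) (N : ℕ) : Submodule ℂ (FreeAlgebra ℂ G) :=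
  Submodule.span ℂ {a | ∃ l : List G, l.length ≤ N ∧ a = (l.map (FreeAlgebra.ι ℂ)).prod}

theorem degLE_mono {N M : ℕ} (h : N ≤ M) : degLE G N ≤ degLE G M :=
  Submodule.span_mono fun _ ⟨l, hl, e⟩ => ⟨l, hl.trans h, e⟩

theorem ι_mul_mem_degLE {N : ℕ} (X : G) {a : FreeAlgebra ℂ G} (ha : a ∈ degLE G N) :
    FreeAlgebra.ι ℂ X * a ∈ degLE G (N + 1) := by
  refine Submodule.span_induction (p := fun a _ => FreeAlgebra.ι ℂ X * a ∈ degLE G (N + 1))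
    ?_ (by simp) ?_ ?_ ha
  · rintro _ ⟨l, hl, rfl⟩
    exact Submodule.subset_span ⟨X :: l, by simpa using hl, by simp⟩
  · intro a b _ _ ha hb; rw [mul_add]; exact Submodule.add_mem _ ha hb
  · intro r a _ ha; rw [mul_smul_comm]; exact Submodule.smul_mem _ _ ha

theorem exists_mem_degLE (a : FreeAlgebra ℂ G) : ∃ N, a ∈ degLE G N := by
  let S : Submodule ℂ (FreeAlgebra ℂ G) :=
    { carrier := {a | ∃ N, a ∈ degLE G N}
      zero_mem' := ⟨0, Submodule.zero_mem _⟩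
      add_mem' := by
        rintro a b ⟨N, hN⟩ ⟨M, hM⟩
        exact ⟨max N M, Submodule.add_mem _ (degLE_mono (le_max_left _ _) hN)
          (degLE_mono (le_max_right _ _) hM)⟩
      smul_mem' := by
        rintro r a ⟨N, hN⟩; exact ⟨N, Submodule.smul_mem _ _ hN⟩ }
  exact freeAlgebra_left_induction S ⟨0, Submodule.subset_span ⟨[], by simp, by simp⟩⟩
    (fun X b ⟨N, hN⟩ => ⟨N + 1, ι_mul_mem_degLE X hN⟩) a

/-- Induction on the length of words: a submodule is everything if it contains `1` and every
product `X * a` such that it contains all words that are not longer than those in `a`. -/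
theorem freeAlgebra_length_induction (S : Submodule ℂ (FreeAlgebra ℂ G)) (h1 : 1 ∈ S)
    (hmul : ∀ N, degLE G N ≤ S → ∀ X, ∀ a ∈ degLE G N, FreeAlgebra.ι ℂ X * a ∈ S)
    (a : FreeAlgebra ℂ G) : a ∈ S := by
  have key : ∀ N, degLE G N ≤ S := by
    intro N
    induction N with
    | zero =>
      refine Submodule.span_le.2 ?_
      rintro _ ⟨l, hl, rfl⟩
      obtain rfl : l = [] := by simpa using hl
      simpa using h1
    | succ N ih =>
      refine Submodule.span_le.2 ?_
      rintro _ ⟨l, hl, rfl⟩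
      cases l with
      | nil => simpa using h1
      | cons X l =>
        simp only [List.map_cons, List.prod_cons]
        exact hmul N ih X _ (Submodule.subset_span ⟨l, by simpa using hl, rfl⟩)
  obtain ⟨N, hN⟩ := exists_mem_degLE a
  exact key N hN

/-- Contractions and sign twists do not lengthen words. After a leading letter has been contracted
by Wick's theorem, the remaining element is therefore covered by an induction hypothesis on the
length. -/
theorem map_mem_degLE (f : FreeAlgebra ℂ G →ₗ[ℂ] FreeAlgebra ℂ G) (h1 : f 1 = 0 ∨ f 1 = 1)
    (hf : ∀ X, ∃ r s : ℂ, ∀ b, f (FreeAlgebra.ι ℂ X * b) = r • b +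
      s • (FreeAlgebra.ι ℂ X * f b)) {N : ℕ} {a : FreeAlgebra ℂ G} (ha : a ∈ degLE G N) :
    f a ∈ degLE G N := by
  refine Submodule.span_induction (p := fun a _ => f a ∈ degLE G N)
    ?_ (by simp) ?_ ?_ ha
  · rintro _ ⟨l, hl, rfl⟩
    refine degLE_mono hl ?_
    clear hl ha
    induction l with
    | nil =>
      rcases h1 with h | h
      · simp [h]
      · simp only [List.map_nil, List.prod_nil, h]
        exact Submodule.subset_span ⟨[], by simp, by simp⟩
    | cons X l ih =>
      obtain ⟨r, s, h⟩ := hf X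
      simp only [List.map_cons, List.prod_cons, h]
      refine Submodule.add_mem _ (Submodule.smul_mem _ _ ?_)
        (Submodule.smul_mem _ _ (ι_mul_mem_degLE X ih))
      exact Submodule.subset_span ⟨l, by simp, rfl⟩
  · intro a b _ _ ha hb; rw [map_add]; exact Submodule.add_mem _ ha hb
  · intro r a _ ha; rw [map_smul]; exact Submodule.smul_mem _ _ ha

end TwistedDerivation

/-! ### Gaussian functionals on a free superalgebra -/

/-- The sign picked up when letters of the given parities are exchanged. -/
def koszul (a b : Bool) : ℂ := if a && b then -1 else 1

theorem koszul_comm (a b : Bool) : koszul a b = koszul b a := by cases a <;> cases b <;> rfl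
theorem koszul_sq (a b : Bool) : koszul a b * koszul a b = 1 := by
  cases a <;> cases b <;> simp [koszul]
@[simp] theorem koszul_false' (b : Bool) : koszul b false = 1 := by simp [koszul]
@[simp] theorem koszul_true : koszul true true = -1 := by simp [koszul]

section
variable {G : Type*}

/-- The automorphism that changes the sign of the fermionic letters if `b` is `true`. -/
def twist (par : G → Bool) (b : Bool) : FreeAlgebra ℂ G →ₐ[ℂ] FreeAlgebra ℂ G :=
  FreeAlgebra.lift ℂ fun Y => koszul b (par Y) • FreeAlgebra.ι ℂ Y

theorem twist_ι (par : G → Bool) (b : Bool) (Y : G) :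
    twist par b (FreeAlgebra.ι ℂ Y) = koszul b (par Y) • FreeAlgebra.ι ℂ Y := by
  simp [twist]

/-- The contraction of a letter with the letters of a word. -/
def contract (par : G → Bool) (c : G → G → ℂ) (X : G) : FreeAlgebra ℂ G →ₗ[ℂ] FreeAlgebra ℂ G :=
  twistedDer (twist par (par X)) fun Y => algebraMap ℂ _ (c X Y)

theorem contract_ι_mul (par : G → Bool) (c : G → G → ℂ) (X Y : G) (b : FreeAlgebra ℂ G) :
    contract par c X (FreeAlgebra.ι ℂ Y * b) =
      c X Y • b + koszul (par X) (par Y) • (FreeAlgebra.ι ℂ Y * contract par c X b) := by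
  simp [contract, twistedDer_ι_mul, twist_ι, Algebra.smul_def, mul_assoc]

theorem twist_twist (par : G → Bool) (b : Bool) (x : FreeAlgebra ℂ G) :
    twist par b (twist par b x) = x := by
  have : (twist par b).comp (twist par b) = AlgHom.id ℂ _ := by
    refine FreeAlgebra.hom_ext ?_
    funext X
    simp [twist_ι, smul_smul, koszul_sq]
  exact DFunLike.congr_fun this x

end

/-- A functional on a free superalgebra that satisfies Wick's theorem. -/
structure WickFunctional (G : Type*) where
  /-- Which letters are fermionic. -/
  par : G → Bool
  /-- The contraction of two letters. -/
  c : G → G → ℂ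
  /-- The expectation value. -/
  W : FreeAlgebra ℂ G →ₗ[ℂ] ℂ
  c_symm : ∀ X Y, c X Y = koszul (par X) (par Y) * c Y X
  c_par : ∀ X Y, par X ≠ par Y → c X Y = 0
  W_one : W 1 = 1
  W_ι_mul : ∀ X x, W (FreeAlgebra.ι ℂ X * x) = W (contract par c X x)

namespace WickFunctional

variable {G : Type*} (F : WickFunctional G)

/-- Contracted letters have the same parity, so the signs for moving both past a third letter
cancel. -/
theorem koszul_mul_c (a : Bool) (Y Z : G) :
    koszul a (F.par Y) * koszul a (F.par Z) * F.c Y Z = F.c Y Z := by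
  by_cases h : F.par Y = F.par Z
  · rw [h, koszul_sq, one_mul]
  · rw [F.c_par _ _ h, mul_zero]

/-- Both composites satisfy the same recursion in the leading letter of the word, because signs of
contracted pairs cancel by `koszul_mul_c`. -/
theorem contract_contract (X Y : G) (x : FreeAlgebra ℂ G) :
    contract F.par F.c X (contract F.par F.c Y x) =
      koszul (F.par X) (F.par Y) • contract F.par F.c Y (contract F.par F.c X x) := by
  have := freeAlgebra_left_induction (G := G)
    (LinearMap.eqLocus (contract F.par F.c X ∘ₗ contract F.par F.c Y)
      (koszul (F.par X) (F.par Y) • (contract F.par F.c Y ∘ₗ contract F.par F.c X)))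
    (by simp [contract, twistedDer_one]) ?_ x
  · simpa using this
  intro Z b hb
  simp only [LinearMap.mem_eqLocus, LinearMap.comp_apply, LinearMap.smul_apply] at hb ⊢
  simp only [contract_ι_mul, map_add, map_smul, hb, smul_add, smul_smul, mul_smul_comm]
  have h1 := F.koszul_mul_c (F.par X) Y Z
  have h2 := F.koszul_mul_c (F.par Y) X Z
  rw [koszul_comm (F.par Y) (F.par X)] at h2
  have h3 := koszul_sq (F.par X) (F.par Y)
  match_scalars
  · linear_combination (-1 : ℂ) * h1
  · linear_combination koszul (F.par X) (F.par Y) * h2 - koszul (F.par Y) (F.par Z) * F.c X Z * h3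
  · ring

theorem twist_contract (b : Bool) (X : G) (x : FreeAlgebra ℂ G) :
    twist F.par b (contract F.par F.c X x) =
      koszul b (F.par X) • contract F.par F.c X (twist F.par b x) := by
  have := freeAlgebra_left_induction (G := G)
    (LinearMap.eqLocus ((twist F.par b).toLinearMap ∘ₗ contract F.par F.c X)
      (koszul b (F.par X) • (contract F.par F.c X ∘ₗ (twist F.par b).toLinearMap)))
    (by simp [contract, twistedDer_one]) ?_ x
  · simpa using this
  intro Z y hy
  simp only [LinearMap.mem_eqLocus, LinearMap.comp_apply, LinearMap.smul_apply,
    AlgHom.toLinearMap_apply] at hy ⊢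
  simp only [contract_ι_mul, map_add, map_smul, map_mul, twist_ι, hy, smul_add, smul_smul,
    mul_smul_comm, smul_mul_assoc]
  congr 2
  · rw [← mul_assoc, F.koszul_mul_c]
  · ring

theorem contract_mem_degLE (X : G) {N : ℕ} {a : FreeAlgebra ℂ G} (ha : a ∈ degLE G N) :
    contract F.par F.c X a ∈ degLE G N :=
  map_mem_degLE _ (Or.inl (by simp [contract, twistedDer_one]))
    (fun Y => ⟨_, _, fun b => contract_ι_mul _ _ X Y b⟩) ha

theorem twist_mem_degLE (s : Bool) {N : ℕ} {a : FreeAlgebra ℂ G} (ha : a ∈ degLE G N) :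
    twist F.par s a ∈ degLE G N :=
  map_mem_degLE (twist F.par s).toLinearMap (Or.inr (by simp))
    (fun Y => ⟨0, koszul s (F.par Y), fun b => by simp [twist_ι]⟩) ha

/-- Contractions pair letters of equal parity, so a word with an odd number of fermions has
expectation value zero. -/
theorem W_twist (b : Bool) (x : FreeAlgebra ℂ G) : F.W (twist F.par b x) = F.W x := by
  refine freeAlgebra_length_induction (LinearMap.eqLocus (F.W ∘ₗ (twist F.par b).toLinearMap) F.W)
    (by simp) ?_ x
  intro N hN X a ha
  have := hN (F.contract_mem_degLE X ha)
  simp only [LinearMap.mem_eqLocus, LinearMap.comp_apply, AlgHom.toLinearMap_apply] at this ⊢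
  rw [twist_contract] at this
  rw [map_mul, twist_ι, F.W_ι_mul, ← this, smul_mul_assoc, map_smul, F.W_ι_mul, map_smul]

/-- The largest two-sided ideal on which the functional vanishes. -/
def kernel : Ideal (FreeAlgebra ℂ G) where
  carrier := {x | ∀ u v, F.W (u * x * v) = 0}
  zero_mem' := by simp
  add_mem' := by intro a b ha hb u v; simp [mul_add, add_mul, ha u v, hb u v]
  smul_mem' := by
    intro r a ha u v
    simpa [mul_assoc] using ha (u * r) v

instance : F.kernel.IsTwoSided where
  mul_mem_of_left {a} b ha u v := by
    simpa [mul_assoc] using ha u (b * v)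

/-- Since `r` has no contractions, a letter to its left can only be contracted with the rest of `u`
or with `v`. Hence `u` can be used up letter by letter until `r` is leftmost, where `h2` applies.
Hypothesis `h1` controls the sign of a contraction that passes `r`. -/
theorem mem_kernel_of_contract {r : FreeAlgebra ℂ G} (h0 : ∀ Z, contract F.par F.c Z r = 0)
    (h1 : ∀ b, ∃ s : ℂ, twist F.par b r = s • r) (h2 : ∀ v, F.W (r * v) = 0) : r ∈ F.kernel := by
  intro u
  let S : Submodule ℂ (FreeAlgebra ℂ G) :=
    { carrier := {u | ∀ v, F.W (u * r * v) = 0}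
      zero_mem' := by simp
      add_mem' := by intro a b ha hb v; simp [add_mul, ha v, hb v]
      smul_mem' := by intro s a ha v; simp [ha v] }
  refine freeAlgebra_length_induction S (by simpa [S] using h2) ?_ u
  intro N hN X a ha v
  obtain ⟨s, hs⟩ := h1 (F.par X)
  have e1 := hN (F.contract_mem_degLE X ha) v
  have e2 := hN (F.twist_mem_degLE (F.par X) ha) (contract F.par F.c X v)
  rw [mul_assoc, mul_assoc, F.W_ι_mul, contract, twistedDer_mul, twistedDer_mul, ← contract, h0 X,
    hs, zero_mul, zero_add, map_add, ← mul_assoc, e1, ← mul_assoc, mul_smul_comm, smul_mul_assoc,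
    map_smul, e2]
  simp

/-- The contractions of the supercommutator cancel in pairs by `koszul_mul_c`. At the left end of a
word its value vanishes because the two-point function is graded symmetric and contractions
supercommute. -/
theorem commutator_mem_kernel (X Y : G) :
    FreeAlgebra.ι ℂ X * FreeAlgebra.ι ℂ Y -
      koszul (F.par X) (F.par Y) • (FreeAlgebra.ι ℂ Y * FreeAlgebra.ι ℂ X) ∈ F.kernel := by
  have hc : ∀ Z W, contract F.par F.c Z (FreeAlgebra.ι ℂ W) = algebraMap ℂ _ (F.c Z W) := fun Z W => by
    rw [contract, twistedDer_ι]
  refine F.mem_kernel_of_contract ?_ ?_ ?_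
  · intro Z
    rw [map_sub, map_smul, contract_ι_mul, contract_ι_mul, hc, hc, ← Algebra.commutes,
      ← Algebra.commutes, ← Algebra.smul_def, ← Algebra.smul_def, smul_add, smul_smul, smul_smul,
      smul_smul, smul_smul, sub_eq_zero]
    have e1 := F.koszul_mul_c (F.par Y) Z X
    have e2 := F.koszul_mul_c (F.par X) Z Y
    rw [koszul_comm (F.par Y) (F.par X), koszul_comm (F.par Y) (F.par Z)] at e1
    rw [koszul_comm (F.par X) (F.par Z)] at e2
    match_scalars
    · linear_combination (-1 : ℂ) * e1
    · linear_combination koszul (F.par X) (F.par Y) * e2 -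
        koszul (F.par Z) (F.par X) * F.c Z Y * koszul_sq (F.par X) (F.par Y)
  · intro b
    refine ⟨koszul b (F.par X) * koszul b (F.par Y), ?_⟩
    simp [twist_ι, smul_sub, smul_smul]
    ring_nf
  · intro v
    rw [sub_mul, map_sub, smul_mul_assoc, mul_assoc, mul_assoc, map_smul, F.W_ι_mul, F.W_ι_mul,
      contract_ι_mul, contract_ι_mul, map_add, map_add, map_smul, map_smul, map_smul, map_smul,
      F.W_ι_mul, F.W_ι_mul, contract_contract, F.c_symm X Y, map_smul]
    simp only [smul_eq_mul, koszul_comm (F.par Y) (F.par X)]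
    ring

end WickFunctional
end CombSusy
end

noncomputable section
namespace CombSusy
namespace WickFunctional

variable {G : Type*} (F : WickFunctional G)

/-! ### The supercommutative algebra of a Wick functional -/

theorem twist_mem_kernel (b : Bool) {x : FreeAlgebra ℂ G} (hx : x ∈ F.kernel) :
    twist F.par b x ∈ F.kernel := by
  intro u v
  rw [← F.W_twist b, map_mul (twist F.par b), map_mul (twist F.par b), twist_twist]
  exact hx _ _

/-- Apply `hW` to the kernel element `τ(u) x v`, with `τ` the twist. By the Leibniz rule, the terms
in which `D` does not hit `x` contain `x` itself as a factor and vanish. -/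
theorem map_mem_kernel (b : Bool) (D : FreeAlgebra ℂ G →ₗ[ℂ] FreeAlgebra ℂ G)
    (hmul : ∀ x y, D (x * y) = D x * y + twist F.par b x * D y)
    (hW : ∀ x ∈ F.kernel, F.W (D x) = 0) {x : FreeAlgebra ℂ G} (hx : x ∈ F.kernel) :
    D x ∈ F.kernel := by
  intro u v
  have h1 := hW _ (F.kernel.mul_mem_right v (F.kernel.mul_mem_left (twist F.par b u) hx))
  rw [hmul, hmul, add_mul, map_mul, twist_twist, map_add, map_add, hx,
    F.twist_mem_kernel b hx] at h1
  simpa using h1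

theorem contract_mem_kernel (X : G) {x : FreeAlgebra ℂ G} (hx : x ∈ F.kernel) :
    contract F.par F.c X x ∈ F.kernel := by
  refine F.map_mem_kernel (F.par X) _ (fun x y => twistedDer_mul _ _ x y) ?_ hx
  intro y hy
  rw [← contract, ← F.W_ι_mul]
  simpa using hy (FreeAlgebra.ι ℂ X) 1

/-- The quotient of the free algebra by the kernel of a Wick functional. -/
def Alg : Type _ := FreeAlgebra ℂ G ⧸ F.kernel

instance : Ring F.Alg := inferInstanceAs (Ring (FreeAlgebra ℂ G ⧸ F.kernel))
instance : Algebra ℂ F.Alg := inferInstanceAs (Algebra ℂ (FreeAlgebra ℂ G ⧸ F.kernel))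

/-- The quotient map. -/
def proj : FreeAlgebra ℂ G →ₐ[ℂ] F.Alg := Ideal.Quotient.mkₐ ℂ F.kernel

theorem proj_surjective : Function.Surjective F.proj := Ideal.Quotient.mk_surjective

theorem proj_eq_zero {x : FreeAlgebra ℂ G} : F.proj x = 0 ↔ x ∈ F.kernel :=
  Ideal.Quotient.eq_zero_iff_mem

theorem proj_eq_proj {x y : FreeAlgebra ℂ G} : F.proj x = F.proj y ↔ x - y ∈ F.kernel := by
  rw [← proj_eq_zero, map_sub, sub_eq_zero]

/-- A linear map that vanishes on the kernel descends to the quotient. -/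
def descend {M : Type*} [AddCommGroup M] [Module ℂ M] (f : FreeAlgebra ℂ G →ₗ[ℂ] M)
    (h : ∀ x ∈ F.kernel, f x = 0) : F.Alg →ₗ[ℂ] M where
  toFun b := f (F.proj_surjective b).choose
  map_add' a b := by
    rw [← map_add, ← sub_eq_zero, ← map_sub]
    refine h _ (F.proj_eq_proj.1 ?_)
    rw [map_add, (F.proj_surjective _).choose_spec, (F.proj_surjective _).choose_spec,
      (F.proj_surjective _).choose_spec]
  map_smul' r a := by
    rw [RingHom.id_apply, ← map_smul, ← sub_eq_zero, ← map_sub]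
    refine h _ (F.proj_eq_proj.1 ?_)
    rw [map_smul, (F.proj_surjective _).choose_spec, (F.proj_surjective _).choose_spec]

theorem descend_proj {M : Type*} [AddCommGroup M] [Module ℂ M] (f : FreeAlgebra ℂ G →ₗ[ℂ] M)
    (h : ∀ x ∈ F.kernel, f x = 0) (x : FreeAlgebra ℂ G) : F.descend f h (F.proj x) = f x := by
  change f (F.proj_surjective (F.proj x)).choose = f x
  rw [← sub_eq_zero, ← map_sub]
  exact h _ (F.proj_eq_proj.1 (F.proj_surjective (F.proj x)).choose_spec)

/-- The expectation value on the quotient. -/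
def ev : F.Alg →ₗ[ℂ] ℂ := F.descend F.W fun x hx => by simpa using hx 1 1

theorem ev_proj (x : FreeAlgebra ℂ G) : F.ev (F.proj x) = F.W x := F.descend_proj _ _ x

/-- The letters in the quotient. -/
def gen (X : G) : F.Alg := F.proj (FreeAlgebra.ι ℂ X)

theorem alg_induction (S : Submodule ℂ F.Alg) (h1 : 1 ∈ S)
    (hmul : ∀ X b, b ∈ S → F.gen X * b ∈ S) (a : F.Alg) : a ∈ S := by
  obtain ⟨a, rfl⟩ := F.proj_surjective a
  refine freeAlgebra_left_induction (S.comap F.proj.toLinearMap) (by simpa using h1) ?_ a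
  intro X b hb
  simpa [gen] using hmul X _ hb

/-- The parity automorphism as a linear map. -/
def parityLin : F.Alg →ₗ[ℂ] F.Alg :=
  F.descend (F.proj.toLinearMap ∘ₗ (twist F.par true).toLinearMap)
    fun _ hx => F.proj_eq_zero.2 (F.twist_mem_kernel true hx)

theorem parityLin_proj (x : FreeAlgebra ℂ G) :
    F.parityLin (F.proj x) = F.proj (twist F.par true x) := F.descend_proj _ _ x

/-- The parity automorphism. -/
def parity : F.Alg →ₐ[ℂ] F.Alg :=
  AlgHom.ofLinearMap F.parityLin
    (by rw [← map_one F.proj, parityLin_proj, map_one])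
    (by
      intro x y
      obtain ⟨x, rfl⟩ := F.proj_surjective x
      obtain ⟨y, rfl⟩ := F.proj_surjective y
      rw [← map_mul, parityLin_proj, parityLin_proj, parityLin_proj, map_mul, map_mul])

theorem parity_proj (x : FreeAlgebra ℂ G) : F.parity (F.proj x) = F.proj (twist F.par true x) :=
  F.parityLin_proj x

theorem parity_gen (X : G) : F.parity (F.gen X) = koszul true (F.par X) • F.gen X := by
  rw [gen, parity_proj, twist_ι, map_smul]

theorem parity_parity (x : F.Alg) : F.parity (F.parity x) = x := by
  obtain ⟨x, rfl⟩ := F.proj_surjective x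
  rw [parity_proj, parity_proj, twist_twist]

theorem gen_comm (X Y : G) :
    F.gen X * F.gen Y = koszul (F.par X) (F.par Y) • (F.gen Y * F.gen X) := by
  have := F.proj_eq_proj.2 (F.commutator_mem_kernel X Y)
  simpa [gen] using this

/-- Contraction with a letter, on the quotient. -/
def contr (X : G) : F.Alg →ₗ[ℂ] F.Alg :=
  F.descend (F.proj.toLinearMap ∘ₗ contract F.par F.c X)
    fun _ hx => F.proj_eq_zero.2 (F.contract_mem_kernel X hx)

theorem contr_proj (X : G) (x : FreeAlgebra ℂ G) :
    F.contr X (F.proj x) = F.proj (contract F.par F.c X x) := F.descend_proj _ _ x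

theorem contr_mul {X : G} (hX : F.par X = true) (a b : F.Alg) :
    F.contr X (a * b) = F.contr X a * b + F.parity a * F.contr X b := by
  obtain ⟨a, rfl⟩ := F.proj_surjective a
  obtain ⟨b, rfl⟩ := F.proj_surjective b
  rw [← map_mul, contr_proj, contr_proj, contr_proj, contract, twistedDer_mul, hX, map_add, map_mul,
    map_mul, parity_proj]

theorem contr_one (X : G) : F.contr X 1 = 0 := by
  rw [← map_one F.proj, contr_proj, contract, twistedDer_one, map_zero]

theorem contr_algebraMap (X : G) (r : ℂ) : F.contr X (algebraMap ℂ _ r) = 0 := by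
  rw [Algebra.algebraMap_eq_smul_one, map_smul, contr_one, smul_zero]

theorem contr_gen (X Y : G) : F.contr X (F.gen Y) = algebraMap ℂ _ (F.c X Y) := by
  rw [gen, contr_proj, contract, twistedDer_ι, AlgHom.commutes]

theorem parity_contr {X : G} (hX : F.par X = true) (a : F.Alg) :
    F.parity (F.contr X a) = -F.contr X (F.parity a) := by
  obtain ⟨a, rfl⟩ := F.proj_surjective a
  rw [parity_proj, contr_proj, contr_proj, parity_proj, twist_contract, hX, koszul_true]
  simp

theorem ev_one : F.ev 1 = 1 := by rw [← map_one F.proj, ev_proj, F.W_one]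

theorem ev_gen_mul (X : G) (b : F.Alg) : F.ev (F.gen X * b) = F.ev (F.contr X b) := by
  obtain ⟨b, rfl⟩ := F.proj_surjective b
  rw [gen, ← map_mul, ev_proj, contr_proj, ev_proj, F.W_ι_mul]

/-- The letters are formal symbols with no linear structure. In the quotient only their contractions
matter, and this makes the fields linear in the vectors that label them. -/
theorem gen_eq_smul_add {X Y Z : G} (r : ℂ) (hY : F.par Y = F.par X) (hZ : F.par Z = F.par X)
    (h : ∀ T, F.c X T = r * F.c Y T + F.c Z T) : F.gen X = r • F.gen Y + F.gen Z := by
  rw [gen, gen, gen, ← map_smul, ← map_add, proj_eq_proj]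
  have h' : ∀ T, F.c T X = r * F.c T Y + F.c T Z := by
    intro T
    rw [F.c_symm, h, F.c_symm T Y, F.c_symm T Z, hY, hZ]
    ring
  refine F.mem_kernel_of_contract ?_ ?_ ?_
  · intro T
    rw [map_sub, map_add, map_smul]
    simp only [contract, twistedDer_ι, h', map_mul, map_add, Algebra.smul_def]
    abel
  · intro b
    refine ⟨koszul b (F.par X), ?_⟩
    simp only [map_sub, map_add, map_smul, twist_ι, hY, hZ]
    module
  · intro v
    rw [sub_mul, add_mul, smul_mul_assoc, map_sub, map_add, map_smul, F.W_ι_mul, F.W_ι_mul,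
      F.W_ι_mul, ← map_smul, ← map_add, ← map_sub]
    have : contract F.par F.c X v - (r • contract F.par F.c Y v + contract F.par F.c Z v) = 0 := by
      have := freeAlgebra_left_induction (LinearMap.ker (contract F.par F.c X -
        (r • contract F.par F.c Y + contract F.par F.c Z))) (by simp [contract, twistedDer_one])
        ?_ v
      · simpa using this
      intro T b hb
      simp only [LinearMap.mem_ker, LinearMap.sub_apply, LinearMap.add_apply,
        LinearMap.smul_apply, sub_eq_zero] at hb ⊢
      rw [contract_ι_mul, contract_ι_mul, contract_ι_mul, hb, h, hY, hZ, mul_add, mul_smul_comm]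
      module
    rw [this, map_zero]

/-- The odd derivation exchanging each letter `X` for `a X` times its superpartner `p X`. -/
def susyFree (a : G → ℂ) (p : G → G) : FreeAlgebra ℂ G →ₗ[ℂ] FreeAlgebra ℂ G :=
  twistedDer (twist F.par true) fun X => a X • FreeAlgebra.ι ℂ (p X)

/-- A pairing of the letters with superpartners that leaves all contractions invariant. -/
structure Susy where
  /-- The coefficients. -/
  a : G → ℂ
  /-- The superpartners. -/
  p : G → G
  par_p : ∀ X, F.par (p X) = !F.par X
  inv : ∀ X Z, a X * F.c (p X) Z + koszul true (F.par X) * a Z * F.c X (p Z) = 0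

variable {F} (s : F.Susy)

/-- The graded commutator of the symmetry with contraction by a letter is contraction by its
superpartner. On a single letter this is the invariance `inv` of the two-point function; the rest is
the Leibniz rule. -/
theorem susyFree_contract (X : G) (x : FreeAlgebra ℂ G) :
    s.a X • contract F.par F.c (s.p X) x +
      koszul true (F.par X) • contract F.par F.c X (F.susyFree s.a s.p x) =
      F.susyFree s.a s.p (contract F.par F.c X x) := by
  have := freeAlgebra_left_induction (LinearMap.ker (s.a X • contract F.par F.c (s.p X) +
      koszul true (F.par X) • (contract F.par F.c X ∘ₗ (F.susyFree s.a s.p)) -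
      F.susyFree s.a s.p ∘ₗ contract F.par F.c X)) (by simp [contract, susyFree, twistedDer_one])
        ?_ x
  · simpa [sub_eq_zero] using this
  intro Z b hb
  simp only [LinearMap.mem_ker, LinearMap.sub_apply, LinearMap.add_apply,
        LinearMap.smul_apply, LinearMap.comp_apply, sub_eq_zero] at hb ⊢
  have hs : ∀ (T : G) (y : FreeAlgebra ℂ G), F.susyFree s.a s.p (FreeAlgebra.ι ℂ T * y) =
      s.a T • (FreeAlgebra.ι ℂ (s.p T) * y) +
        koszul true (F.par T) • (FreeAlgebra.ι ℂ T * F.susyFree s.a s.p y) := by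
    intro T y
    simp [susyFree, twistedDer_ι_mul, twist_ι]
  rw [contract_ι_mul, contract_ι_mul, hs, map_add, map_add, map_smul, map_smul, map_smul, map_smul,
    hs, contract_ι_mul, contract_ι_mul, ← hb, s.par_p, s.par_p, mul_add, mul_smul_comm,
    mul_smul_comm]
  have h1 := s.inv X Z
  have h2 : koszul true (F.par X) * koszul true (F.par Z) * F.c X Z = F.c X Z := by
    by_cases h : F.par X = F.par Z
    · rw [h, koszul_sq, one_mul]
    · rw [F.c_par _ _ h, mul_zero]
  have h3 : ∀ u v, koszul (!u) v = koszul u v * koszul true v := by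
    intro u v; cases u <;> cases v <;> simp [koszul]
  have h4 : koszul (F.par X) (!F.par Z) = koszul (F.par X) (F.par Z) * koszul true (F.par X) := by
    generalize F.par X = u; generalize F.par Z = v
    cases u <;> cases v <;> simp [koszul]
  rw [h3, h4]
  have h5 := koszul_sq true (F.par X)
  match_scalars
  · linear_combination h1
  · ring
  · linear_combination (s.a Z * koszul (F.par X) (F.par Z)) * h5
  · linear_combination h2
  · ring

/-- Invariance of the two-point function suffices in a Gaussian theory: Wick's theorem turns the
variation of `X b` into the variation of the contraction of `X` with `b`, which has shorter words.
-/
theorem W_susyFree (x : FreeAlgebra ℂ G) : F.W (F.susyFree s.a s.p x) = 0 := by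
  refine freeAlgebra_length_induction (LinearMap.ker (F.W ∘ₗ F.susyFree s.a s.p))
    (by simp [susyFree, twistedDer_one]) ?_ x
  intro N hN X b hb
  have h := hN (F.contract_mem_degLE X hb)
  simp only [LinearMap.mem_ker, LinearMap.comp_apply] at h ⊢
  rw [← susyFree_contract, map_add, map_smul, map_smul] at h
  rw [susyFree, twistedDer_ι_mul, twist_ι, ← susyFree, map_add, smul_mul_assoc, smul_mul_assoc,
    map_smul, map_smul, F.W_ι_mul, F.W_ι_mul, h]

/-- The odd derivation on the quotient. -/
def susy : F.Alg →ₗ[ℂ] F.Alg :=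
  F.descend (F.proj.toLinearMap ∘ₗ F.susyFree s.a s.p)
    fun _ hx => F.proj_eq_zero.2 (F.map_mem_kernel true _ (fun x y => twistedDer_mul _ _ x y)
      (fun x _ => W_susyFree s x) hx)

theorem susy_proj (x : FreeAlgebra ℂ G) : susy s (F.proj x) = F.proj (F.susyFree s.a s.p x) :=
  F.descend_proj _ _ x

theorem susy_mul (a b : F.Alg) : susy s (a * b) = susy s a * b + F.parity a * susy s b := by
  obtain ⟨a, rfl⟩ := F.proj_surjective a
  obtain ⟨b, rfl⟩ := F.proj_surjective b
  rw [← map_mul, susy_proj, susy_proj, susy_proj, susyFree, twistedDer_mul, map_add, map_mul,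
    map_mul, parity_proj]

theorem susy_one : susy s 1 = 0 := by
  rw [← map_one F.proj, susy_proj, susyFree, twistedDer_one, map_zero]

theorem susy_gen (X : G) : susy s (F.gen X) = s.a X • F.gen (s.p X) := by
  rw [gen, susy_proj, susyFree, twistedDer_ι, map_smul, gen]

theorem ev_susy (a : F.Alg) : F.ev (susy s a) = 0 := by
  obtain ⟨a, rfl⟩ := F.proj_surjective a
  rw [susy_proj, ev_proj, W_susyFree]

end WickFunctional
end CombSusy
end

noncomputable section
namespace CombSusy

/-! ### Wick's theorem for the worldsheet fields -/

theorem contract_word {G : Type*} (par : G → Bool) (c : G → G → ℂ) (X : G) (l : List G) :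
    contract par c X (l.map (FreeAlgebra.ι ℂ)).prod = ∑ j : Fin l.length,
      ((if par X then (-1 : ℂ) ^ ((l.take j).countP par) else 1) * c X l[j]) •
        ((l.eraseIdx j).map (FreeAlgebra.ι ℂ)).prod := by
  induction l with
  | nil => simp [contract, twistedDer_one]
  | cons Y l ih =>
    rw [List.map_cons, List.prod_cons, contract_ι_mul, ih]
    rw [show (∑ j : Fin (Y :: l).length, ((if par X then (-1 : ℂ) ^ (((Y :: l).take j).countP par)
      else 1) * c X (Y :: l)[j]) • (((Y :: l).eraseIdx j).map (FreeAlgebra.ι ℂ)).prod) =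
      ∑ j : Fin (l.length + 1), ((if par X then (-1 : ℂ) ^ (((Y :: l).take j).countP par)
      else 1) * c X (Y :: l)[(j : ℕ)]) • (((Y :: l).eraseIdx j).map (FreeAlgebra.ι ℂ)).prod from rfl]
    rw [Fin.sum_univ_succ, Finset.mul_sum, Finset.smul_sum]
    congr 1
    · simp
    · refine Finset.sum_congr rfl fun j _ => ?_
      simp only [Fin.val_succ, List.take_succ_cons, List.getElem_cons_succ, List.eraseIdx_cons_succ,
        List.map_cons, List.prod_cons, List.countP_cons, mul_smul_comm, smul_smul, Fin.getElem_fin]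
      congr 1
      cases par X <;> cases par Y <;> simp [koszul, pow_succ]

section

variable {n : ℕ} {V 𝔤 : Type*} [AddCommGroup V] [Module ℂ V] [LieRing 𝔤] [LieAlgebra ℂ 𝔤]
  (η : BilinForm ℂ V) (κ : BilinForm ℂ 𝔤) (σ : Fin n → ℂ)

/-- The matter correlator as a linear functional. -/
def matterLin : FieldPoly n V 𝔤 →ₗ[ℂ] ℂ where
  toFun := matterCorrelator η κ σ
  map_add' a b := by
    unfold matterCorrelator
    rw [map_add, MonoidAlgebra.coeff_add, Finsupp.sum_add_index'] <;> intros <;> ring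
  map_smul' r a := by
    unfold matterCorrelator
    rw [map_smul, MonoidAlgebra.coeff_smul, Finsupp.sum_smul_index', RingHom.id_apply,
      Finsupp.smul_sum]
    · simp [mul_assoc]
    · simp

theorem matterLin_word (l : List (Field V 𝔤 × Fin n)) :
    matterLin η κ σ (l.map (FreeAlgebra.ι ℂ)).prod = wick η κ σ l := by
  have : FreeAlgebra.equivMonoidAlgebraFreeMonoid (R := ℂ) (l.map (FreeAlgebra.ι ℂ)).prod =
      MonoidAlgebra.single (FreeMonoid.ofList l) 1 := by
    induction l with
    | nil => simp [MonoidAlgebra.one_def]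
    | cons X l ih =>
      rw [List.map_cons, List.prod_cons, map_mul, ih]
      simp [FreeAlgebra.equivMonoidAlgebraFreeMonoid, MonoidAlgebra.single_mul_single]
  change matterCorrelator η κ σ _ = _
  rw [matterCorrelator, this, MonoidAlgebra.coeff_single, Finsupp.sum_single_index] <;> simp

theorem contraction_symm (hη : η.IsSymm) (hκ : κ.IsSymm) (X Y : Field V 𝔤 × Fin n) :
    contraction η κ σ X Y =
      koszul X.1.fermionic Y.1.fermionic * contraction η κ σ Y X := by
  obtain ⟨X, i⟩ := X
  obtain ⟨Y, j⟩ := Y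
  have h1 : (σ j - σ i) = -(σ i - σ j) := by ring
  have hη' : ∀ x y, η x y = η y x := fun x y => by simpa using hη.eq x y
  have hκ' : ∀ x y, κ x y = κ y x := fun x y => by simpa using hκ.eq x y
  by_cases hij : i = j
  · simp [contraction, hij]
  · simp only [contraction, hij, Ne.symm hij, if_false, h1]
    cases X <;> cases Y <;> simp [opeCoeff, Field.fermionic, koszul, div_neg, neg_div, -neg_sub]
    · rw [hη']
    all_goals rw [hκ']

theorem contraction_parity (X Y : Field V 𝔤 × Fin n) (h : X.1.fermionic ≠ Y.1.fermionic) :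
    contraction η κ σ X Y = 0 := by
  obtain ⟨X, i⟩ := X
  obtain ⟨Y, j⟩ := Y
  cases X <;> cases Y <;> simp_all [contraction, opeCoeff, Field.fermionic]

/-- The matter correlator as a Wick functional. -/
def matterWick (hη : η.IsSymm) (hκ : κ.IsSymm) : WickFunctional (Field V 𝔤 × Fin n) where
  par X := X.1.fermionic
  c := contraction η κ σ
  W := matterLin η κ σ
  c_symm := contraction_symm η κ σ hη hκ
  c_par := contraction_parity η κ σ
  W_one := by
    have := matterLin_word η κ σ []
    rw [wick] at this
    simpa using this
  W_ι_mul X x := by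
    obtain ⟨N, hN⟩ := exists_mem_degLE x
    refine Submodule.span_induction (p := fun x _ => matterLin η κ σ (FreeAlgebra.ι ℂ X * x) =
      matterLin η κ σ (contract (fun X => X.1.fermionic) (contraction η κ σ) X x)) ?_ ?_ ?_ ?_ hN
    -- On words, both sides are the defining recursion of `wick`.
    · rintro _ ⟨l, -, rfl⟩
      rw [← List.prod_cons, ← List.map_cons, matterLin_word, wick, contract_word, map_sum]
      refine Finset.sum_congr rfl fun j _ => ?_
      rw [map_smul, matterLin_word, smul_eq_mul]
    · simp
    · intro a b _ _ ha hb; rw [mul_add, map_add, map_add, map_add, ha, hb]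
    · intro r a _ ha; rw [mul_smul_comm, map_smul, map_smul, map_smul, ha]

end

end CombSusy
end

/-! ### Even central and odd elements of the quotient algebra -/

noncomputable section
namespace CombSusy

theorem Derivation.leibniz_prod {R A : Type*} [CommRing R] [CommRing A] [Algebra R A]
    (D : Derivation R A A) {α : Type*} [DecidableEq α] (s : Finset α) (f : α → A) :
    D (∏ j ∈ s, f j) = ∑ j ∈ s, D (f j) * ∏ k ∈ s.erase j, f k := by
  induction s using Finset.induction_on with
  | empty => simp
  | insert a s ha ih =>
    rw [Finset.prod_insert ha, Derivation.leibniz, ih, Finset.sum_insert ha,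
      Finset.erase_insert ha, smul_eq_mul, smul_eq_mul, Finset.mul_sum, add_comm]
    congr 1
    · ring
    · refine Finset.sum_congr rfl fun j hj => ?_
      have hja : a ≠ j := fun h => ha (h ▸ hj)
      rw [Finset.erase_insert_of_ne hja, Finset.prod_insert (fun h => ha (Finset.mem_of_mem_erase h))]
      ring

namespace WickFunctional

variable {G : Type*} (F : WickFunctional G)

/-- The even central elements. -/
def evenCenter : Subalgebra ℂ F.Alg where
  carrier := {z | F.parity z = z ∧ ∀ b, b * z = z * b}
  mul_mem' := by
    rintro a b ⟨ha, ha'⟩ ⟨hb, hb'⟩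
    refine ⟨by rw [map_mul, ha, hb], fun x => ?_⟩
    rw [← mul_assoc, ha', mul_assoc, hb', mul_assoc]
  add_mem' := by
    rintro a b ⟨ha, ha'⟩ ⟨hb, hb'⟩
    exact ⟨by rw [map_add, ha, hb], fun x => by rw [mul_add, add_mul, ha', hb']⟩
  algebraMap_mem' r := ⟨by simp, fun b => (Algebra.commutes r b).symm⟩

instance : CommRing F.evenCenter :=
  { (inferInstance : Ring F.evenCenter) with
    mul_comm := fun a b => Subtype.ext (b.2.2 a) }

/-- The odd elements. -/
def oddPart : Submodule ℂ F.Alg where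
  carrier := {z | F.parity z = -z ∧ ∀ b, b * z = z * F.parity b}
  zero_mem' := by simp
  add_mem' := by
    rintro a b ⟨ha, ha'⟩ ⟨hb, hb'⟩
    exact ⟨by rw [map_add, ha, hb]; abel, fun x => by rw [mul_add, add_mul, ha', hb']⟩
  smul_mem' := by
    rintro r a ⟨ha, ha'⟩
    exact ⟨by rw [map_smul, ha, smul_neg], fun x => by rw [mul_smul_comm, ha', smul_mul_assoc]⟩

variable {F}

theorem mul_mem_evenCenter {a b : F.Alg} (ha : a ∈ F.oddPart) (hb : b ∈ F.oddPart) :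
    a * b ∈ F.evenCenter := by
  refine ⟨by rw [map_mul, ha.1, hb.1, neg_mul_neg], fun x => ?_⟩
  rw [← mul_assoc, ha.2, mul_assoc, hb.2, parity_parity, mul_assoc]

theorem odd_mul_odd {a b : F.Alg} (ha : a ∈ F.oddPart) (hb : b ∈ F.oddPart) :
    a * b = -(b * a) := by
  rw [hb.2, ha.1, mul_neg]

theorem odd_mul_self {a : F.Alg} (ha : a ∈ F.oddPart) : a * a = 0 := by
  have h := odd_mul_odd ha ha
  have h2 : (2 : ℂ) • (a * a) = 0 := by
    rw [two_smul]; nth_rw 1 [h]; simp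
  simpa using h2

theorem gen_mem_oddPart {X : G} (hX : F.par X = true) : F.gen X ∈ F.oddPart := by
  refine ⟨by rw [parity_gen, hX]; simp, fun b => ?_⟩
  refine F.alg_induction (LinearMap.eqLocus (LinearMap.mulRight ℂ (F.gen X))
    (LinearMap.mulLeft ℂ (F.gen X) ∘ₗ F.parity.toLinearMap)) (by simp) ?_ b
  intro Y b hb
  simp only [LinearMap.mem_eqLocus, LinearMap.mulRight_apply, LinearMap.comp_apply,
    LinearMap.mulLeft_apply, AlgHom.toLinearMap_apply] at hb ⊢
  rw [mul_assoc, hb, ← mul_assoc, gen_comm, map_mul, parity_gen, hX, koszul_comm]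
  simp [mul_assoc]

theorem gen_mem_evenCenter {X : G} (hX : F.par X = false) : F.gen X ∈ F.evenCenter := by
  refine ⟨by rw [parity_gen, hX]; simp, fun b => ?_⟩
  refine F.alg_induction (LinearMap.eqLocus (LinearMap.mulRight ℂ (F.gen X))
    (LinearMap.mulLeft ℂ (F.gen X))) (by simp) ?_ b
  intro Y b hb
  simp only [LinearMap.mem_eqLocus, LinearMap.mulRight_apply,
    LinearMap.mulLeft_apply] at hb ⊢
  rw [mul_assoc, hb, ← mul_assoc, gen_comm, hX]
  simp [mul_assoc]

/-- Contracting both sides of the relation that `z` commutes with everything leaves this relation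
for the contraction of `z`. -/
theorem contr_even_comm {X : G} (hX : F.par X = true) {z : F.Alg} (hz : z ∈ F.evenCenter)
    (b : F.Alg) : b * F.contr X z = F.contr X z * F.parity b := by
  have h := congrArg (F.contr X) (hz.2 (F.parity b))
  rw [contr_mul F hX, contr_mul F hX, parity_parity, hz.1, hz.2, add_comm] at h
  exact add_right_cancel h

/-- The even derivation `θ ∂_X` for an odd element `θ` and a fermionic letter `X`. -/
def oddContr (θ : F.oddPart) (X : G) (hX : F.par X = true) :
    Derivation ℂ F.evenCenter F.evenCenter where
  toFun z := ⟨θ * F.contr X z, by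
    refine ⟨?_, fun b => ?_⟩
    · rw [map_mul, θ.2.1, parity_contr F hX, z.2.1, neg_mul_neg]
    · rw [← mul_assoc, θ.2.2, mul_assoc, contr_even_comm hX z.2, parity_parity, mul_assoc]⟩
  map_add' a b := Subtype.ext (by simp [mul_add])
  map_smul' r a := Subtype.ext (by simp)
  map_one_eq_zero' := Subtype.ext (by simp [contr_one])
  leibniz' a b := Subtype.ext (by
    simp only [MulMemClass.coe_mul, LinearMap.coe_mk, AddHom.coe_mk, Subalgebra.coe_add, smul_eq_mul]
    rw [contr_mul F hX, a.2.1, mul_add, ← mul_assoc, ← mul_assoc, ← mul_assoc, a.2.2, b.2.2]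
    simp only [mul_assoc]
    rw [add_comm])

/-- Moving the letter to the left past `θ` gives a sign, and moving its contraction back past `θ`
gives a second one. -/
theorem ev_odd_mul_gen_mul {θ : F.Alg} (hθ : θ ∈ F.oddPart) {X : G} (hX : F.par X = true)
    (h : F.contr X θ = 0) (z : F.Alg) :
    F.ev (θ * F.gen X * z) = F.ev (θ * F.contr X z) := by
  rw [odd_mul_odd hθ (gen_mem_oddPart hX), neg_mul, map_neg, mul_assoc, ev_gen_mul, contr_mul F hX,
    h, hθ.1]
  simp

end WickFunctional
end CombSusy
end

/-! ### The worldsheet fields, their supersymmetry and the currents -/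

noncomputable section
namespace CombSusy

/-- A family of letters depending linearly on a parameter, as a linear map. -/
def WickFunctional.genLin {G E : Type*} [AddCommGroup E] [Module ℂ E] (F : WickFunctional G)
    (A : E → G) (hp : ∀ x y, F.par (A x) = F.par (A y))
    (h : ∀ (r : ℂ) x y T, F.c (A (r • x + y)) T = r * F.c (A x) T + F.c (A y) T) :
    E →ₗ[ℂ] F.Alg :=
  have key : ∀ (r : ℂ) x y, F.gen (A (r • x + y)) = r • F.gen (A x) + F.gen (A y) := fun r x y =>
    F.gen_eq_smul_add r (hp _ _) (hp _ _) (h r x y)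
  have h0 : F.gen (A 0) = 0 := by simpa using key 1 0 0
  { toFun := fun x => F.gen (A x)
    map_add' := fun x y => by simpa using key 1 x y
    map_smul' := fun r x => by simpa [h0] using key r x 0 }

/-- The forms, punctures and a basis of the Lie algebra that determine the matter correlators. -/
structure MatterData (n : ℕ) (V 𝔤 ι : Type*) [AddCommGroup V] [Module ℂ V]
    [LieRing 𝔤] [LieAlgebra ℂ 𝔤] [Fintype ι] [DecidableEq ι] where
  /-- The form on space-time. -/
  η : BilinForm ℂ V
  η_symm : η.IsSymm
  /-- The form on the Lie algebra. -/
  κ : BilinForm ℂ 𝔤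
  κ_nondeg : κ.Nondegenerate
  κ_symm : κ.IsSymm
  κ_inv : κ.lieInvariant 𝔤
  /-- A basis of the Lie algebra. -/
  e : Basis ι ℂ 𝔤
  /-- The punctures. -/
  σ : Fin n → ℂ

namespace MatterData

open WickFunctional

variable {n : ℕ} {V 𝔤 ι : Type*} [AddCommGroup V] [Module ℂ V]
    [LieRing 𝔤] [LieAlgebra ℂ 𝔤] [Fintype ι] [DecidableEq ι] (M : MatterData n V 𝔤 ι)

theorem κ_comm (x y : 𝔤) : M.κ x y = M.κ y x := by simpa using M.κ_symm.eq x y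

theorem κ_lie (t s x : 𝔤) : M.κ t ⁅s, x⁆ = M.κ ⁅t, s⁆ x := by
  have h := M.κ_inv s t x
  rw [← lie_skew t s, map_neg, LinearMap.neg_apply, h, neg_neg]

/-- The Wick functional of the matter fields. -/
def F : WickFunctional (Field V 𝔤 × Fin n) := matterWick M.η M.κ M.σ M.η_symm M.κ_symm

theorem F_c (X Y : Field V 𝔤 × Fin n) : M.F.c X Y = contraction M.η M.κ M.σ X Y := rfl

/-- The field `v · Ψ` at a puncture. -/
def psi (i : Fin n) : V →ₗ[ℂ] M.F.Alg :=
  M.F.genLin (fun v => (.psi v, i)) (fun _ _ => rfl) (by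
    rintro r x y ⟨T, j⟩
    by_cases h : i = j <;> cases T <;> simp [F, matterWick, contraction, opeCoeff, h]; ring)

/-- The field `t · ρ` at a puncture. -/
def rho (i : Fin n) : 𝔤 →ₗ[ℂ] M.F.Alg :=
  M.F.genLin (fun v => (.rho v, i)) (fun _ _ => rfl) (by
    rintro r x y ⟨T, j⟩
    by_cases h : i = j <;> cases T <;> simp [F, matterWick, contraction, opeCoeff, h]; ring)

/-- The field `t · ρ̃` at a puncture. -/
def rhoT (i : Fin n) : 𝔤 →ₗ[ℂ] M.F.Alg :=
  M.F.genLin (fun v => (.rhoTilde v, i)) (fun _ _ => rfl) (by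
    rintro r x y ⟨T, j⟩
    by_cases h : i = j <;> cases T <;> simp [F, matterWick, contraction, opeCoeff, h]; ring)

/-- The field `t · q` at a puncture. -/
def q (i : Fin n) : 𝔤 →ₗ[ℂ] M.F.Alg :=
  M.F.genLin (fun v => (.q v, i)) (fun _ _ => rfl) (by
    rintro r x y ⟨T, j⟩
    by_cases h : i = j <;> cases T <;> simp [F, matterWick, contraction, opeCoeff, h]; ring)

/-- The field `t · y` at a puncture. -/
def y (i : Fin n) : 𝔤 →ₗ[ℂ] M.F.Alg :=
  M.F.genLin (fun v => (.y v, i)) (fun _ _ => rfl) (by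
    rintro r x y ⟨T, j⟩
    by_cases h : i = j <;> cases T <;> simp [F, matterWick, contraction, opeCoeff, h]; ring)

theorem psi_apply (i : Fin n) (v : V) : M.psi i v = M.F.gen (.psi v, i) := rfl
theorem rho_apply (i : Fin n) (v : 𝔤) : M.rho i v = M.F.gen (.rho v, i) := rfl
theorem rhoT_apply (i : Fin n) (v : 𝔤) : M.rhoT i v = M.F.gen (.rhoTilde v, i) := rfl
theorem q_apply (i : Fin n) (v : 𝔤) : M.q i v = M.F.gen (.q v, i) := rfl
theorem y_apply (i : Fin n) (v : 𝔤) : M.y i v = M.F.gen (.y v, i) := rfl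

/-- The supersymmetry exchanging `q` with `ρ` and `ρ̃` with `y`. -/
def susyData : M.F.Susy where
  a X := match X.1 with
    | .q _ => 1
    | .rhoTilde _ => 1
    | _ => 0
  -- The superpartners of `ρ`, `y` and `Ψ` have coefficient zero and only need to have the opposite
  -- parity.
  p X := (match X.1 with
    | .q t => .rho t
    | .rhoTilde t => .y t
    | .rho t => .y t
    | .y t => .rho t
    | .psi _ => .q 0, X.2)
  par_p X := by
    obtain ⟨X, i⟩ := X
    cases X <;> rfl
  inv X Z := by
    obtain ⟨X, i⟩ := X
    obtain ⟨Z, j⟩ := Z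
    by_cases h : i = j <;> cases X <;> cases Z <;>
      simp [F, matterWick, contraction, opeCoeff, h, koszul, Field.fermionic, neg_div]

/-- The supersymmetry on the algebra of fields. -/
abbrev Q : M.F.Alg →ₗ[ℂ] M.F.Alg := susy M.susyData

/-- Contraction with `s · ρ` at a puncture. -/
abbrev dRho (s : 𝔤) (i : Fin n) : M.F.Alg →ₗ[ℂ] M.F.Alg := M.F.contr (.rho s, i)

/-- Contraction with `s · ρ̃` at a puncture. -/
abbrev dRhoT (s : 𝔤) (i : Fin n) : M.F.Alg →ₗ[ℂ] M.F.Alg := M.F.contr (.rhoTilde s, i)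

section values
variable (s : 𝔤) (i j : Fin n) (v : V) (t : 𝔤)

theorem Q_psi : M.Q (M.psi i v) = 0 := by rw [psi_apply, susy_gen]; exact zero_smul ℂ _
theorem Q_rho : M.Q (M.rho i t) = 0 := by rw [rho_apply, susy_gen]; exact zero_smul ℂ _
theorem Q_y : M.Q (M.y i t) = 0 := by rw [y_apply, susy_gen]; exact zero_smul ℂ _
theorem Q_q : M.Q (M.q i t) = M.rho i t := by rw [q_apply, susy_gen]; exact one_smul ℂ _
theorem Q_rhoT : M.Q (M.rhoT i t) = M.y i t := by rw [rhoT_apply, susy_gen]; exact one_smul ℂ _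

theorem dRho_psi : M.dRho s i (M.psi j v) = 0 := by
  rw [psi_apply, contr_gen, F_c]; simp [contraction, opeCoeff]
theorem dRho_rho : M.dRho s i (M.rho j t) = 0 := by
  rw [rho_apply, contr_gen, F_c]; simp [contraction, opeCoeff]
theorem dRhoT_psi : M.dRhoT s i (M.psi j v) = 0 := by
  rw [psi_apply, contr_gen, F_c]; simp [contraction, opeCoeff]
theorem dRhoT_rhoT : M.dRhoT s i (M.rhoT j t) = 0 := by
  rw [rhoT_apply, contr_gen, F_c]; simp [contraction, opeCoeff]
theorem dRhoT_q : M.dRhoT s i (M.q j t) = 0 := by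
  rw [q_apply, contr_gen, F_c]; simp [contraction, opeCoeff]
theorem dRhoT_y : M.dRhoT s i (M.y j t) = 0 := by
  rw [y_apply, contr_gen, F_c]; simp [contraction, opeCoeff]
theorem dRhoT_rho (h : i ≠ j) :
    M.dRhoT s i (M.rho j t) = algebraMap ℂ _ (M.κ s t / (M.σ i - M.σ j)) := by
  rw [rho_apply, contr_gen, F_c]; simp [contraction, opeCoeff, h]

theorem psi_mem : M.psi i v ∈ M.F.oddPart := gen_mem_oddPart rfl
theorem rho_mem : M.rho i t ∈ M.F.oddPart := gen_mem_oddPart rfl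
theorem rhoT_mem : M.rhoT i t ∈ M.F.oddPart := gen_mem_oddPart rfl
theorem q_mem : M.q i t ∈ M.F.evenCenter := gen_mem_evenCenter rfl
theorem y_mem : M.y i t ∈ M.F.evenCenter := gen_mem_evenCenter rfl

theorem dRho_mul (a b : M.F.Alg) :
    M.dRho s i (a * b) = M.dRho s i a * b + M.F.parity a * M.dRho s i b := contr_mul _ rfl _ _
theorem dRhoT_mul (a b : M.F.Alg) :
    M.dRhoT s i (a * b) = M.dRhoT s i a * b + M.F.parity a * M.dRhoT s i b := contr_mul _ rfl _ _

end values

/-- `t · [A, B]` for two `𝔤`-valued fields. -/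
def bil (A B : 𝔤 →ₗ[ℂ] M.F.Alg) (t : 𝔤) : M.F.Alg :=
  ∑ a, ∑ b, M.κ t ⁅M.e a, M.e b⁆ •
    (A (M.κ.dualBasis M.κ_nondeg M.e a) * B (M.κ.dualBasis M.κ_nondeg M.e b))

theorem sum_dualBasis {E : Type*} [AddCommGroup E] [Module ℂ E] (A : 𝔤 →ₗ[ℂ] E) (x : 𝔤) :
    ∑ b, M.κ x (M.e b) • A (M.κ.dualBasis M.κ_nondeg M.e b) = A x := by
  conv_rhs => rw [← (M.κ.dualBasis M.κ_nondeg M.e).sum_repr x]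
  simp only [map_sum, map_smul, LinearMap.BilinForm.dualBasis_repr_apply]

theorem sum_dualBasis' {E : Type*} [AddCommGroup E] [Module ℂ E] (A : 𝔤 →ₗ[ℂ] E) (x : 𝔤) :
    ∑ b, M.κ x (M.κ.dualBasis M.κ_nondeg M.e b) • A (M.e b) = A x := by
  conv_rhs => rw [← M.e.sum_repr x]
  simp only [map_sum, map_smul]
  refine Finset.sum_congr rfl fun b _ => ?_
  congr 1
  conv_rhs => rw [← LinearMap.BilinForm.dualBasis_dualBasis M.κ_nondeg M.κ_symm M.e]
  rw [LinearMap.BilinForm.dualBasis_repr_apply]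

theorem κ_lie_basis (t s x : 𝔤) :
    ∑ a, M.κ t ⁅M.e a, x⁆ * M.κ s (M.κ.dualBasis M.κ_nondeg M.e a) = M.κ ⁅t, s⁆ x := by
  have h := M.sum_dualBasis' (M.κ (-⁅t, x⁆)) s
  have h2 : ∀ u, M.κ (-⁅t, x⁆) u = M.κ t ⁅u, x⁆ := fun u => by
    rw [map_neg, LinearMap.neg_apply, ← κ_lie, ← map_neg, lie_skew]
  simp only [h2, smul_eq_mul] at h
  rw [← κ_lie, ← h]
  exact Finset.sum_congr rfl fun a _ => mul_comm _ _

theorem sum_bil_left (s t : 𝔤) (B : 𝔤 →ₗ[ℂ] M.F.Alg) :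
    ∑ a, ∑ b, M.κ t ⁅M.e a, M.e b⁆ • (M.κ s (M.κ.dualBasis M.κ_nondeg M.e a) •
      B (M.κ.dualBasis M.κ_nondeg M.e b)) = B ⁅t, s⁆ := by
  rw [Finset.sum_comm, ← M.sum_dualBasis B]
  refine Finset.sum_congr rfl fun b _ => ?_
  rw [← κ_lie_basis, Finset.sum_smul]
  simp only [smul_smul]

theorem sum_bil_right (s t : 𝔤) (A : 𝔤 →ₗ[ℂ] M.F.Alg) :
    ∑ a, ∑ b, M.κ t ⁅M.e a, M.e b⁆ • (M.κ s (M.κ.dualBasis M.κ_nondeg M.e b) •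
      A (M.κ.dualBasis M.κ_nondeg M.e a)) = -A ⁅t, s⁆ := by
  rw [Finset.sum_comm, ← sum_bil_left, ← Finset.sum_neg_distrib]
  refine Finset.sum_congr rfl fun a _ => ?_
  rw [← Finset.sum_neg_distrib]
  refine Finset.sum_congr rfl fun b _ => ?_
  rw [← lie_skew, map_neg, neg_smul]

/-- The current `t · ([ρ, ρ̃] + [q, y])`. -/
def current (i : Fin n) (t : 𝔤) : M.F.Alg :=
  M.bil (M.rho i) (M.rhoT i) t + M.bil (M.q i) (M.y i) t

/-- Only the `ρ` in `[ρ, ρ̃]` has a contraction with `ρ̃`; invariance of the form recombines the sum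
over the basis into a bracket. -/
theorem dRhoT_current (s t : 𝔤) {i j : Fin n} (h : i ≠ j) :
    M.dRhoT s i (M.current j t) = (M.σ i - M.σ j)⁻¹ • M.rhoT j ⁅t, s⁆ := by
  simp only [current, bil, map_add, map_sum, map_smul, dRhoT_mul, dRhoT_rho M s i j _ h,
    dRhoT_rhoT, dRhoT_q, dRhoT_y, mul_zero, zero_mul, add_zero, smul_zero, Finset.sum_const_zero]
  rw [← sum_bil_left, Finset.smul_sum]
  refine Finset.sum_congr rfl fun a _ => ?_
  rw [Finset.smul_sum]
  refine Finset.sum_congr rfl fun b _ => ?_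
  rw [← Algebra.smul_def]
  module

/-- The contractions with the two factors `ρ` agree by antisymmetry of the bracket, which cancels
the factor `1/2`. Hence both types of current transform in the same way. -/
theorem dRhoT_bil_rho (s t : 𝔤) {i j : Fin n} (h : i ≠ j) :
    M.dRhoT s i ((1 / 2 : ℂ) • M.bil (M.rho j) (M.rho j) t) =
      (M.σ i - M.σ j)⁻¹ • M.rho j ⁅t, s⁆ := by
  have e1 : M.rho j ⁅t, s⁆ = (1 / 2 : ℂ) • (M.rho j ⁅t, s⁆ - -M.rho j ⁅t, s⁆) := by module
  rw [e1, ← sum_bil_right]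
  nth_rw 1 [← sum_bil_left]
  simp only [bil, map_smul, map_sum, dRhoT_mul, dRhoT_rho M s i j _ h]
  rw [smul_comm]
  congr 1
  rw [← Finset.sum_sub_distrib, Finset.smul_sum]
  refine Finset.sum_congr rfl fun a _ => ?_
  rw [← Finset.sum_sub_distrib, Finset.smul_sum]
  refine Finset.sum_congr rfl fun b _ => ?_
  rw [(M.rho_mem j _).1, ← Algebra.smul_def, ← Algebra.commutes, ← Algebra.smul_def]
  module

theorem dRho_bil_rho (s t : 𝔤) (i j : Fin n) :
    M.dRho s i (M.bil (M.rho j) (M.rho j) t) = 0 := by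
  simp [bil, dRho_mul, dRho_rho]

theorem Q_bil_rho (t : 𝔤) (j : Fin n) : M.Q (M.bil (M.rho j) (M.rho j) t) = 0 := by
  simp [bil, susy_mul, Q_rho]

/-- The bosons make the tilded current exact. This removes all contributions in which `ρ̃` and `ρ`
would form closed loops of currents. -/
theorem Q_bil_q_rhoT (t : 𝔤) (i : Fin n) : M.Q (M.bil (M.q i) (M.rhoT i) t) = M.current i t := by
  simp only [bil, current, map_sum, map_smul, susy_mul, Q_q, Q_rhoT, (M.q_mem _ _).1,
    ← Finset.sum_add_distrib, smul_add]

theorem Q_current (t : 𝔤) (i : Fin n) : M.Q (M.current i t) = 0 := by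
  simp only [bil, current, map_sum, map_smul, map_add, susy_mul, Q_q, Q_rhoT, Q_rho, Q_y,
    (M.rho_mem _ _).1, ← Finset.sum_add_distrib]
  simp

theorem bil_mem {A B : 𝔤 →ₗ[ℂ] M.F.Alg} (h : ∀ s t, A s * B t ∈ M.F.evenCenter) (t : 𝔤) :
    M.bil A B t ∈ M.F.evenCenter :=
  Subalgebra.sum_mem _ fun _ _ => Subalgebra.sum_mem _ fun _ _ =>
    Subalgebra.smul_mem _ (h _ _) _

theorem current_mem (t : 𝔤) (i : Fin n) : M.current i t ∈ M.F.evenCenter :=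
  Subalgebra.add_mem _ (M.bil_mem (fun _ _ => mul_mem_evenCenter (M.rho_mem _ _) (M.rhoT_mem _ _)) _)
    (M.bil_mem (fun _ _ => Subalgebra.mul_mem _ (M.q_mem _ _) (M.y_mem _ _)) _)

/-- The odd elements that do not involve the colour fields. -/
def colourlessOdd : Submodule ℂ M.F.Alg where
  carrier := {θ | θ ∈ M.F.oddPart ∧ (∀ s i, M.dRho s i θ = 0) ∧ (∀ s i, M.dRhoT s i θ = 0) ∧
    M.Q θ = 0}
  zero_mem' := ⟨zero_mem _, by simp, by simp, by simp⟩
  add_mem' := by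
    rintro a b ⟨h1, h2, h3, h4⟩ ⟨g1, g2, g3, g4⟩
    exact ⟨add_mem h1 g1, fun s i => by rw [map_add, h2, g2, add_zero],
      fun s i => by rw [map_add, h3, g3, add_zero], by rw [map_add, h4, g4, add_zero]⟩
  smul_mem' := by
    rintro r a ⟨h1, h2, h3, h4⟩
    exact ⟨Submodule.smul_mem _ r h1, fun s i => by rw [map_smul, h2, smul_zero],
      fun s i => by rw [map_smul, h3, smul_zero], by rw [map_smul, h4, smul_zero]⟩

theorem psi_mem_colourlessOdd (i : Fin n) (v : V) : M.psi i v ∈ M.colourlessOdd :=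
  ⟨M.psi_mem i v, fun s j => M.dRho_psi s j i v, fun s j => M.dRhoT_psi s j i v, M.Q_psi i v⟩

/-- The even central elements that do not involve the colour fields. -/
def colourlessEven : Subalgebra ℂ M.F.evenCenter where
  carrier := {z | (∀ s i, M.dRho s i z = 0) ∧ (∀ s i, M.dRhoT s i z = 0) ∧ M.Q z = 0}
  mul_mem' := by
    rintro a b ⟨h2, h3, h4⟩ ⟨g2, g3, g4⟩
    simp only [Set.mem_ofPred_eq, MulMemClass.coe_mul]
    exact ⟨fun s i => by rw [dRho_mul, h2, g2]; simp,
      fun s i => by rw [dRhoT_mul, h3, g3]; simp, by rw [susy_mul, h4, g4]; simp⟩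
  add_mem' := by
    rintro a b ⟨h2, h3, h4⟩ ⟨g2, g3, g4⟩
    simp only [Set.mem_ofPred_eq, Subalgebra.coe_add]
    exact ⟨fun s i => by rw [map_add, h2, g2, add_zero],
      fun s i => by rw [map_add, h3, g3, add_zero], by rw [map_add, h4, g4, add_zero]⟩
  algebraMap_mem' r := by
    refine ⟨fun s i => contr_algebraMap _ _ r, fun s i => contr_algebraMap _ _ r, ?_⟩
    change M.Q (algebraMap ℂ _ r) = 0
    rw [Algebra.algebraMap_eq_smul_one, map_smul, susy_one, smul_zero]

/-- The product of two colourless odd elements. -/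
def oddMul (θ θ' : M.colourlessOdd) : M.F.evenCenter := ⟨θ * θ', mul_mem_evenCenter θ.2.1 θ'.2.1⟩

theorem oddMul_mem (θ θ' : M.colourlessOdd) : M.oddMul θ θ' ∈ M.colourlessEven := by
  obtain ⟨h1, h2, h3, h4⟩ := θ.2
  obtain ⟨g1, g2, g3, g4⟩ := θ'.2
  exact ⟨fun s i => by simp only [oddMul]; rw [dRho_mul, h2, g2]; simp,
      fun s i => by simp only [oddMul]; rw [dRhoT_mul, h3, g3]; simp,
      by simp only [oddMul]; rw [susy_mul, h4, g4]; simp⟩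

end MatterData
end CombSusy
end

/-! ### Gluon vertex operators and their contractions -/

noncomputable section
namespace CombSusy
namespace MatterData
open WickFunctional

variable {n : ℕ} {V 𝔤 ι : Type*} [AddCommGroup V] [Module ℂ V]
    [LieRing 𝔤] [LieAlgebra ℂ 𝔤] [Fintype ι] [DecidableEq ι] (M : MatterData n V 𝔤 ι)

/-- The expectation value of an even element. -/
def evEven : M.F.evenCenter →ₗ[ℂ] ℂ := M.F.ev ∘ₗ M.F.evenCenter.val.toLinearMap

theorem evEven_apply (z : M.F.evenCenter) : M.evEven z = M.F.ev z := rfl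

/-- A gluon vertex operator `θ t·ρ + l/2 t·[ρ, ρ]` (untilded) or `θ t·ρ̃ + l t·([ρ, ρ̃] + [q, y])`
(tilded), with an arbitrary odd coefficient `θ` and an arbitrary number `l`. -/
def vertex (tilde : Bool) (θ : M.colourlessOdd) (l : ℂ) (t : 𝔤) (i : Fin n) : M.F.evenCenter :=
  ⟨if tilde then θ * M.rhoT i t + l • M.current i t
    else θ * M.rho i t + l • (1 / 2 : ℂ) • M.bil (M.rho i) (M.rho i) t, by
    split_ifs
    · exact add_mem (mul_mem_evenCenter θ.2.1 (M.rhoT_mem _ _))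
        (Subalgebra.smul_mem _ (M.current_mem _ _) _)
    · exact add_mem (mul_mem_evenCenter θ.2.1 (M.rho_mem _ _))
        (Subalgebra.smul_mem _ (Subalgebra.smul_mem _
          (M.bil_mem (fun _ _ => mul_mem_evenCenter (M.rho_mem _ _) (M.rho_mem _ _)) _) _) _)⟩

theorem vertex_tilde_coe (θ : M.colourlessOdd) (l : ℂ) (t : 𝔤) (i : Fin n) :
    (M.vertex true θ l t i : M.F.Alg) = θ * M.rhoT i t + l • M.current i t := rfl

theorem vertex_untilded_coe (θ : M.colourlessOdd) (l : ℂ) (t : 𝔤) (i : Fin n) :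
    (M.vertex false θ l t i : M.F.Alg) =
      θ * M.rho i t + l • (1 / 2 : ℂ) • M.bil (M.rho i) (M.rho i) t := rfl

theorem vertex_add (b : Bool) (θ θ' : M.colourlessOdd) (l l' : ℂ) (t : 𝔤) (i : Fin n) :
    M.vertex b (θ + θ') (l + l') t i = M.vertex b θ l t i + M.vertex b θ' l' t i := by
  apply Subtype.ext
  cases b
  · simp only [vertex_untilded_coe, Subalgebra.coe_add, Submodule.coe_add, add_mul, add_smul]
    abel
  · simp only [vertex_tilde_coe, Subalgebra.coe_add, Submodule.coe_add, add_mul, add_smul]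
    abel

/-- The derivation `θ ∂` for the contraction with `s · ρ̃` at the puncture `i`. -/
def dTheta (θ : M.colourlessOdd) (s : 𝔤) (i : Fin n) :
    Derivation ℂ M.F.evenCenter M.F.evenCenter :=
  oddContr ⟨θ, θ.2.1⟩ (.rhoTilde s, i) rfl

theorem dTheta_coe (θ : M.colourlessOdd) (s : 𝔤) (i : Fin n) (z : M.F.evenCenter) :
    (M.dTheta θ s i z : M.F.Alg) = θ * M.dRhoT s i z := rfl

theorem dTheta_colourless (θ : M.colourlessOdd) (s : 𝔤) (i : Fin n) {z : M.F.evenCenter}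
    (hz : z ∈ M.colourlessEven) : M.dTheta θ s i z = 0 :=
  Subtype.ext (by rw [dTheta_coe, hz.2.1]; simp)

/-- This is one step of the colour recursion. Contraction with the current leaves a vertex of the
same form, with the contracting coefficient `θ`, no current and colour `[s, t]`; this is why
coefficients and currents are kept as independent parameters. Contraction with the elementary `ρ` of
an untilded vertex closes a trace. -/
theorem dTheta_vertex (b : Bool) (θ θ' : M.colourlessOdd) (l : ℂ) (s t : 𝔤) {i j : Fin n}
    (h : i ≠ j) : M.dTheta θ s i (M.vertex b θ' l t j) = -((M.σ i - M.σ j)⁻¹ •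
      (l • M.vertex b θ 0 ⁅s, t⁆ j + if b then 0 else M.κ s t • M.oddMul θ θ')) := by
  apply Subtype.ext
  have hT := θ'.2.2.2.1
  cases b
  · rw [dTheta_coe, vertex_untilded_coe, map_add, map_smul, dRhoT_bil_rho M _ _ h, dRhoT_mul, hT,
      dRhoT_rho M _ _ _ _ h, θ'.2.1.1, ← Algebra.commutes, ← Algebra.smul_def, ← lie_skew]
    simp only [vertex_untilded_coe, oddMul, Subalgebra.coe_neg, Subalgebra.coe_smul,
      Subalgebra.coe_add, Bool.false_eq_true, if_false, map_neg, zero_mul, zero_add, zero_smul,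
      mul_add, mul_smul_comm, mul_neg, smul_neg, smul_add, smul_smul, div_eq_mul_inv,
      add_zero]
    module
  · rw [dTheta_coe, vertex_tilde_coe, map_add, map_smul, dRhoT_current M _ _ h, dRhoT_mul, hT,
      dRhoT_rhoT, ← lie_skew]
    simp only [vertex_tilde_coe, Subalgebra.coe_neg, Subalgebra.coe_smul,
      if_true, map_neg, zero_mul, zero_add, zero_smul,
      mul_smul_comm, mul_neg, smul_neg, smul_smul,
      add_zero, mul_zero]
    module

theorem evEven_vertex_mul (θ : M.colourlessOdd) (s : 𝔤) (i : Fin n) (z : M.F.evenCenter) :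
    M.evEven (M.vertex true θ 0 s i * z) = M.evEven (M.dTheta θ s i z) := by
  rw [evEven_apply, evEven_apply, dTheta_coe, MulMemClass.coe_mul, vertex_tilde_coe, zero_smul,
    add_zero]
  exact ev_odd_mul_gen_mul θ.2.1 rfl (θ.2.2.2.1 s i) z

/-- The even elements annihilated by the supersymmetry. -/
theorem evEven_current_mul (l : ℂ) (t : 𝔤) (i : Fin n) {z : M.F.evenCenter} (hz : M.Q z = 0) :
    M.evEven (M.vertex true 0 l t i * z) = 0 := by
  rw [evEven_apply, MulMemClass.coe_mul, vertex_tilde_coe, ← Q_bil_q_rhoT]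
  simp only [Submodule.coe_zero, zero_mul, zero_add, smul_mul_assoc, map_smul]
  -- The current is the variation of `t · [q, ρ̃]` and `z` is invariant, so the product is a total
  -- variation.
  have : M.Q (M.bil (M.q i) (M.rhoT i) t * z) = M.Q (M.bil (M.q i) (M.rhoT i) t) * z := by
    rw [susy_mul, hz, mul_zero, add_zero]
  rw [← this, ev_susy, smul_zero]

theorem Q_vertex_tilde (l : ℂ) (t : 𝔤) (i : Fin n) : M.Q (M.vertex true 0 l t i) = 0 := by
  rw [vertex_tilde_coe, map_add, map_smul, Q_current]
  simp

theorem Q_vertex_untilded (θ : M.colourlessOdd) (l : ℂ) (t : 𝔤) (i : Fin n) :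
    M.Q (M.vertex false θ l t i) = 0 := by
  rw [vertex_untilded_coe, map_add, map_smul, map_smul, Q_bil_rho, susy_mul, θ.2.2.2.2, Q_rho]
  simp

theorem dRho_vertex_untilded (s : 𝔤) (j : Fin n) (θ : M.colourlessOdd) (l : ℂ) (t : 𝔤)
    (i : Fin n) : M.dRho s j (M.vertex false θ l t i) = 0 := by
  rw [vertex_untilded_coe, map_add, map_smul, map_smul, dRho_bil_rho, dRho_mul, θ.2.2.1, dRho_rho]
  simp

/-- Every term of an untilded vertex contains a `ρ`, which has no partner to be contracted with. -/
theorem evEven_untilded_mul (θ : M.colourlessOdd) (l : ℂ) (t : 𝔤) (i : Fin n)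
    {z : M.F.evenCenter} (hz : ∀ s j, M.dRho s j z = 0) :
    M.evEven (M.vertex false θ l t i * z) = 0 := by
  rw [evEven_apply, MulMemClass.coe_mul, vertex_untilded_coe, add_mul, map_add,
    rho_apply, ev_odd_mul_gen_mul θ.2.1 rfl (θ.2.2.1 t i), hz]
  simp only [bil, smul_mul_assoc, map_smul, Finset.sum_mul, map_sum, mul_zero, map_zero, zero_add]
  have : ∀ a b, M.F.ev (M.rho i a * M.rho i b * z) = 0 := by
    intro a b
    rw [mul_assoc, rho_apply, ev_gen_mul, dRho_mul, dRho_rho, hz]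
    simp
  simp [this]

end MatterData
end CombSusy
end

noncomputable section
namespace CombSusy

/-! ### Comb chains -/

section Chain

variable {α 𝔤 : Type*} [DecidableEq α] [LieRing 𝔤] [LieAlgebra ℂ 𝔤] (κ : BilinForm ℂ 𝔤)
  (σ : α → ℂ)

/-- The sum over the orderings `w` of `k` elements of `I` of
`κ([…[x, t_{w_1}], …, t_{w_k}], t_d) / (σ_{c w_1} σ_{w_1 w_2} ⋯ σ_{w_k d})`. -/
def chainAux (t : α → 𝔤) (d : α) : ℕ → 𝔤 → α → Finset α → ℂ
  | 0, x, c, _ => (σ c - σ d)⁻¹ * κ x (t d)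
  | k + 1, x, c, I => ∑ j ∈ I, (σ c - σ j)⁻¹ * chainAux t d k ⁅x, t j⁆ j (I.erase j)

/-- The sum over all orderings `w` of `I` of
`κ([…[x, t_{w_1}], …, t_{w_k}], t_d) / (σ_{c w_1} σ_{w_1 w_2} ⋯ σ_{w_k d})`. -/
def chain (t : α → 𝔤) (x : 𝔤) (c d : α) (I : Finset α) : ℂ := chainAux κ σ t d I.card x c I

theorem chain_empty (t : α → 𝔤) (x : 𝔤) (c d : α) :
    chain κ σ t x c d ∅ = (σ c - σ d)⁻¹ * κ x (t d) := rfl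

theorem chain_eq_sum (t : α → 𝔤) (x : 𝔤) (c d : α) {I : Finset α} (hI : I.Nonempty) :
    chain κ σ t x c d I = ∑ j ∈ I, (σ c - σ j)⁻¹ * chain κ σ t ⁅x, t j⁆ j d (I.erase j) := by
  obtain ⟨k, hk⟩ : ∃ k, I.card = k + 1 := ⟨I.card - 1, by have := hI.card_pos; omega⟩
  rw [chain, hk, chainAux]
  refine Finset.sum_congr rfl fun j hj => ?_
  rw [chain, Finset.card_erase_of_mem hj, hk, Nat.add_sub_cancel]

theorem chain_congr {t t' : α → 𝔤} (x : 𝔤) (c d : α) (I : Finset α)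
    (h : ∀ j ∈ insert d I, t j = t' j) : chain κ σ t x c d I = chain κ σ t' x c d I := by
  induction I using Finset.strongInduction generalizing x c with
  | H I ih =>
    rcases I.eq_empty_or_nonempty with rfl | hI
    · rw [chain_empty, chain_empty, h d (by simp)]
    · rw [chain_eq_sum _ _ _ _ _ _ hI, chain_eq_sum _ _ _ _ _ _ hI]
      refine Finset.sum_congr rfl fun j hj => ?_
      rw [h j (by simp [hj]), ih _ (Finset.erase_ssubset hj)]
      intro k hk
      refine h k ?_
      rw [Finset.mem_insert] at hk ⊢
      exact hk.imp_right Finset.mem_of_mem_erase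

theorem chain_add (t : α → 𝔤) (x y : 𝔤) (c d : α) (I : Finset α) :
    chain κ σ t (x + y) c d I = chain κ σ t x c d I + chain κ σ t y c d I := by
  induction I using Finset.strongInduction generalizing x y c with
  | H I ih =>
    rcases I.eq_empty_or_nonempty with rfl | hI
    · simp only [chain_empty, map_add, LinearMap.add_apply, mul_add]
    · rw [chain_eq_sum _ _ _ _ _ _ hI, chain_eq_sum _ _ _ _ _ _ hI, chain_eq_sum _ _ _ _ _ _ hI,
        ← Finset.sum_add_distrib]
      refine Finset.sum_congr rfl fun j hj => ?_
      rw [add_lie, ih _ (Finset.erase_ssubset hj), mul_add]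

theorem chain_neg (t : α → 𝔤) (x : 𝔤) (c d : α) (I : Finset α) :
    chain κ σ t (-x) c d I = -chain κ σ t x c d I := by
  have h0 : chain κ σ t 0 c d I = 0 := by simpa using chain_add κ σ t 0 0 c d I
  have := chain_add κ σ t x (-x) c d I
  rw [add_neg_cancel, h0] at this
  exact (neg_eq_of_add_eq_zero_right this.symm).symm

variable {κ σ} (hinv : ∀ t s x, κ t ⁅s, x⁆ = κ ⁅t, s⁆ x) (hsymm : ∀ x y, κ x y = κ y x)
  (hσ : Function.Injective σ)

include hinv hσ

/-- Summed over its positions in a chain, the label `i` can be detached: it acts on the colour of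
each remaining label `j` by `[t_i, ·] / σ_ij`. For two end points this is a partial fraction
identity together with invariance of the form; the induction step, on the first link of the chain,
uses partial fractions and the Jacobi identity. -/
theorem chain_insert (t : α → 𝔤) (x : 𝔤) {c d i : α} {I : Finset α} (hi : i ∉ I) (hic : i ≠ c)
    (hid : i ≠ d) (hcI : c ∉ I) (hdI : d ∉ I) (hcd : c ≠ d) :
    chain κ σ t x c d (insert i I) = (σ i - σ c)⁻¹ * chain κ σ t ⁅t i, x⁆ c d I +
      ∑ j ∈ insert d I, (σ i - σ j)⁻¹ *
        chain κ σ (Function.update t j ⁅t i, t j⁆) x c d I := by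
  have hne : ∀ {a b}, a ≠ b → σ a - σ b ≠ 0 := fun h => sub_ne_zero.2 fun h' => h (hσ h')
  induction I using Finset.strongInduction generalizing x c with
  | H I ih =>
    rw [chain_eq_sum _ _ _ _ _ _ (Finset.insert_nonempty _ _), Finset.sum_insert hi,
      Finset.erase_insert hi]
    rcases I.eq_empty_or_nonempty with rfl | hI
    · simp only [chain_empty, Finset.sum_empty, add_zero, insert_empty_eq, Finset.sum_singleton,
        Function.update_self, hinv]
      have h1 := hne hic
      have h2 := hne hic.symm
      have h3 := hne hid
      have h4 := hne hcd
      have h5 : κ ⁅t i, x⁆ (t d) = -κ ⁅x, t i⁆ (t d) := by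
        rw [← lie_skew, map_neg, LinearMap.neg_apply]
      rw [h5]
      have h6 : σ c - σ i = -(σ i - σ c) := by ring
      rw [h6]
      field_simp
      ring
    · rw [chain_eq_sum _ _ _ _ _ _ hI, chain_eq_sum _ _ _ ⁅t i, x⁆ _ _ hI, Finset.mul_sum,
        Finset.mul_sum, ← Finset.sum_add_distrib]
      have hR : ∑ j ∈ insert d I, (σ i - σ j)⁻¹ *
          chain κ σ (Function.update t j ⁅t i, t j⁆) x c d I =
          ∑ j ∈ I, ∑ l ∈ insert d I, (σ i - σ l)⁻¹ * ((σ c - σ j)⁻¹ *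
            chain κ σ (Function.update t l ⁅t i, t l⁆)
              ⁅x, Function.update t l ⁅t i, t l⁆ j⁆ j d (I.erase j)) := by
        rw [Finset.sum_comm]
        refine Finset.sum_congr rfl fun l _ => ?_
        rw [chain_eq_sum _ _ _ _ _ _ hI, Finset.mul_sum]
      rw [hR, ← Finset.sum_add_distrib]
      refine Finset.sum_congr rfl fun j hj => ?_
      have hji : j ≠ i := fun h => hi (h ▸ hj)
      have hcj : c ≠ j := fun h => hcI (h ▸ hj)
      have hjd : j ≠ d := fun h => hdI (h ▸ hj)
      rw [Finset.erase_insert_of_ne hji.symm,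
        ih _ (Finset.erase_ssubset hj) ⁅x, t j⁆ (fun h => hi (Finset.mem_of_mem_erase h)) hji.symm
        (Finset.notMem_erase _ _) (fun h => hdI (Finset.mem_of_mem_erase h)) hjd]
      have hsplit : insert d I = insert j (insert d (I.erase j)) := by
        rw [Finset.insert_comm, Finset.insert_erase hj]
      have hjn : j ∉ insert d (I.erase j) := by simp [hjd]
      rw [hsplit, Finset.sum_insert hjn, Function.update_self]
      have e1 : ∑ l ∈ insert d (I.erase j), (σ i - σ l)⁻¹ * ((σ c - σ j)⁻¹ *
            chain κ σ (Function.update t l ⁅t i, t l⁆)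
              ⁅x, Function.update t l ⁅t i, t l⁆ j⁆ j d (I.erase j)) =
          (σ c - σ j)⁻¹ * ∑ l ∈ insert d (I.erase j), (σ i - σ l)⁻¹ *
            chain κ σ (Function.update t l ⁅t i, t l⁆) ⁅x, t j⁆ j d (I.erase j) := by
        rw [Finset.mul_sum]
        refine Finset.sum_congr rfl fun l hl => ?_
        rw [Function.update_of_ne (ne_of_mem_of_not_mem hl hjn).symm]
        ring
      have e2 : chain κ σ (Function.update t j ⁅t i, t j⁆) ⁅x, ⁅t i, t j⁆⁆ j d (I.erase j) =
          chain κ σ t ⁅x, ⁅t i, t j⁆⁆ j d (I.erase j) := by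
        refine chain_congr _ _ _ _ _ _ fun k hk => ?_
        rw [Function.update_of_ne (ne_of_mem_of_not_mem hk hjn)]
      -- By the Jacobi identity, the action of `t_i` on `[x, t_j]` is the sum of its actions on `x`
      -- and on `t_j`. The remaining identity among the coefficients is a partial fraction
      -- decomposition.
      rw [e1, e2, leibniz_lie, chain_add, ← lie_skew x (t i), neg_lie, chain_neg]
      have h1 := hne hic
      have h3 := hne hji.symm
      have h4 := hne hcj
      have h6 : σ c - σ i = -(σ i - σ c) := by ring
      rw [h6]
      field_simp
      ring

omit hinv hσ

variable (κ σ) in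
/-- The sum over all chains through `T` from `c` to `d`, divided by `σ_{dc}`. -/
def cyc (t : α → 𝔤) (c d : α) (T : Finset α) : ℂ :=
  chain κ σ t (t c) c d ((T.erase c).erase d) / (σ d - σ c)

include hinv hσ

/-- With `x = t_c`, the terms of `chain_insert` form one sum over all of `T` in which the ends are
not distinguished. Comparisons of different ends therefore reduce to the smallest sets that contain
these ends. -/
theorem cyc_insert (t : α → 𝔤) {c d i : α} {T : Finset α} (hi : i ∉ T) (hc : c ∈ T) (hd : d ∈ T)
    (hcd : c ≠ d) : cyc κ σ t c d (insert i T) =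
      ∑ j ∈ T, (σ i - σ j)⁻¹ * cyc κ σ (Function.update t j ⁅t i, t j⁆) c d T := by
  have hic : i ≠ c := fun h => hi (h ▸ hc)
  have hid : i ≠ d := fun h => hi (h ▸ hd)
  have hT : T = insert c (insert d ((T.erase c).erase d)) := by
    rw [Finset.insert_erase (by simp [hd, hcd.symm]), Finset.insert_erase hc]
  have hcn : c ∉ insert d ((T.erase c).erase d) := by simp [hcd]
  rw [cyc, Finset.erase_insert_of_ne hic, Finset.erase_insert_of_ne hid,
    chain_insert hinv hσ t _ (by simp [hi]) hic hid (by simp) (by simp) hcd, add_div, Finset.sum_div]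
  nth_rw 4 [hT]
  rw [Finset.sum_insert hcn]
  congr 1
  · rw [cyc, Function.update_self, mul_div_assoc]
    congr 2
    refine chain_congr _ _ _ _ _ _ fun k hk => ?_
    rw [Function.update_of_ne (ne_of_mem_of_not_mem hk hcn)]
  · refine Finset.sum_congr rfl fun j hj => ?_
    rw [cyc, mul_div_assoc, Function.update_of_ne (ne_of_mem_of_not_mem hj hcn).symm]

include hsymm

/-- Detaching all other labels by `cyc_insert` leaves the two-element set, where the claim is the
symmetry of the form. -/
theorem cyc_symm (t : α → 𝔤) {c d : α} {T : Finset α} (hc : c ∈ T) (hd : d ∈ T) (hcd : c ≠ d) :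
    cyc κ σ t c d T = cyc κ σ t d c T := by
  induction T using Finset.strongInduction generalizing t with
  | H T ih =>
    by_cases h : ∃ i ∈ T, i ≠ c ∧ i ≠ d
    · obtain ⟨i, hi, hic, hid⟩ := h
      have hc' : c ∈ T.erase i := by simp [hc, hic.symm]
      have hd' : d ∈ T.erase i := by simp [hd, hid.symm]
      rw [← Finset.insert_erase hi, cyc_insert hinv hσ t (Finset.notMem_erase _ _) hc' hd' hcd,
        cyc_insert hinv hσ t (Finset.notMem_erase _ _) hd' hc' hcd.symm]
      exact Finset.sum_congr rfl fun j _ => by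
        rw [ih _ (Finset.erase_ssubset hi) _ hc' hd']
    · push Not at h
      have hT : (T.erase c).erase d = ∅ := by
        ext j; simp only [Finset.mem_erase, Finset.notMem_empty, iff_false]
        rintro ⟨h1, h2, h3⟩; exact h1 (h j h3 h2)
      rw [cyc, cyc, hT, Finset.erase_right_comm, hT, chain_empty, chain_empty, hsymm (t c)]
      have h1 : σ c - σ d ≠ 0 := sub_ne_zero.2 fun h' => hcd (hσ h')
      have h2 : σ d - σ c ≠ 0 := sub_ne_zero.2 fun h' => hcd (hσ h').symm
      field_simp

omit hsymm in
-- Detaching all other labels leaves the set `{c, d, d'}`, where the claim is the antisymmetry of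
-- `κ(t_c, [t_d, t_d'])`.
theorem cyc_right (t : α → 𝔤) {c d d' : α} {T : Finset α} (hc : c ∈ T) (hd : d ∈ T) (hcd : c ≠ d)
    (hd' : d' ∈ T) (hcd' : c ≠ d') : cyc κ σ t c d T = cyc κ σ t c d' T := by
  by_cases hdd : d = d'
  · rw [hdd]
  induction T using Finset.strongInduction generalizing t with
  | H T ih =>
    by_cases h : ∃ i ∈ T, i ≠ c ∧ i ≠ d ∧ i ≠ d'
    · obtain ⟨i, hi, hic, hid, hid'⟩ := h
      have hc₁ : c ∈ T.erase i := by simp [hc, hic.symm]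
      have hd₁ : d ∈ T.erase i := by simp [hd, hid.symm]
      have hd₁' : d' ∈ T.erase i := by simp [hd', hid'.symm]
      rw [← Finset.insert_erase hi, cyc_insert hinv hσ t (Finset.notMem_erase _ _) hc₁ hd₁ hcd,
        cyc_insert hinv hσ t (Finset.notMem_erase _ _) hc₁ hd₁' hcd']
      exact Finset.sum_congr rfl fun j _ => by
        rw [ih _ (Finset.erase_ssubset hi) _ hc₁ hd₁ hd₁']
    · push Not at h
      have hT : (T.erase c).erase d = {d'} := by
        ext j; simp only [Finset.mem_erase, Finset.mem_singleton]
        constructor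
        · rintro ⟨h1, h2, h3⟩; exact h j h3 h2 h1
        · rintro rfl; exact ⟨Ne.symm hdd, hcd'.symm, hd'⟩
      have hT' : (T.erase c).erase d' = {d} := by
        ext j; simp only [Finset.mem_erase, Finset.mem_singleton]
        constructor
        · rintro ⟨h1, h2, h3⟩; by_contra h4; exact h1 (h j h3 h2 h4)
        · rintro rfl; exact ⟨hdd, hcd.symm, hd⟩
      rw [cyc, cyc, hT, hT', chain_eq_sum _ _ _ _ _ _ (Finset.singleton_nonempty _),
        chain_eq_sum _ _ _ _ _ _ (Finset.singleton_nonempty _), Finset.sum_singleton,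
        Finset.sum_singleton, Finset.erase_singleton, Finset.erase_singleton, chain_empty,
        chain_empty, ← hinv, ← hinv, ← lie_skew, map_neg]
      have hne : ∀ {a b}, a ≠ b → σ a - σ b ≠ 0 := fun h => sub_ne_zero.2 fun h' => h (hσ h')
      have h1 := hne hcd
      have h2 := hne hcd'
      have h3 := hne hdd
      rw [show σ d' - σ d = -(σ d - σ d') by ring, show σ d - σ c = -(σ c - σ d) by ring,
        show σ d' - σ c = -(σ c - σ d') by ring]
      field_simp

theorem cyc_eq (t : α → 𝔤) {c d c' d' : α} {T : Finset α} (hc : c ∈ T) (hd : d ∈ T) (hcd : c ≠ d)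
    (hc' : c' ∈ T) (hd' : d' ∈ T) (hcd' : c' ≠ d') : cyc κ σ t c d T = cyc κ σ t c' d' T := by
  by_cases h : c' = d
  · subst h
    rw [cyc_symm hinv hsymm hσ t hc hd hcd, cyc_right hinv hσ t hd hc hcd.symm hd' hcd']
  · rw [cyc_symm hinv hsymm hσ t hc hd hcd,
      cyc_right hinv hσ t hd hc hcd.symm hc' (Ne.symm h),
      cyc_symm hinv hsymm hσ t hd hc' (Ne.symm h),
      cyc_right hinv hσ t hc' hd h hd' hcd']

end Chain

end CombSusy
end

noncomputable section
namespace CombSusy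

/-! ### The colour factor as a sum over chains -/

theorem sum_permutations_eq {α : Type*} [DecidableEq α] (f : List α → ℂ) {l : List α}
    (hl : l.Nodup) (hne : l ≠ []) : (l.permutations.map f).sum =
      ∑ j ∈ l.toFinset, ((l.erase j).permutations.map fun m => f (j :: m)).sum := by
  have key : ∀ (g : List α → ℂ) {l : List α}, l.Nodup →
      (l.permutations.map g).sum = ∑ m ∈ l.permutations.toFinset, g m := fun g l h => by
    rw [List.sum_toFinset _ (List.nodup_permutations _ h)]
  have hU : l.permutations.toFinset =
      l.toFinset.biUnion fun j => (l.erase j).permutations.toFinset.image (List.cons j) := by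
    ext m
    simp only [List.mem_toFinset, List.mem_permutations, Finset.mem_biUnion, Finset.mem_image]
    constructor
    · intro hm
      cases m with
      | nil => exact absurd hm.symm.eq_nil hne
      | cons j m =>
        exact ⟨j, hm.subset (by simp), m, by simpa using hm.erase j, rfl⟩
    · rintro ⟨j, hj, m, hm, rfl⟩
      exact (hm.cons j).trans (List.perm_cons_erase hj).symm
  rw [key _ hl, hU, Finset.sum_biUnion]
  · refine Finset.sum_congr rfl fun j _ => ?_
    rw [Finset.sum_image fun _ _ _ _ h => (List.cons.inj h).2, key _ (hl.erase j)]
  · intro i _ j _ hij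
    rw [Function.onFun, Finset.disjoint_left]
    simp only [Finset.mem_image]
    rintro _ ⟨_, _, rfl⟩ ⟨_, _, h⟩
    exact hij (List.cons.inj h).1.symm

namespace Insertions

variable {n : ℕ} {V 𝔤 : Type*} [AddCommGroup V] [Module ℂ V] [LieRing 𝔤] [LieAlgebra ℂ 𝔤]
  (D : Insertions n V 𝔤)

/-- The product of the differences of consecutive punctures along `a, m, b`. -/
def pathProd (b : Fin n) : Fin n → List (Fin n) → ℂ
  | a, [] => D.σ a - D.σ b
  | a, j :: m => (D.σ a - D.σ j) * pathProd b j m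

omit [AddCommGroup V] [Module ℂ V] [LieRing 𝔤] [LieAlgebra ℂ 𝔤] in
theorem prod_zipWith_path (a b e : Fin n) (m : List (Fin n)) :
    (List.zipWith (fun i j => D.σ i - D.σ j) (a :: (m ++ [b])) (m ++ [b] ++ [e])).prod =
      D.pathProd b a m * (D.σ b - D.σ e) := by
  induction m generalizing a with
  | nil => simp [pathProd]
  | cons j m ih =>
    have := ih j
    simp only [List.cons_append, List.zipWith_cons_cons, List.prod_cons, pathProd] at this ⊢
    rw [this, mul_assoc]

omit [AddCommGroup V] [Module ℂ V] in
theorem combTerm_path (κ : BilinForm ℂ 𝔤) (a b : Fin n) (m : List (Fin n)) :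
    D.combTerm κ (a :: (m ++ [b])) =
      κ (D.t a) (D.nested (m ++ [b])) / D.pathProd b a m / (D.σ b - D.σ a) := by
  have : (a :: (m ++ [b])).rotate 1 = m ++ [b] ++ [a] := by simp
  rw [combTerm, this, prod_zipWith_path, div_div]
  simp

omit [AddCommGroup V] [Module ℂ V] in
-- Invariance of the form moves the brackets one by one from the right-nested comb into the first
-- argument, where the recursion for chains builds them.
theorem sum_permutations_path {κ : BilinForm ℂ 𝔤} (hinv : ∀ t s x, κ t ⁅s, x⁆ = κ ⁅t, s⁆ x)
    (x : 𝔤) (a b : Fin n) (l : List (Fin n)) (hl : l.Nodup) :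
    (l.permutations.map fun m => κ x (D.nested (m ++ [b])) / D.pathProd b a m).sum =
      chain κ D.σ D.t x a b l.toFinset := by
  obtain ⟨k, hk⟩ : ∃ k, l.length = k := ⟨_, rfl⟩
  induction k generalizing l x a with
  | zero =>
    obtain rfl := List.length_eq_zero_iff.1 hk
    simp [nested, pathProd, chain_empty]; ring
  | succ k ih =>
    have hne : l ≠ [] := by rintro rfl; simp at hk
    rw [sum_permutations_eq _ hl hne, chain_eq_sum _ _ _ _ _ _ (by simpa using hne)]
    refine Finset.sum_congr rfl fun j hj => ?_
    have hj' : j ∈ l := by simpa using hj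
    have hE : l.toFinset.erase j = (l.erase j).toFinset := by
      ext i
      simp [hl.mem_erase_iff]
    rw [hE, ← ih ⁅x, D.t j⁆ j _ (hl.erase j) (by simp [List.length_erase_of_mem hj', hk]),
      ← List.sum_map_mul_left]
    congr 1
    refine List.map_congr_left fun m _ => ?_
    have : D.nested (j :: (m ++ [b])) = ⁅D.t j, D.nested (m ++ [b])⁆ := by
      cases m <;> rfl
    rw [List.cons_append, this, hinv, pathProd, div_eq_mul_inv, div_eq_mul_inv, mul_inv]
    ring

omit [AddCommGroup V] [Module ℂ V] in
-- `colour` uses the smallest and the largest label as ends; by `cyc_eq` these can be exchanged for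
-- any other pair.
theorem colour_eq_cyc {κ : BilinForm ℂ 𝔤} (hinv : ∀ t s x, κ t ⁅s, x⁆ = κ ⁅t, s⁆ x)
    (hsymm : ∀ x y, κ x y = κ y x) (hσ : Function.Injective D.σ) {T : Finset (Fin n)} {c d : Fin n}
    (hc : c ∈ T) (hd : d ∈ T) (hcd : c ≠ d) : D.colour κ T = cyc κ D.σ D.t c d T := by
  obtain ⟨w, hw⟩ : ∃ w, w = T.sort (· ≤ ·) := ⟨_, rfl⟩
  have hnd : w.Nodup := hw ▸ Finset.sort_nodup _ _
  have hmem : ∀ i, i ∈ w ↔ i ∈ T := fun i => by rw [hw, Finset.mem_sort]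
  rw [colour, ← hw]
  match w, hnd, hmem with
  | [], _, hmem => exact absurd ((hmem c).2 hc) (by simp)
  | a :: u, hnd, hmem =>
    rcases List.eq_nil_or_concat u with rfl | ⟨l, b, rfl⟩
    · have h1 := (hmem c).2 hc
      have h2 := (hmem d).2 hd
      simp only [List.mem_singleton] at h1 h2
      exact absurd (h1.trans h2.symm) hcd
    · have hab : a ≠ b := by rintro rfl; simp at hnd
      have hln : l.Nodup := by
        have := (List.nodup_cons.1 hnd).2
        rw [List.concat_eq_append] at this
        exact this.of_append_left
      have hT : l.toFinset = (T.erase a).erase b := by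
        ext i
        have h1 := hmem i
        simp only [List.nodup_cons, List.concat_eq_append, List.mem_append,
          not_or, List.nodup_append, List.mem_cons] at hnd h1
        simp only [List.mem_toFinset, Finset.mem_erase, ← h1]
        constructor
        · intro hi
          refine ⟨fun h => ?_, fun h => hnd.1.1 (h ▸ hi), Or.inr (Or.inl hi)⟩
          exact hnd.2.2.2 i hi b (by simp) h
        · tauto
      have ha : a ∈ T := (hmem a).1 (by simp)
      have hb : b ∈ T := (hmem b).1 (by simp)
      rw [cyc_eq hinv hsymm hσ D.t hc hd hcd ha hb hab, cyc, ← hT,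
        ← sum_permutations_path D hinv _ _ _ _ hln, div_eq_mul_inv, ← List.sum_map_mul_right]
      simp only [List.concat_eq_append, List.tail_cons, List.dropLast_concat, List.head?_cons,
        Option.toList_some, List.cons_append, List.nil_append, List.getLast?_cons,
        combTerm_path, div_eq_mul_inv]
      simp

end Insertions
end CombSusy
end

/-! ### Colour traces with prescribed ends -/

noncomputable section
namespace CombSusy
namespace MatterData
open WickFunctional

variable {n : ℕ} {V 𝔤 ι : Type*} [AddCommGroup V] [Module ℂ V]
    [LieRing 𝔤] [LieAlgebra ℂ 𝔤] [Fintype ι] [DecidableEq ι] (M : MatterData n V 𝔤 ι)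

/-- The colour factor of a set of labels. -/
def col (t : Fin n → 𝔤) (T : Finset (Fin n)) : ℂ :=
  -- Only punctures and colours enter `colour`; the other entries are placeholders.
  (⟨M.σ, 0, 0, t, fun _ => .gluon, ∅⟩ : Insertions n V 𝔤).colour M.κ T

theorem col_eq_cyc (hσ : Function.Injective M.σ) (t : Fin n → 𝔤) {T : Finset (Fin n)} {c d : Fin n}
    (hc : c ∈ T) (hd : d ∈ T) (hcd : c ≠ d) : M.col t T = cyc M.κ M.σ t c d T :=
  (⟨M.σ, 0, 0, t, fun _ => .gluon, ∅⟩ : Insertions n V 𝔤).colour_eq_cyc M.κ_lie M.κ_comm hσ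
    hc hd hcd

theorem mul_cyc (hσ : Function.Injective M.σ) (t : Fin n → 𝔤) {T : Finset (Fin n)} {c d : Fin n}
    (hcd : c ≠ d) : (M.σ d - M.σ c) * cyc M.κ M.σ t c d T =
      chain M.κ M.σ t (t c) c d ((T.erase c).erase d) := by
  rw [cyc, mul_div_cancel₀]
  exact sub_ne_zero.2 fun h => hcd (hσ h).symm

/-- Take `i` and `d` as ends and split off the first link `i, j` of every chain: the rest is a chain
from `j` to `d` with colour `[t_i, t_j]` at `j`. If `T = {d}`, the single link closes the trace. -/
theorem col_insert (hσ : Function.Injective M.σ) (t : Fin n → 𝔤) {T : Finset (Fin n)} {i d : Fin n}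
    (hi : i ∉ T) (hd : d ∈ T) : (M.σ d - M.σ i) * M.col t (insert i T) =
      ∑ j ∈ T.erase d, (M.σ i - M.σ j)⁻¹ * ((M.σ d - M.σ j) *
        M.col (Function.update t j ⁅t i, t j⁆) T) +
      if T = {d} then (M.σ i - M.σ d)⁻¹ * M.κ (t i) (t d) else 0 := by
  have hid : i ≠ d := fun h => hi (h ▸ hd)
  rw [M.col_eq_cyc hσ t (Finset.mem_insert_self _ _) (Finset.mem_insert_of_mem hd) hid,
    M.mul_cyc hσ t hid, Finset.erase_insert hi]
  rcases (T.erase d).eq_empty_or_nonempty with h | h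
  · have hT : T = {d} := by rw [← Finset.insert_erase hd, h]; rfl
    rw [h, chain_empty, if_pos hT]
    simp
  · have hT : T ≠ {d} := by rintro rfl; simp at h
    rw [if_neg hT, add_zero, chain_eq_sum _ _ _ _ _ _ h]
    refine Finset.sum_congr rfl fun j hj => ?_
    obtain ⟨hjd, hj⟩ := Finset.mem_erase.1 hj
    rw [M.col_eq_cyc hσ _ hj hd hjd, M.mul_cyc hσ _ hjd, Function.update_self,
      Finset.erase_right_comm]
    congr 1
    refine chain_congr _ _ _ _ _ _ fun k hk => ?_
    rw [Function.update_of_ne]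
    rintro rfl
    simp [hjd] at hk

/-- The sum over the two ends of a chain. -/
def ends (θ : Fin n → M.colourlessOdd) (l : Fin n → ℂ) (T : Finset (Fin n)) : M.F.evenCenter :=
  -- The sum is over ordered pairs, hence the factor `1/2`. The labels other than the two ends enter
  -- through their currents, hence the product of the numbers `l j`.
  ∑ c ∈ T, ∑ d ∈ T, ((1 / 2) * (M.σ d - M.σ c) * ∏ j ∈ (T.erase c).erase d, l j) •
    M.oddMul (θ c) (θ d)

theorem oddMul_comm (θ θ' : M.colourlessOdd) : M.oddMul θ θ' = -M.oddMul θ' θ :=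
  Subtype.ext (odd_mul_odd θ.2.1 θ'.2.1)

theorem oddMul_zero_left (θ : M.colourlessOdd) : M.oddMul 0 θ = 0 :=
  Subtype.ext (zero_mul _)

theorem oddMul_zero_right (θ : M.colourlessOdd) : M.oddMul θ 0 = 0 :=
  Subtype.ext (mul_zero _)

theorem ends_congr {θ θ' : Fin n → M.colourlessOdd} {l l' : Fin n → ℂ} {T : Finset (Fin n)}
    (h : ∀ j ∈ T, θ j = θ' j) (h' : ∀ j ∈ T, l j = l' j) : M.ends θ l T = M.ends θ' l' T := by
  refine Finset.sum_congr rfl fun c hc => Finset.sum_congr rfl fun d hd => ?_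
  rw [h c hc, h d hd]
  congr 2
  exact Finset.prod_congr rfl fun j hj => h' j (Finset.mem_of_mem_erase (Finset.mem_of_mem_erase hj))

/-- A label without a current cannot be in the interior of a chain, so it is one of its ends. -/
theorem ends_insert (θ : Fin n → M.colourlessOdd) (l : Fin n → ℂ) {T : Finset (Fin n)} {i : Fin n}
    (hi : i ∉ T) (hl : l i = 0) : M.ends θ l (insert i T) =
      ∑ d ∈ T, ((M.σ d - M.σ i) * ∏ j ∈ T.erase d, l j) • M.oddMul (θ i) (θ d) := by
  rw [ends, Finset.sum_insert hi, Finset.sum_insert hi]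
  simp only [sub_self, mul_zero, zero_mul, zero_smul, zero_add]
  rw [← Finset.sum_add_distrib]
  refine Finset.sum_congr rfl fun d hd => ?_
  have hid : i ≠ d := fun h => hi (h ▸ hd)
  rw [Finset.sum_insert hi, Finset.sum_eq_zero, add_zero, Finset.erase_insert hi,
    Finset.erase_right_comm, Finset.erase_insert hi, M.oddMul_comm (θ d)]
  · module
  · intro c hc
    have hic : i ≠ c := fun h => hi (h ▸ hc)
    rw [Finset.prod_eq_zero (i := i) (by simp [hid, hic]) hl]
    simp

/-- The label `i` is either an end, and then `l i` does not occur, or in the interior, and then `θ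
i` does not occur. -/
theorem ends_split (θ : Fin n → M.colourlessOdd) (l : Fin n → ℂ) {T : Finset (Fin n)} {i : Fin n}
    (hi : i ∈ T) : M.ends θ l T =
      M.ends θ (Function.update l i 0) T + M.ends (Function.update θ i 0) l T := by
  rw [ends, ends, ends, ← Finset.sum_add_distrib]
  refine Finset.sum_congr rfl fun c hc => ?_
  rw [← Finset.sum_add_distrib]
  refine Finset.sum_congr rfl fun d hd => ?_
  by_cases hc : c = i
  · subst hc
    rw [Function.update_self, oddMul_zero_left, smul_zero, add_zero]
    congr 2
    refine Finset.prod_congr rfl fun j hj => ?_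
    rw [Function.update_of_ne]
    rintro rfl
    simp at hj
  by_cases hd : d = i
  · subst hd
    rw [Function.update_self, oddMul_zero_right, smul_zero, add_zero]
    congr 2
    refine Finset.prod_congr rfl fun j hj => ?_
    rw [Function.update_of_ne]
    rintro rfl
    simp at hj
  have h0 : ∏ j ∈ (T.erase c).erase d, Function.update l i 0 j = 0 :=
    Finset.prod_eq_zero (i := i) (by simp [Ne.symm hc, Ne.symm hd, hi]) (Function.update_self _ _ _)
  rw [Function.update_of_ne hc, Function.update_of_ne hd, h0]
  simp

/-- The contribution of a colour trace through the set `T`. -/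
def trace (θ : Fin n → M.colourlessOdd) (l : Fin n → ℂ) (t : Fin n → 𝔤) (T : Finset (Fin n)) :
    M.F.evenCenter := ((-1) ^ (T.card + 1) * M.col t T) • M.ends θ l T

/-- As `i` is an end, `col_insert` removes it. Its neighbour `j` turns from an interior label with
factor `l j` into an end that inherits `θ i`. The resulting terms and signs are those of
`dTheta_vertex`. -/
theorem trace_insert (hσ : Function.Injective M.σ) (θ : Fin n → M.colourlessOdd) (l : Fin n → ℂ)
    (t : Fin n → 𝔤) {T : Finset (Fin n)} {i : Fin n} (hi : i ∉ T) (hl : l i = 0) :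
    M.trace θ l t (insert i T) = -(∑ j ∈ T, ((M.σ i - M.σ j)⁻¹ * l j) •
      M.trace (Function.update θ j (θ i)) (Function.update l j 0)
        (Function.update t j ⁅t i, t j⁆) T) -
      ∑ u ∈ T, if T = {u} then ((M.σ i - M.σ u)⁻¹ * M.κ (t i) (t u)) • M.oddMul (θ i) (θ u)
        else 0 := by
  have h1 : ∀ j ∈ T, M.ends (Function.update θ j (θ i)) (Function.update l j 0) T =
      ∑ d ∈ T.erase j, ((M.σ d - M.σ j) * ∏ k ∈ (T.erase j).erase d, l k) •
        M.oddMul (θ i) (θ d) := by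
    intro j hj
    conv_lhs => rw [← Finset.insert_erase hj]
    rw [M.ends_insert _ _ (Finset.notMem_erase _ _) (Function.update_self _ _ _),
      Function.update_self]
    refine Finset.sum_congr rfl fun d hd => ?_
    rw [Function.update_of_ne (Finset.ne_of_mem_erase hd)]
    congr 2
    refine Finset.prod_congr rfl fun k hk => ?_
    rw [Function.update_of_ne (Finset.ne_of_mem_erase (Finset.mem_of_mem_erase hk))]
  have h2 : ∑ j ∈ T, ((M.σ i - M.σ j)⁻¹ * l j) •
      M.trace (Function.update θ j (θ i)) (Function.update l j 0)
        (Function.update t j ⁅t i, t j⁆) T = ∑ d ∈ T, ∑ j ∈ T.erase d,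
        ((-1) ^ (T.card + 1) * ((M.σ i - M.σ j)⁻¹ * ((M.σ d - M.σ j) *
          M.col (Function.update t j ⁅t i, t j⁆) T)) * ∏ k ∈ T.erase d, l k) •
          M.oddMul (θ i) (θ d) := by
    rw [Finset.sum_comm' (t' := T) (s' := fun j => T.erase j)
      (by intro x y; simp only [Finset.mem_erase]; tauto)]
    refine Finset.sum_congr rfl fun j hj => ?_
    rw [trace, h1 j hj, Finset.smul_sum, Finset.smul_sum]
    refine Finset.sum_congr rfl fun d hd => ?_
    have hjd : j ∈ T.erase d := by
      rw [Finset.mem_erase] at hd ⊢; exact ⟨hd.1.symm, hj⟩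
    rw [smul_smul, smul_smul, ← Finset.mul_prod_erase _ _ hjd, Finset.erase_right_comm]
    congr 1
    ring
  rw [h2, trace, M.ends_insert _ _ hi hl, Finset.smul_sum, ← Finset.sum_neg_distrib,
    ← Finset.sum_sub_distrib]
  refine Finset.sum_congr rfl fun d hd => ?_
  rw [← Finset.sum_smul, smul_smul, Finset.card_insert_of_notMem hi,
    show (-1 : ℂ) ^ (T.card + 1 + 1) * M.col t (insert i T) *
      ((M.σ d - M.σ i) * ∏ j ∈ T.erase d, l j) = (-1 : ℂ) ^ (T.card + 1 + 1) *
      ((M.σ d - M.σ i) * M.col t (insert i T)) * ∏ j ∈ T.erase d, l j by ring, M.col_insert hσ t hi hd,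
      ← Finset.sum_mul, ← Finset.mul_sum]
  split_ifs with h
  · subst h
    simp only [Finset.card_singleton, Finset.erase_singleton, Finset.prod_empty]
    module
  · module

end MatterData
end CombSusy
end

/-! ### Distributions of the tilded gluons among traces and the gluon correlator -/

noncomputable section
namespace CombSusy

/-- The maps that send `S` into `U` and fix everything else. -/
def retractions {α : Type*} [Fintype α] [DecidableEq α] (S U : Finset α) : Finset (α → α) :=
  Fintype.piFinset fun j => if j ∈ S then U else {j}

theorem mem_retractions {α : Type*} [Fintype α] [DecidableEq α] {S U : Finset α} {f : α → α} :
    f ∈ retractions S U ↔ (∀ j ∈ S, f j ∈ U) ∧ ∀ j ∉ S, f j = j := by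
  simp only [retractions, Fintype.mem_piFinset]
  constructor
  · intro h
    exact ⟨fun j hj => by simpa [hj] using h j, fun j hj => by simpa [hj] using h j⟩
  · rintro ⟨h1, h2⟩ j
    by_cases hj : j ∈ S
    · simpa [hj] using h1 j hj
    · simpa [hj] using h2 j hj

theorem sum_retractions_insert {α E : Type*} [Fintype α] [DecidableEq α] [AddCommMonoid E]
    {S U : Finset α} {i : α} (hi : i ∉ S) (F : (α → α) → E) :
    ∑ f ∈ retractions (insert i S) U, F f =
      ∑ f ∈ retractions S U, ∑ u ∈ U, F (Function.update f i u) := by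
  rw [← Finset.sum_product']
  refine Finset.sum_bij' (fun f _ => (Function.update f i i, f i))
    (fun p _ => Function.update p.1 i p.2) ?_ ?_ ?_ ?_ ?_
  · intro f hf
    rw [mem_retractions] at hf
    rw [Finset.mem_product, mem_retractions]
    refine ⟨⟨fun j hj => ?_, fun j hj => ?_⟩, hf.1 i (Finset.mem_insert_self _ _)⟩
    · dsimp only
      rw [Function.update_of_ne (a := j) (a' := i) (by rintro rfl; exact hi hj)]
      exact hf.1 j (Finset.mem_insert_of_mem hj)
    · by_cases h : j = i
      · subst h; simp
      · dsimp only
        rw [Function.update_of_ne h]; exact hf.2 j (by simp [h, hj])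
  · rintro ⟨f, u⟩ hf
    rw [Finset.mem_product, mem_retractions] at hf
    rw [mem_retractions]
    refine ⟨fun j hj => ?_, fun j hj => ?_⟩
    · by_cases h : j = i
      · subst h; simpa using hf.2
      · rw [Function.update_of_ne h]
        exact hf.1.1 j (Finset.mem_of_mem_insert_of_ne hj h)
    · rw [Finset.mem_insert, not_or] at hj
      rw [Function.update_of_ne hj.1]
      exact hf.1.2 j hj.2
  · intro f _; simp
  · rintro ⟨f, u⟩ hf
    rw [Finset.mem_product, mem_retractions] at hf
    simp only [Function.update_idem, Function.update_self, Prod.mk.injEq, and_true]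
    rw [Function.update_eq_self_iff]
    exact (hf.1.2 i hi).symm
  · intro f _; simp

/-- The fibre of a self-map of a finite type. -/
def fibre {α : Type*} [Fintype α] [DecidableEq α] (f : α → α) (u : α) : Finset α := {j | f j = u}

theorem mem_fibre {α : Type*} [Fintype α] [DecidableEq α] {f : α → α} {u j : α} :
    j ∈ fibre f u ↔ f j = u := by simp [fibre]

namespace MatterData
open WickFunctional

variable {n : ℕ} {V 𝔤 ι : Type*} [AddCommGroup V] [Module ℂ V]
    [LieRing 𝔤] [LieAlgebra ℂ 𝔤] [Fintype ι] [DecidableEq ι] (M : MatterData n V 𝔤 ι)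

/-- The sum over all ways to distribute the labels in `S` among colour traces that are based at
the labels in `U`. -/
def traceSum (S U : Finset (Fin n)) (θ : Fin n → M.colourlessOdd) (l : Fin n → ℂ)
    (t : Fin n → 𝔤) : M.F.evenCenter :=
  ∑ f ∈ retractions S U, ∏ u ∈ U, M.trace θ l t (fibre f u)

theorem trace_congr {θ θ' : Fin n → M.colourlessOdd} {l l' : Fin n → ℂ} {t t' : Fin n → 𝔤}
    {T : Finset (Fin n)} (hσ : Function.Injective M.σ) (h : ∀ j ∈ T, θ j = θ' j)
    (h' : ∀ j ∈ T, l j = l' j) (h'' : ∀ j ∈ T, t j = t' j) :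
    M.trace θ l t T = M.trace θ' l' t' T := by
  rw [trace, trace, M.ends_congr h h']
  by_cases hT : ∃ c ∈ T, ∃ d ∈ T, c ≠ d
  · obtain ⟨c, hc, d, hd, hcd⟩ := hT
    rw [M.col_eq_cyc hσ _ hc hd hcd, M.col_eq_cyc hσ _ hc hd hcd, cyc, cyc, h'' c hc]
    congr 3
    refine chain_congr _ _ _ _ _ _ fun j hj => h'' j ?_
    rw [Finset.mem_insert, Finset.mem_erase, Finset.mem_erase] at hj
    rcases hj with rfl | hj
    · exact hd
    · exact hj.2.2
  -- With fewer than two labels there is no pair of distinct ends, and both sides vanish whatever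
  -- the value of the colour factor.
  · push Not at hT
    have : M.ends θ' l' T = 0 := by
      refine Finset.sum_eq_zero fun c hc => Finset.sum_eq_zero fun d hd => ?_
      rw [hT c hc d hd]; simp
    rw [this, smul_zero, smul_zero]

theorem trace_split (θ : Fin n → M.colourlessOdd) (l : Fin n → ℂ) (t : Fin n → 𝔤)
    {T : Finset (Fin n)} {i : Fin n} (hi : i ∈ T) : M.trace θ l t T =
      M.trace θ (Function.update l i 0) t T + M.trace (Function.update θ i 0) l t T := by
  rw [trace, M.ends_split θ l hi, smul_add]; rfl


theorem traceSum_empty (θ : Fin n → M.colourlessOdd) (l : Fin n → ℂ)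
    (t : Fin n → 𝔤) {S : Finset (Fin n)} (hS : S.Nonempty) : M.traceSum S ∅ θ l t = 0 := by
  obtain ⟨i, hi⟩ := hS
  refine Finset.sum_eq_zero fun f hf => ?_
  simpa using (mem_retractions.1 hf).1 i hi

/-- The two ends of a chain are distinct, and the fibre of `u` contains no label outside `S` other
than `u`. So at least one end lies in `S`, where `θ` vanishes. -/
theorem traceSum_eq_zero {S U : Finset (Fin n)} (hU : U.Nonempty)
    {θ : Fin n → M.colourlessOdd} (hθ : ∀ i ∈ S, θ i = 0) (l : Fin n → ℂ) (t : Fin n → 𝔤) :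
    M.traceSum S U θ l t = 0 := by
  obtain ⟨u, hu⟩ := hU
  refine Finset.sum_eq_zero fun f hf => ?_
  rw [mem_retractions] at hf
  refine Finset.prod_eq_zero hu ?_
  have key : ∀ c ∈ fibre f u, c = u ∨ θ c = 0 := by
    intro c hc
    rw [mem_fibre] at hc
    by_cases h : c ∈ S
    · exact .inr (hθ c h)
    · exact .inl ((hf.2 c h).symm.trans hc)
  rw [trace, ends, Finset.sum_eq_zero, smul_zero]
  intro c hc
  refine Finset.sum_eq_zero fun d hd => ?_
  rcases key c hc with rfl | h
  · rcases key d hd with rfl | h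
    · simp
    · rw [h, oddMul_zero_right, smul_zero]
  · rw [h, oddMul_zero_left, smul_zero]

theorem traceSum_split {S U : Finset (Fin n)} (θ : Fin n → M.colourlessOdd) (l : Fin n → ℂ)
    (t : Fin n → 𝔤) {i : Fin n} (hi : i ∈ S) (hσ : Function.Injective M.σ) : M.traceSum S U θ l t =
      M.traceSum S U θ (Function.update l i 0) t + M.traceSum S U (Function.update θ i 0) l t := by
  rw [traceSum, traceSum, traceSum, ← Finset.sum_add_distrib]
  refine Finset.sum_congr rfl fun f hf => ?_
  have hu := (mem_retractions.1 hf).1 i hi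
  have key : ∀ u ∈ U.erase (f i), M.trace θ l t (fibre f u) =
      M.trace θ (Function.update l i 0) t (fibre f u) ∧ M.trace θ l t (fibre f u) =
      M.trace (Function.update θ i 0) l t (fibre f u) := by
    intro u hu
    have h : ∀ j ∈ fibre f u, j ≠ i := by
      rintro j hj rfl
      exact Finset.ne_of_mem_erase hu (mem_fibre.1 hj).symm
    constructor
    · exact M.trace_congr hσ (fun _ _ => rfl) (fun j hj => by rw [Function.update_of_ne (h j hj)])
        fun _ _ => rfl
    · exact M.trace_congr hσ (fun j hj => by rw [Function.update_of_ne (h j hj)]) (fun _ _ => rfl)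
        fun _ _ => rfl
  rw [← Finset.mul_prod_erase _ _ hu, ← Finset.mul_prod_erase _ _ hu, ← Finset.mul_prod_erase _ _ hu,
    M.trace_split θ l t (mem_fibre.2 rfl : i ∈ fibre f (f i)), add_mul]
  congr 2
  · exact Finset.prod_congr rfl fun u hu => (key u hu).1
  · exact Finset.prod_congr rfl fun u hu => (key u hu).2

/-- Sum `trace_insert` over the trace to which `i` is assigned. Its closing term occurs only for a
fibre `{u}`; the trace is then `{i, u}`, and the labels of `S` are distributed among the remaining
traces. These are the terms produced by contracting the `ρ̃` of vertex `i`. -/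
theorem traceSum_insert (hσ : Function.Injective M.σ) {S U : Finset (Fin n)}
    (hSU : Disjoint S U) {i : Fin n}
    (hiS : i ∉ S) (hiU : i ∉ U) (θ : Fin n → M.colourlessOdd) (l : Fin n → ℂ)
    (t : Fin n → 𝔤) (hl : l i = 0) : M.traceSum (insert i S) U θ l t =
      -(∑ j ∈ S ∪ U, ((M.σ i - M.σ j)⁻¹ * l j) •
        M.traceSum S U (Function.update θ j (θ i)) (Function.update l j 0)
          (Function.update t j ⁅t i, t j⁆)) -
      ∑ u ∈ U, ((M.σ i - M.σ u)⁻¹ * M.κ (t i) (t u)) •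
        (M.oddMul (θ i) (θ u) * M.traceSum S (U.erase u) θ l t) := by
  rw [traceSum, sum_retractions_insert hiS]
  have key : ∀ f ∈ retractions S U, ∀ u ∈ U,
      ∏ w ∈ U, M.trace θ l t (fibre (Function.update f i u) w) =
      -(∑ j ∈ S ∪ U with f j = u, ((M.σ i - M.σ j)⁻¹ * l j) • ∏ w ∈ U,
        M.trace (Function.update θ j (θ i)) (Function.update l j 0)
          (Function.update t j ⁅t i, t j⁆) (fibre f w)) -
      if f ∈ retractions S (U.erase u) then ((M.σ i - M.σ u)⁻¹ * M.κ (t i) (t u)) •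
        (M.oddMul (θ i) (θ u) * ∏ w ∈ U.erase u, M.trace θ l t (fibre f w)) else 0 := by
    intro f hf u hu
    have hf' := mem_retractions.1 hf
    have hfix : ∀ w ∈ U, f w = w := fun w hw => hf'.2 w (Finset.disjoint_right.1 hSU hw)
    have hiu : i ≠ u := by rintro rfl; exact hiU hu
    have h1 : fibre (Function.update f i u) u = insert i (fibre f u) := by
      ext j
      rw [Finset.mem_insert, mem_fibre, mem_fibre]
      by_cases h : j = i
      · subst h; simp
      · simp [h]
    have hi : i ∉ fibre f u := by rw [mem_fibre, hf'.2 i hiS]; exact hiu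
    have h2 : ∀ w ∈ U.erase u, fibre (Function.update f i u) w = fibre f w := by
      intro w hw
      obtain ⟨hwu, hw⟩ := Finset.mem_erase.1 hw
      ext j
      rw [mem_fibre, mem_fibre]
      by_cases h : j = i
      · subst h
        rw [Function.update_self, hf'.2 j hiS]
        simp only [hwu.symm, false_iff]
        rintro rfl; exact hiU hw
      · simp [h]
    have h3 : fibre f u = (S ∪ U).filter (f · = u) := by
      ext j
      simp only [mem_fibre, Finset.mem_filter, Finset.mem_union, iff_and_self]
      intro h
      by_cases hj : j ∈ S
      · exact .inl hj
      · exact .inr ((hf'.2 j hj ▸ h) ▸ hu)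
    rw [← Finset.mul_prod_erase _ _ hu, h1, Finset.prod_congr rfl fun w hw => by rw [h2 w hw],
      M.trace_insert hσ θ l t hi hl, sub_mul, neg_mul, Finset.sum_mul, ← h3]
    congr 2
    · refine Finset.sum_congr rfl fun j hj => ?_
      rw [smul_mul_assoc, ← Finset.mul_prod_erase _ _ hu]
      congr 2
      refine Finset.prod_congr rfl fun w hw => ?_
      have : ∀ k ∈ fibre f w, k ≠ j := by
        rintro k hk rfl
        exact Finset.ne_of_mem_erase hw ((mem_fibre.1 hk).symm.trans (mem_fibre.1 hj))
      exact M.trace_congr hσ (fun k hk => by rw [Function.update_of_ne (this k hk)])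
        (fun k hk => by rw [Function.update_of_ne (this k hk)])
        (fun k hk => by rw [Function.update_of_ne (this k hk)])
    · have hmem : u ∈ fibre f u := mem_fibre.2 (hfix u hu)
      rw [Finset.sum_eq_single u]
      · have : fibre f u = {u} ↔ f ∈ retractions S (U.erase u) := by
          rw [mem_retractions]
          constructor
          · intro h
            refine ⟨fun j hj => Finset.mem_erase.2 ⟨?_, hf'.1 j hj⟩, hf'.2⟩
            intro hju
            have : j ∈ fibre f u := mem_fibre.2 hju
            rw [h, Finset.mem_singleton] at this
            subst this
            exact Finset.disjoint_left.1 hSU hj hu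
          · intro h
            refine Finset.eq_singleton_iff_unique_mem.2 ⟨hmem, fun j hj => ?_⟩
            rw [mem_fibre] at hj
            by_cases hjS : j ∈ S
            · exact absurd hj (Finset.ne_of_mem_erase (h.1 j hjS))
            · exact (h.2 j hjS).symm.trans hj
        simp only [this]
        split_ifs
        · rw [smul_mul_assoc]
        · rw [zero_mul]
      · intro b hb hbu
        rw [if_neg]
        intro h
        rw [h, Finset.mem_singleton] at hmem
        exact hbu hmem.symm
      · exact fun h => absurd hmem h
  rw [Finset.sum_congr rfl fun f hf => Finset.sum_congr rfl fun u hu => key f hf u hu]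
  simp only [Finset.sum_sub_distrib, Finset.sum_neg_distrib]
  refine congr_arg₂ _ (congr_arg _ ?_) ?_
  · have : ∀ f ∈ retractions S U, ∀ j ∈ S ∪ U, f j ∈ U := by
      intro f hf j hj
      have hf' := mem_retractions.1 hf
      by_cases h : j ∈ S
      · exact hf'.1 j h
      · rw [hf'.2 j h]; exact (Finset.mem_union.1 hj).resolve_left h
    rw [Finset.sum_congr rfl fun f hf => Finset.sum_fiberwise_of_maps_to (this f hf) _,
      Finset.sum_comm]
    refine Finset.sum_congr rfl fun j _ => ?_
    rw [traceSum, Finset.smul_sum]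
  · rw [Finset.sum_comm]
    refine Finset.sum_congr rfl fun u hu => ?_
    rw [traceSum, Finset.mul_sum, Finset.smul_sum, ← Finset.sum_filter]
    refine Finset.sum_congr ?_ fun _ _ => rfl
    ext f
    simp only [Finset.mem_filter, mem_retractions, Finset.mem_erase]
    exact ⟨fun h => h.2, fun h => ⟨⟨fun j hj => (h.1 j hj).2, h.2⟩, h⟩⟩

/-- The expectation value of gluon vertices, of which those in `U` are untilded, as a sum over
the distributions of the tilded gluons among colour traces. -/
theorem evEven_prod_vertex (hσ : Function.Injective M.σ) (b : Fin n → Bool)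
    (S U : Finset (Fin n)) (hS : ∀ j ∈ S, b j = true) (hU : ∀ j ∈ U, b j = false)
    (θ : Fin n → M.colourlessOdd) (l : Fin n → ℂ) (t : Fin n → 𝔤) {Y : M.F.evenCenter}
    (hY : Y ∈ M.colourlessEven) :
    M.evEven (Y * ∏ j ∈ S ∪ U, M.vertex (b j) (θ j) (l j) (t j) j) =
      M.evEven (Y * M.traceSum S U θ l t) := by
  induction hN : S.card generalizing S U θ l t Y with
  | zero =>
    obtain rfl := Finset.card_eq_zero.1 hN
    rcases U.eq_empty_or_nonempty with rfl | hUn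
    · simp [traceSum, retractions]
    -- With no `ρ̃` left, the untilded vertices have no contractions; on the other side all fibres
    -- are singletons.
    · rw [M.traceSum_eq_zero hUn (by simp), mul_zero, map_zero]
      obtain ⟨u, hu⟩ := hUn
      rw [Finset.empty_union, ← Finset.mul_prod_erase _ _ hu, hU u hu, mul_left_comm]
      refine M.evEven_untilded_mul _ _ _ _ fun s j => ?_
      have : ∀ W ⊆ U, M.dRho s j (∏ j ∈ W, M.vertex (b j) (θ j) (l j) (t j) j : M.F.evenCenter) = 0 := by
        intro W hW
        induction W using Finset.induction_on with
        | empty => simp [contr_one]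
        | insert a W ha ih =>
          rw [Finset.prod_insert ha, MulMemClass.coe_mul, dRho_mul, hU a (hW (by simp)),
            dRho_vertex_untilded, ih fun x hx => hW (by simp [hx])]
          simp
      rw [MulMemClass.coe_mul, dRho_mul, hY.1, this _ (Finset.erase_subset _ _)]
      simp
  | succ N ih =>
    have hSU : Disjoint S U := Finset.disjoint_left.2 fun j h h' => by simpa [hS j h] using hU j h'
    -- If vertex `i` has no current, contracting its `ρ̃` reduces the number of tilded vertices, and
    -- `traceSum_insert` matches the result term by term.
    have hA : ∀ (i : Fin n) (hi : i ∈ S) (θ : Fin n → M.colourlessOdd) (l : Fin n → ℂ), l i = 0 →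
        M.evEven (Y * ∏ j ∈ S ∪ U, M.vertex (b j) (θ j) (l j) (t j) j) =
          M.evEven (Y * M.traceSum S U θ l t) := by
      intro i hi θ l hl
      obtain ⟨S, hiS, rfl⟩ : ∃ S', i ∉ S' ∧ S = insert i S' :=
        ⟨S.erase i, Finset.notMem_erase _ _, (Finset.insert_erase hi).symm⟩
      have hiU : i ∉ U := Finset.disjoint_left.1 hSU hi
      have hSU' : Disjoint S U := hSU.mono_left (Finset.subset_insert _ _)
      have hS' : ∀ j ∈ S, b j = true := fun j hj => hS j (Finset.mem_insert_of_mem hj)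
      have hcard : S.card = N := by simpa [hiS] using hN
      have hiSU : i ∉ S ∪ U := by simp [hiS, hiU]
      rw [Finset.insert_union, Finset.prod_insert hiSU, hS i hi, hl, mul_left_comm,
        evEven_vertex_mul, Derivation.leibniz, M.dTheta_colourless _ _ _ hY, smul_zero, add_zero,
        smul_eq_mul, Derivation.leibniz_prod, M.traceSum_insert hσ hSU' hiS hiU θ l t hl]
      have h1 : ∀ j ∈ S ∪ U, M.dTheta (θ i) (t i) i (M.vertex (b j) (θ j) (l j) (t j) j) *
          ∏ k ∈ (S ∪ U).erase j, M.vertex (b k) (θ k) (l k) (t k) k =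
          -(((M.σ i - M.σ j)⁻¹ * l j) • ∏ k ∈ S ∪ U, M.vertex (b k)
            (Function.update θ j (θ i) k) (Function.update l j 0 k)
            (Function.update t j ⁅t i, t j⁆ k) k) -
          if b j = true then 0 else ((M.σ i - M.σ j)⁻¹ * M.κ (t i) (t j)) •
            (M.oddMul (θ i) (θ j) *
              ∏ k ∈ (S ∪ U).erase j, M.vertex (b k) (θ k) (l k) (t k) k) := by
        intro j hj
        have hij : i ≠ j := by rintro rfl; exact hiSU hj
        rw [M.dTheta_vertex _ _ _ _ _ _ hij, ← Finset.mul_prod_erase (S ∪ U) _ hj,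
          Function.update_self, Function.update_self, Function.update_self]
        have h2 : ∏ k ∈ (S ∪ U).erase j, M.vertex (b k) (Function.update θ j (θ i) k)
            (Function.update l j 0 k) (Function.update t j ⁅t i, t j⁆ k) k =
            ∏ k ∈ (S ∪ U).erase j, M.vertex (b k) (θ k) (l k) (t k) k :=
          Finset.prod_congr rfl fun k hk => by rw [Function.update_of_ne (Finset.ne_of_mem_erase hk),
            Function.update_of_ne (Finset.ne_of_mem_erase hk),
            Function.update_of_ne (Finset.ne_of_mem_erase hk)]
        rw [h2]
        split_ifs
        · rw [add_zero, smul_smul, neg_mul, smul_mul_assoc, sub_zero]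
        · simp only [smul_add, smul_smul, neg_mul, add_mul, smul_mul_assoc]
          abel
      rw [Finset.sum_congr rfl h1, Finset.sum_sub_distrib, Finset.sum_neg_distrib, mul_sub, mul_sub,
        mul_neg, mul_neg, map_sub, map_sub, map_neg, map_neg]
      refine congr_arg₂ _ (congr_arg _ ?_) ?_
      · simp only [Finset.mul_sum, map_sum, mul_smul_comm, map_smul]
        refine Finset.sum_congr rfl fun j _ => ?_
        rw [ih S U hS' hU _ _ _ hY hcard]
      · rw [Finset.sum_union hSU', Finset.sum_eq_zero fun j hj => if_pos (hS' j hj), zero_add]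
        simp only [Finset.mul_sum, map_sum]
        refine Finset.sum_congr rfl fun u hu => ?_
        have huS : u ∉ S := Finset.disjoint_right.1 hSU' hu
        rw [hU u hu, if_neg (by simp), mul_smul_comm, map_smul, mul_smul_comm, map_smul, ← mul_assoc,
          ← mul_assoc, Finset.erase_union_distrib, Finset.erase_eq_of_notMem huS, ih S (U.erase u) hS'
            (fun j hj => hU j (Finset.mem_of_mem_erase hj)) _ _ _
            (Subalgebra.mul_mem _ hY (M.oddMul_mem _ _)) hcard]
    -- The set `A` contains the tilded labels at which `θ` may be nonzero; it is enlarged one label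
    -- at a time.
    suffices H : ∀ A ⊆ S, ∀ θ : Fin n → M.colourlessOdd, (∀ j ∈ S \ A, θ j = 0) →
        M.evEven (Y * ∏ j ∈ S ∪ U, M.vertex (b j) (θ j) (l j) (t j) j) =
          M.evEven (Y * M.traceSum S U θ l t) from H S subset_rfl θ (by simp)
    have hne : S.Nonempty := Finset.card_pos.1 (by omega)
    intro A hA'
    induction A using Finset.induction_on with
    | empty =>
      intro θ hθ
      rw [Finset.sdiff_empty] at hθ
      have h0 : M.traceSum S U θ l t = 0 := by
        rcases U.eq_empty_or_nonempty with rfl | hUn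
        · exact M.traceSum_empty _ _ _ hne
        · exact M.traceSum_eq_zero hUn hθ _ _
      obtain ⟨i, hi⟩ := hne
      rw [h0, mul_zero, map_zero, ← Finset.mul_prod_erase _ _ (Finset.mem_union_left U hi), hS i hi,
        hθ i hi, mul_left_comm]
      -- All tilded vertices are pure currents: the one at `i` is exact, and all other factors are
      -- invariant.
      refine M.evEven_current_mul _ _ _ ?_
      have : ∀ W ⊆ S ∪ U,
          M.Q (∏ j ∈ W, M.vertex (b j) (θ j) (l j) (t j) j : M.F.evenCenter) = 0 := by
        intro W hW
        induction W using Finset.induction_on with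
        | empty => exact susy_one _
        | insert a W ha ih =>
          have h1 : M.Q (M.vertex (b a) (θ a) (l a) (t a) a) = 0 := by
            rcases Finset.mem_union.1 (hW (Finset.mem_insert_self a W)) with h | h
            · rw [hS a h, hθ a h, Q_vertex_tilde]
            · rw [hU a h, Q_vertex_untilded]
          rw [Finset.prod_insert ha, MulMemClass.coe_mul, susy_mul, h1,
            ih fun x hx => hW (by simp [hx])]
          simp
      rw [MulMemClass.coe_mul, susy_mul, hY.2.2, this _ (Finset.erase_subset _ _)]
      simp
    | insert i A hi ihA =>
      intro θ hθ
      have hiS : i ∈ S := hA' (Finset.mem_insert_self _ _)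
      -- Both sides are additive in the pair `(θ i, l i)`. The part with `l i = 0` is covered by
      -- `hA`, the part with `θ i = 0` by the induction over `A`.
      have h1 := hA i hiS θ (Function.update l i 0) (Function.update_self _ _ _)
      have h2 := ihA (fun x hx => hA' (by simp [hx])) (Function.update θ i 0) (by
        intro j hj
        by_cases h : j = i
        · subst h; simp
        · rw [Function.update_of_ne h]
          exact hθ j (by simpa [h] using hj))
      rw [M.traceSum_split θ l t hiS hσ, mul_add, map_add, ← h1, ← h2, ← map_add, ← mul_add]
      congr 2
      have hi' := Finset.mem_union_left U hiS
      rw [← Finset.mul_prod_erase _ _ hi', ← Finset.mul_prod_erase _ _ hi',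
        ← Finset.mul_prod_erase _ _ hi', Function.update_self, Function.update_self]
      have h3 := M.vertex_add (b i) (θ i) 0 0 (l i) (t i) i
      rw [add_zero, zero_add] at h3
      rw [h3, add_mul]
      congr 2 <;>
      exact Finset.prod_congr rfl fun k hk => by rw [Function.update_of_ne (Finset.ne_of_mem_erase hk)]

end MatterData
end CombSusy
end

/-! ### Pfaffians as functionals on the exterior algebra -/

noncomputable section
namespace CombSusy

section PfaffianFunctional

variable {E : Type*} [AddCommGroup E] [Module ℂ E]

local notation "Λ" => ExteriorAlgebra ℂ E

/-- Contraction of the exterior algebra with a functional. -/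
def del : Module.Dual ℂ E →ₗ[ℂ] Λ →ₗ[ℂ] Λ :=
  CliffordAlgebra.contractLeft (Q := (0 : QuadraticForm ℂ E))

/-- The degree one part of the exterior algebra. -/
def vec : E →ₗ[ℂ] Λ := ExteriorAlgebra.ι ℂ

theorem del_vec_mul (d : Module.Dual ℂ E) (u : E) (w : Λ) :
    del d (vec u * w) = d u • w - vec u * del d w :=
  CliffordAlgebra.contractLeft_ι_mul _ _ _

theorem del_one (d : Module.Dual ℂ E) : del d (1 : Λ) = 0 := CliffordAlgebra.contractLeft_one (Q := (0 : QuadraticForm ℂ E)) _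

theorem del_comm (d d' : Module.Dual ℂ E) (w : Λ) : del d (del d' w) = -del d' (del d w) :=
  CliffordAlgebra.contractLeft_comm _ _ _

theorem del_self (d : Module.Dual ℂ E) (w : Λ) : del d (del d w) = 0 :=
  CliffordAlgebra.contractLeft_contractLeft _ _

theorem vec_mul_self (u : E) : vec u * vec u = (0 : Λ) := ExteriorAlgebra.ι_sq_zero u

theorem vec_mul_comm (u v : E) : vec u * vec v = -(vec v * vec u : Λ) :=
  eq_neg_of_add_eq_zero_left (ExteriorAlgebra.ι_add_mul_swap u v)

theorem ext_induction {p : Λ → Prop} (h0 : ∀ r : ℂ, p (algebraMap ℂ _ r))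
    (ha : ∀ x y, p x → p y → p (x + y)) (hm : ∀ u w, p w → p (vec u * w)) (w : Λ) : p w :=
  CliffordAlgebra.left_induction (Q := (0 : QuadraticForm ℂ E)) (P := p) h0 ha
    (fun w u h => hm u w h) w

/-- A functional on the exterior algebra given by the Pfaffians of a form. -/
structure IsPfaffian (B : E →ₗ[ℂ] E →ₗ[ℂ] ℂ) (φ : Λ →ₗ[ℂ] ℂ) : Prop where
  one : φ 1 = 1
  vec_mul : ∀ u w, φ (vec u * w) = φ (del (B u) w)


theorem toQuadraticMap_eq_zero {B : E →ₗ[ℂ] E →ₗ[ℂ] ℂ} (hB : ∀ x, B x x = 0) :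
    LinearMap.BilinMap.toQuadraticMap B = (0 : QuadraticForm ℂ E) - 0 := by
  ext x; simpa using hB x

/-- The exponential of the contraction with a two-form. -/
def expForm (B : E →ₗ[ℂ] E →ₗ[ℂ] ℂ) (hB : ∀ x, B x x = 0) : Λ →ₗ[ℂ] Λ :=
  CliffordAlgebra.changeForm (toQuadraticMap_eq_zero hB)

theorem expForm_algebraMap (B : E →ₗ[ℂ] E →ₗ[ℂ] ℂ) (hB : ∀ x, B x x = 0) (r : ℂ) :
    expForm B hB (algebraMap ℂ _ r) = algebraMap ℂ _ r := CliffordAlgebra.changeForm_algebraMap _ _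

theorem expForm_vec_mul (B : E →ₗ[ℂ] E →ₗ[ℂ] ℂ) (hB : ∀ x, B x x = 0) (u : E) (w : Λ) :
    expForm B hB (vec u * w) = vec u * expForm B hB w - del (B u) (expForm B hB w) :=
  CliffordAlgebra.changeForm_ι_mul _ _ _

theorem expForm_del (B : E →ₗ[ℂ] E →ₗ[ℂ] ℂ) (hB : ∀ x, B x x = 0) (d : Module.Dual ℂ E) (w : Λ) :
    expForm B hB (del d w) = del d (expForm B hB w) :=
  CliffordAlgebra.changeForm_contractLeft _ _ _

theorem neg_alternating {B : E →ₗ[ℂ] E →ₗ[ℂ] ℂ} (hB : ∀ x, B x x = 0) (x : E) : (-B) x x = 0 := by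
  simp [hB x]

theorem expForm_expForm_neg (B : E →ₗ[ℂ] E →ₗ[ℂ] ℂ) (hB : ∀ x, B x x = 0) (w : Λ) :
    expForm B hB (expForm (-B) (neg_alternating hB) w) = w := by
  induction w using ext_induction with
  | h0 r => rw [expForm_algebraMap, expForm_algebraMap]
  | ha x y hx hy => rw [map_add, map_add, hx, hy]
  | hm u w h =>
    rw [expForm_vec_mul, map_sub, expForm_vec_mul, expForm_del, h, LinearMap.neg_apply, map_neg,
      LinearMap.neg_apply]
    abel

/-- Every alternating form has a Pfaffian functional. -/
theorem exists_isPfaffian {B : E →ₗ[ℂ] E →ₗ[ℂ] ℂ} (hB : ∀ x, B x x = 0) :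
    ∃ φ : Λ →ₗ[ℂ] ℂ, IsPfaffian B φ := by
  -- The functional is the constant term after applying the exponential for `-B`. The product with
  -- `u` has no constant term, so only the contraction with `B u` survives, with positive sign.
  refine ⟨(ExteriorAlgebra.algebraMapInv (R := ℂ) (M := E)).toLinearMap ∘ₗ
    expForm (-B) (neg_alternating hB), ?_, ?_⟩
  · rw [LinearMap.comp_apply, ← map_one (algebraMap ℂ Λ), expForm_algebraMap]
    simp
  · intro u w
    rw [LinearMap.comp_apply, LinearMap.comp_apply, expForm_vec_mul, expForm_del, vec]
    simp [ExteriorAlgebra.algebraMapInv]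

/-- The exponential of `B` is surjective, and after composition with it the recursion says that a
Pfaffian functional vanishes on all products `u ∧ w`. Only the value at `1` remains. -/
theorem IsPfaffian.unique {B : E →ₗ[ℂ] E →ₗ[ℂ] ℂ} (hB : ∀ x, B x x = 0) {φ ψ : Λ →ₗ[ℂ] ℂ}
    (hφ : IsPfaffian B φ) (hψ : IsPfaffian B ψ) : φ = ψ := by
  have key : ∀ w : Λ, (φ - ψ) (expForm B hB w) = 0 := by
    intro w
    induction w using ext_induction with
    | h0 r =>
      rw [expForm_algebraMap, Algebra.algebraMap_eq_smul_one, map_smul]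
      simp [hφ.one, hψ.one]
    | ha x y hx hy => rw [map_add, map_add, hx, hy, add_zero]
    | hm u w h =>
      rw [expForm_vec_mul, map_sub, LinearMap.sub_apply, LinearMap.sub_apply, hφ.vec_mul,
        hψ.vec_mul, sub_self]
  refine LinearMap.ext fun w => sub_eq_zero.1 ?_
  rw [← LinearMap.sub_apply, ← expForm_expForm_neg B hB w, key]

/-- The form `α ∧ β`. -/
def wedge (α β : Module.Dual ℂ E) : E →ₗ[ℂ] E →ₗ[ℂ] ℂ :=
  α.smulRight β - β.smulRight α

theorem wedge_apply (α β : Module.Dual ℂ E) (u : E) : wedge α β u = α u • β - β u • α := rfl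

/-- The Pfaffian functional of a sum with a form of rank two. -/
theorem IsPfaffian.add_wedge {B : E →ₗ[ℂ] E →ₗ[ℂ] ℂ} {φ : Λ →ₗ[ℂ] ℂ} (hφ : IsPfaffian B φ)
    (α β : Module.Dual ℂ E) : IsPfaffian (B + wedge α β) (φ + φ ∘ₗ del β ∘ₗ del α) := by
  constructor
  · simp [hφ.one, del_one]
  · intro u w
    simp only [LinearMap.add_apply, LinearMap.comp_apply, del_vec_mul, map_sub, map_smul, map_add,
      hφ.vec_mul, wedge_apply, LinearMap.sub_apply, LinearMap.smul_apply]
    -- The exponential series of the rank-two form stops at first order, since a repeated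
    -- contraction with `α` or `β` vanishes.
    have h1 : del β (del α (del β w)) = 0 := by rw [del_comm α β, map_neg, del_self, neg_zero]
    have h2 : del (B u) (del β (del α w)) = del β (del α (del (B u) w)) := by
      rw [del_comm (B u) β, del_comm (B u) α, map_neg, neg_neg]
    rw [h1, h2, del_self, map_zero, map_zero]
    simp only [smul_eq_mul, map_zero]
    ring

/-- The correction in `IsPfaffian.add_wedge` contains a contraction with `β`. In applications `β` is
the coordinate of a row that no longer occurs in `w`. -/
theorem IsPfaffian.apply_eq_of_del_eq_zero {B B' : E →ₗ[ℂ] E →ₗ[ℂ] ℂ} (hB : ∀ x, B' x x = 0)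
    {φ φ' : Λ →ₗ[ℂ] ℂ}
    (hφ : IsPfaffian B φ) (hφ' : IsPfaffian B' φ') {α β : Module.Dual ℂ E}
    (h : B' = B + wedge α β) {w : Λ} (hw : del β w = 0) : φ' w = φ w := by
  subst h
  rw [hφ'.unique hB (hφ.add_wedge α β)]
  simp [del_comm β α, hw]

/-- The Plücker relation for a Pfaffian functional and an element `G` divisible by two null
vectors `r`, `s`. -/
theorem IsPfaffian.plucker {B : E →ₗ[ℂ] E →ₗ[ℂ] ℂ} {φ : Λ →ₗ[ℂ] ℂ} (hφ : IsPfaffian B φ)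
    {r s : E} (hr : B r = 0) (hs : B s = 0) {G : Λ} (hrG : vec r * G = 0) (hsG : vec s * G = 0)
    (d₁ d₂ d₃ d₄ : Module.Dual ℂ E) :
    φ (del d₁ (del d₂ G)) * (d₃ r * d₄ s - d₃ s * d₄ r) =
      φ (del d₃ (del d₄ G)) * (d₁ r * d₂ s - d₁ s * d₂ r) := by
  -- Contract `v ∧ G = 0` three times. The terms in which `v` survives are removed by `B v = 0`, and
  -- the others form a linear relation between the double contractions. The relations for `r` and
  -- `s` together give the claim.
  have key : ∀ (v : E), B v = 0 → vec v * G = 0 → ∀ d d' d'' : Module.Dual ℂ E,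
      d'' v * φ (del d (del d' G)) - d' v * φ (del d (del d'' G)) +
        d v * φ (del d' (del d'' G)) = 0 := by
    intro v hv hG d d' d''
    have h : φ (del d (del d' (del d'' (vec v * G)))) = 0 := by rw [hG]; simp
    simp only [del_vec_mul, map_sub, map_smul, smul_eq_mul, hφ.vec_mul, hv, map_zero,
      LinearMap.zero_apply] at h
    linear_combination h
  have h1 := key r hr hrG d₁ d₂ d₃
  have h2 := key r hr hrG d₁ d₂ d₄
  have h3 := key s hs hsG d₁ d₃ d₄
  have h4 := key s hs hsG d₂ d₃ d₄
  linear_combination d₄ s * h1 - d₃ s * h2 + d₂ r * h3 - d₁ r * h4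

/-- The product of the vectors labelled by a list. -/
def vecProd {R : Type*} (v : R → E) (l : List R) : Λ := (l.map fun x => vec (v x)).prod

theorem vecProd_cons {R : Type*} (v : R → E) (x : R) (l : List R) :
    vecProd v (x :: l) = vec (v x) * vecProd v l := by simp [vecProd]

theorem vecProd_append {R : Type*} (v : R → E) (l l' : List R) :
    vecProd v (l ++ l') = vecProd v l * vecProd v l' := by simp [vecProd]

theorem del_vecProd {R : Type*} (d : Module.Dual ℂ E) (v : R → E) (l : List R) :
    del d (vecProd v l) =
      ∑ j : Fin l.length, ((-1) ^ (j : ℕ) * d (v l[j])) • vecProd v (l.eraseIdx j) := by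
  induction l with
  | nil => exact del_one d
  | cons x l ih =>
    rw [vecProd_cons, del_vec_mul, ih]
    rw [show (∑ j : Fin (x :: l).length, ((-1) ^ (j : ℕ) * d (v (x :: l)[j])) •
      vecProd v ((x :: l).eraseIdx j)) = ∑ j : Fin (l.length + 1), ((-1) ^ (j : ℕ) *
        d (v (x :: l)[j])) • vecProd v ((x :: l).eraseIdx j) from rfl, Fin.sum_univ_succ,
      Finset.mul_sum, sub_eq_add_neg, ← Finset.sum_neg_distrib]
    congr 1
    · simp
    · refine Finset.sum_congr rfl fun j _ => ?_
      simp [vecProd_cons, pow_succ]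

theorem IsPfaffian.apply_vecProd {R : Type*} {B : E →ₗ[ℂ] E →ₗ[ℂ] ℂ} {φ : Λ →ₗ[ℂ] ℂ}
    (hφ : IsPfaffian B φ) (v : R → E) (l : List R) :
    φ (vecProd v l) = pfaffian (fun x y => B (v x) (v y)) l := by
  induction h : l.length using Nat.strongRecOn generalizing l with
  | ind N ih =>
    cases l with
    | nil => rw [pfaffian]; exact hφ.one
    | cons x l =>
      rw [pfaffian, vecProd_cons, hφ.vec_mul, del_vecProd, map_sum]
      refine Finset.sum_congr rfl fun j _ => ?_
      rw [map_smul, smul_eq_mul, ih _ (by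
        rw [← h, List.length_eraseIdx, if_pos j.2]; simp) _ rfl]

theorem pfaffian_congr {R : Type*} {M M' : R → R → ℂ} {l : List R}
    (h : ∀ x ∈ l, ∀ y ∈ l, M x y = M' x y) : pfaffian M l = pfaffian M' l := by
  induction hN : l.length using Nat.strongRecOn generalizing l with
  | ind N ih =>
    cases l with
    | nil => rw [pfaffian, pfaffian]
    | cons x l =>
      rw [pfaffian, pfaffian]
      refine Finset.sum_congr rfl fun j _ => ?_
      rw [h x (by simp) l[j] (by simp), ih _ (by
        rw [← hN, List.length_eraseIdx, if_pos j.2]; simp) (fun y hy z hz =>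
          h y (List.mem_cons_of_mem _ (List.mem_of_mem_eraseIdx hy)) z
            (List.mem_cons_of_mem _ (List.mem_of_mem_eraseIdx hz))) rfl]

theorem del_vecProd_eq_zero {R : Type*} (d : Module.Dual ℂ E) (v : R → E) {l : List R}
    (h : ∀ y ∈ l, d (v y) = 0) : del d (vecProd v l) = 0 := by
  rw [del_vecProd]
  exact Finset.sum_eq_zero fun j _ => by rw [h l[j] (List.getElem_mem _), mul_zero, zero_smul]

/-- Hypothesis `hl` says that `x` occurs only once in the list; other labels may be repeated. -/
theorem del_vecProd_of_dual {R : Type*} [DecidableEq R] (d : Module.Dual ℂ E) (v : R → E)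
    {l : List R} {x : R} (hl : x ∉ l.erase x) (hx : x ∈ l) (h1 : d (v x) = 1)
    (h : ∀ y ∈ l, y ≠ x → d (v y) = 0) :
    del d (vecProd v l) = (-1 : ℂ) ^ l.idxOf x • vecProd v (l.erase x) := by
  induction l with
  | nil => simp at hx
  | cons y l ih =>
    rw [vecProd_cons, del_vec_mul]
    by_cases hxy : y = x
    · subst hxy
      rw [List.erase_cons_head] at hl
      rw [h1, del_vecProd_eq_zero d v fun z hz => h z (List.mem_cons_of_mem _ hz) (by
        rintro rfl; exact hl hz)]
      simp
    · have hx' : x ∈ l := (List.mem_cons.1 hx).resolve_left (Ne.symm hxy)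
      rw [List.erase_cons_tail (by simpa using hxy)] at hl
      rw [h y (by simp) hxy, ih (fun hx => hl (List.mem_cons_of_mem _ hx)) hx'
        fun z hz => h z (List.mem_cons_of_mem _ hz),
        List.idxOf_cons_ne _ hxy, List.erase_cons_tail (by simpa using hxy), vecProd_cons]
      simp [pow_succ]

theorem idxOf_erase {R : Type*} [DecidableEq R] {l : List R} {x y : R}
    (hx : x ∈ l) (hy : y ∈ l) (hxy : l.idxOf x < l.idxOf y) :
    (l.erase y).idxOf x = l.idxOf x := by
  induction l with
  | nil => simp at hx
  | cons z l ih =>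
    by_cases hzy : z = y
    · subst hzy; simp at hxy
    · rw [List.erase_cons_tail (by simpa using hzy)]
      by_cases hzx : z = x
      · subst hzx; simp
      · rw [List.idxOf_cons_ne _ hzx, List.idxOf_cons_ne _ hzx, ih]
        · exact (List.mem_cons.1 hx).resolve_left (Ne.symm hzx)
        · exact (List.mem_cons.1 hy).resolve_left (Ne.symm hzy)
        · rw [List.idxOf_cons_ne _ hzx, List.idxOf_cons_ne _ hzy] at hxy; omega

/-- Removal of two entries of a product of vectors by contraction with dual functionals. -/
theorem del_del_vecProd {R : Type*} [DecidableEq R] (d d' : Module.Dual ℂ E) (v : R → E)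
    {l : List R} {x y : R} (hlx : x ∉ l.erase x) (hly : y ∉ l.erase y) (hx : x ∈ l) (hy : y ∈ l)
    (hxy : l.idxOf x < l.idxOf y)
    (h1 : d (v x) = 1) (h : ∀ z ∈ l, z ≠ x → d (v z) = 0)
    (h1' : d' (v y) = 1) (h' : ∀ z ∈ l, z ≠ y → d' (v z) = 0) :
    del d (del d' (vecProd v l)) =
      (-1 : ℂ) ^ (l.idxOf x + l.idxOf y) • vecProd v ((l.erase x).erase y) := by
  have hne : x ≠ y := by rintro rfl; exact lt_irrefl _ hxy
  rw [del_vecProd_of_dual d' v hly hy h1' h', map_smul, del_vecProd_of_dual d v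
    (by rw [List.erase_comm]; exact fun h => hlx (List.mem_of_mem_erase h))
    ((List.mem_erase_of_ne hne).2 hx) h1 fun z hz => h z (List.mem_of_mem_erase hz),
    idxOf_erase hx hy hxy, List.erase_comm, smul_smul, ← pow_add, add_comm]

/-- Even elements of degree two are central. -/
def evenMul (u v : E) : Subalgebra.center ℂ Λ :=
  ⟨vec u * vec v, by
    rw [Subalgebra.mem_center_iff]
    intro w
    induction w using ext_induction with
    | h0 r => rw [Algebra.commutes]
    | ha x y hx hy => rw [add_mul, mul_add, hx, hy]
    | hm x w h =>
      rw [mul_assoc, h, ← mul_assoc, ← mul_assoc, ← mul_assoc, vec_mul_comm x u, neg_mul,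
        mul_assoc (vec u), vec_mul_comm x v, mul_neg, neg_neg, mul_assoc (vec u), mul_assoc (vec u), mul_assoc (vec u)]⟩

theorem evenMul_coe (u v : E) : (evenMul u v : Λ) = vec u * vec v := rfl

theorem vecProd_mul_vec {R : Type*} (x : R → E) (l : List R) (u : E) :
    vecProd x l * vec u = (-1 : ℂ) ^ l.length • (vec u * vecProd x l) := by
  induction l with
  | nil => simp [vecProd]
  | cons r l ih =>
    rw [vecProd_cons, mul_assoc, ih, mul_smul_comm, ← mul_assoc, vec_mul_comm, List.length_cons,
      pow_succ]
    simp [mul_assoc]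

/-- The sign of the rearrangement of `x₁ ⋯ x_N y₁ ⋯ y_N` to `x₁ y₁ ⋯ x_N y_N`. -/
theorem vecProd_mul_vecProd {R : Type*} (x y : R → E) (l : List R) :
    vecProd x l * vecProd y l = (-1 : ℂ) ^ (l.length * (l.length - 1) / 2) •
      ((l.map fun r => evenMul (x r) (y r)).prod : Subalgebra.center ℂ Λ).val := by
  induction l with
  | nil => simp [vecProd]
  | cons r l ih =>
    rw [vecProd_cons, vecProd_cons, mul_assoc, ← mul_assoc (vecProd x l), vecProd_mul_vec,
      smul_mul_assoc, mul_assoc (vec _), ih, List.length_cons, Nat.triangle_succ, List.map_cons,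
      List.prod_cons, MulMemClass.coe_mul, evenMul_coe]
    simp only [mul_smul_comm, smul_smul]
    rw [← pow_add, add_comm, mul_assoc]

end PfaffianFunctional
end CombSusy
end

/-! ### The space of rows, pairs of rows and self-contractions -/

noncomputable section
namespace CombSusy

section RowSpace

variable {n : ℕ}

/-- The space spanned by the row labels. -/
abbrev RowSpace (n : ℕ) := Row n →₀ ℂ

/-- The basis vector of a row label. -/
def row (r : Row n) : RowSpace n := Finsupp.single r 1

/-- The coordinate of a row label. -/
def coord (r : Row n) : Module.Dual ℂ (RowSpace n) := Finsupp.lapply r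

theorem coord_row (r s : Row n) : coord r (row s) = if s = r then 1 else 0 := by
  simp [coord, row, Finsupp.single_apply]

/-- The bilinear form with a given matrix. -/
def rowForm (N : Row n → Row n → ℂ) : RowSpace n →ₗ[ℂ] RowSpace n →ₗ[ℂ] ℂ :=
  Finsupp.linearCombination ℂ fun r => Finsupp.linearCombination ℂ (N r)

theorem rowForm_row (N : Row n → Row n → ℂ) (r s : Row n) : rowForm N (row r) (row s) = N r s := by
  simp [rowForm, row]

theorem dual_ext {f g : Module.Dual ℂ (RowSpace n)} (h : ∀ r, f (row r) = g (row r)) : f = g :=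
  Finsupp.lhom_ext' fun r => LinearMap.ext_ring (h r)

theorem form_ext {B B' : RowSpace n →ₗ[ℂ] RowSpace n →ₗ[ℂ] ℂ}
    (h : ∀ r s, B (row r) (row s) = B' (row r) (row s)) : B = B' :=
  Finsupp.lhom_ext' fun r => LinearMap.ext_ring (dual_ext (h r))

theorem rowForm_self {N : Row n → Row n → ℂ} (h : ∀ r s, N r s = -N s r) (x : RowSpace n) :
    rowForm N x x = 0 := by
  have h1 : rowForm N = -(rowForm N).flip := form_ext fun r s => by
    simp only [LinearMap.neg_apply, LinearMap.flip_apply, rowForm_row]; exact h r s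
  have h2 : rowForm N x x = -rowForm N x x := by
    conv_lhs => rw [h1]
    simp
  linear_combination h2 / 2

/-- The matrix of the contractions of fields with coefficients `K i` and `ε i`, with the numbers
`c i` as contractions of the fields at the same puncture. -/
def rowMatrix {W : Type*} [AddCommGroup W] [Module ℂ W] (η : BilinForm ℂ W) (σ : Fin n → ℂ)
    (K ε : Fin n → W) (c : Fin n → ℂ) : Row n → Row n → ℂ
  | .mom i, .mom j => if i = j then 0 else η (K i) (K j) / (σ i - σ j)
  | .mom i, .pol j => if i = j then c i else η (K i) (ε j) / (σ i - σ j)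
  | .pol i, .mom j => if i = j then -c i else η (ε i) (K j) / (σ i - σ j)
  | .pol i, .pol j => if i = j then 0 else η (ε i) (ε j) / (σ i - σ j)

theorem rowMatrix_skew {W : Type*} [AddCommGroup W] [Module ℂ W] {η : BilinForm ℂ W}
    (hη : ∀ x y, η x y = η y x) (σ : Fin n → ℂ) (K ε : Fin n → W) (c : Fin n → ℂ) (r s : Row n) :
    rowMatrix η σ K ε c r s = -rowMatrix η σ K ε c s r := by
  have key : ∀ i j (x y : W), η x y / (σ i - σ j) = -(η y x / (σ j - σ i)) := by
    intro i j x y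
    rw [hη, ← div_neg, neg_sub]
  cases r with
  | mom i => cases s with
    | mom j =>
      by_cases h : i = j
      · simp [rowMatrix, h]
      · simp only [rowMatrix, h, Ne.symm h, if_false]; exact key _ _ _ _
    | pol j =>
      by_cases h : i = j
      · simp [rowMatrix, h]
      · simp only [rowMatrix, h, Ne.symm h, if_false]; exact key _ _ _ _
  | pol i => cases s with
    | mom j =>
      by_cases h : i = j
      · simp [rowMatrix, h]
      · simp only [rowMatrix, h, Ne.symm h, if_false]; exact key _ _ _ _
    | pol j =>
      by_cases h : i = j
      · simp [rowMatrix, h]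
      · simp only [rowMatrix, h, Ne.symm h, if_false]; exact key _ _ _ _

/-- The product of the two rows of a graviton. -/
def gravitonPair (i : Fin n) : Subalgebra.center ℂ (ExteriorAlgebra ℂ (RowSpace n)) :=
  evenMul (row (.mom i)) (row (.pol i))

/-- The sum of the rows of a trace. -/
def traceVec (T : Finset (Fin n)) : RowSpace n := ∑ c ∈ T, row (.mom c)

/-- The weighted sum of the rows of a trace. -/
def traceVec' (σ : Fin n → ℂ) (T : Finset (Fin n)) : RowSpace n := ∑ c ∈ T, σ c • row (.mom c)

/-- The product of the two rows of a trace. -/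
def tracePair (σ : Fin n → ℂ) (T : Finset (Fin n)) :
    Subalgebra.center ℂ (ExteriorAlgebra ℂ (RowSpace n)) :=
  evenMul (traceVec T) (traceVec' σ T)

end RowSpace

section

variable {E : Type*} [AddCommGroup E] [Module ℂ E]

theorem evenMul_comm (u v : E) : evenMul u v = -evenMul v u := Subtype.ext (vec_mul_comm u v)

theorem evenMul_add_left (u u' v : E) : evenMul (u + u') v = evenMul u v + evenMul u' v :=
  Subtype.ext (by simp [evenMul_coe, add_mul])

theorem evenMul_smul_left (r : ℂ) (u v : E) : evenMul (r • u) v = r • evenMul u v :=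
  Subtype.ext (by simp [evenMul_coe])

/-- The product of two vectors as a bilinear map. -/
def evenMulLin : E →ₗ[ℂ] E →ₗ[ℂ] Subalgebra.center ℂ (ExteriorAlgebra ℂ E) :=
  LinearMap.mk₂ ℂ evenMul evenMul_add_left evenMul_smul_left
    (fun u v v' => by rw [evenMul_comm, evenMul_add_left, evenMul_comm u, evenMul_comm u]; abel)
    (fun r u v => by rw [evenMul_comm, evenMul_smul_left, evenMul_comm u, smul_neg])

theorem evenMulLin_apply (u v : E) : evenMulLin u v = evenMul u v := rfl

theorem evenMul_self (u : E) : evenMul u u = 0 := Subtype.ext (vec_mul_self u)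

theorem del_evenMul_mul (d : Module.Dual ℂ E) (u v : E) (w : ExteriorAlgebra ℂ E) :
    del d (evenMul u v * w) = d u • (vec v * w) - d v • (vec u * w) + evenMul u v * del d w := by
  rw [evenMul_coe, mul_assoc, del_vec_mul, del_vec_mul, mul_sub, mul_smul_comm, mul_assoc]
  abel

theorem del_prod_evenMul_mul {α : Type*} (d : Module.Dual ℂ E) (s : Finset α) (x y : α → E)
    (hx : ∀ i ∈ s, d (x i) = 0) (hy : ∀ i ∈ s, d (y i) = 0) (w : ExteriorAlgebra ℂ E) :
    del d ((∏ i ∈ s, evenMul (x i) (y i) : Subalgebra.center ℂ (ExteriorAlgebra ℂ E)) * w) =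
      (∏ i ∈ s, evenMul (x i) (y i) : Subalgebra.center ℂ (ExteriorAlgebra ℂ E)) * del d w := by
  classical
  induction s using Finset.induction_on with
  | empty => simp
  | insert a s ha ih =>
    rw [Finset.prod_insert ha, MulMemClass.coe_mul, mul_assoc, del_evenMul_mul, hx a (by simp),
      hy a (by simp), ih (fun i hi => hx i (by simp [hi])) (fun i hi => hy i (by simp [hi]))]
    simp [mul_assoc]

theorem vec_mul_evenMul_left (u v : E) : vec u * (evenMul u v : ExteriorAlgebra ℂ E) = 0 := by
  rw [evenMul_coe, ← mul_assoc, vec_mul_self, zero_mul]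

theorem vec_mul_evenMul_right (u v : E) : vec v * (evenMul u v : ExteriorAlgebra ℂ E) = 0 := by
  rw [evenMul_comm, Subalgebra.coe_neg, mul_neg, vec_mul_evenMul_left, neg_zero]

/-- The antisymmetrization of a double sum. -/
theorem evenMul_sum_sum {α : Type*} (T : Finset α) (σ : α → ℂ) (x : α → E) :
    evenMul (∑ c ∈ T, x c) (∑ c ∈ T, σ c • x c) =
      ∑ c ∈ T, ∑ d ∈ T, ((1 / 2) * (σ d - σ c)) • evenMul (x c) (x d) := by
  have h1 : evenMul (∑ c ∈ T, x c) (∑ c ∈ T, σ c • x c) =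
      ∑ c ∈ T, ∑ d ∈ T, σ d • evenMul (x c) (x d) := by
    rw [← evenMulLin_apply, map_sum, Finset.sum_comm]
    simp only [map_sum, LinearMap.sum_apply, map_smul, evenMulLin_apply, Finset.smul_sum]
  have h2 : evenMul (∑ c ∈ T, x c) (∑ c ∈ T, σ c • x c) =
      ∑ c ∈ T, ∑ d ∈ T, -(σ c • evenMul (x c) (x d)) := by
    rw [h1, Finset.sum_comm]
    refine Finset.sum_congr rfl fun c _ => Finset.sum_congr rfl fun d _ => ?_
    rw [evenMul_comm, smul_neg]
  have h3 : (2 : ℂ) • evenMul (∑ c ∈ T, x c) (∑ c ∈ T, σ c • x c) =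
      (2 : ℂ) • ∑ c ∈ T, ∑ d ∈ T, ((1 / 2) * (σ d - σ c)) • evenMul (x c) (x d) := by
    rw [two_smul]
    nth_rw 1 [h1]
    rw [h2, ← Finset.sum_add_distrib, Finset.smul_sum]
    refine Finset.sum_congr rfl fun c _ => ?_
    rw [← Finset.sum_add_distrib, Finset.smul_sum]
    refine Finset.sum_congr rfl fun d _ => ?_
    module
  exact smul_right_injective _ (two_ne_zero' ℂ) h3

theorem evenMul_sum_sum_lt {n : ℕ} (T : Finset (Fin n)) (σ : Fin n → ℂ) (x : Fin n → E) :
    evenMul (∑ c ∈ T, x c) (∑ c ∈ T, σ c • x c) =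
      ∑ p ∈ T ×ˢ T with p.1 < p.2, (σ p.2 - σ p.1) • evenMul (x p.1) (x p.2) := by
  have h1 : ∑ p ∈ T ×ˢ T with p.2 < p.1, ((1 / 2) * (σ p.2 - σ p.1)) • evenMul (x p.1) (x p.2) =
      ∑ p ∈ T ×ˢ T with p.1 < p.2, ((1 / 2) * (σ p.2 - σ p.1)) • evenMul (x p.1) (x p.2) := by
    refine Finset.sum_nbij' Prod.swap Prod.swap ?_ ?_ (by simp) (by simp) ?_
    · simp +contextual
    · simp +contextual
    · rintro ⟨c, d⟩ _
      simp only [Prod.fst_swap, Prod.snd_swap]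
      rw [evenMul_comm]
      module
  rw [evenMul_sum_sum, ← Finset.sum_product', ← Finset.sum_filter_add_sum_filter_not _
    (fun p : Fin n × Fin n => p.1 < p.2)]
  have h2 : ∑ p ∈ T ×ˢ T with ¬ p.1 < p.2, ((1 / 2) * (σ p.2 - σ p.1)) • evenMul (x p.1) (x p.2) =
      ∑ p ∈ T ×ˢ T with p.2 < p.1, ((1 / 2) * (σ p.2 - σ p.1)) • evenMul (x p.1) (x p.2) := by
    symm
    refine Finset.sum_subset_zero_on_sdiff ?_ ?_ fun _ _ => rfl
    · intro p hp
      simp only [Finset.mem_filter] at hp ⊢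
      exact ⟨hp.1, not_lt.2 hp.2.le⟩
    · intro p hp
      simp only [Finset.mem_sdiff, Finset.mem_filter, not_and, not_lt] at hp
      have : p.1 = p.2 := le_antisymm (hp.2 hp.1.1) hp.1.2
      rw [this]
      simp
  rw [h2, h1, ← Finset.sum_add_distrib]
  refine Finset.sum_congr rfl fun p _ => ?_
  module

end

section shift

variable {n : ℕ} {W : Type*} [AddCommGroup W] [Module ℂ W] {η : BilinForm ℂ W}

/-- Contractions at the same puncture amount to constant terms in the operators. -/
theorem IsPfaffian.apply_prod_gravitonPair (hη : ∀ x y, η x y = η y x) (σ : Fin n → ℂ)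
    (K ε : Fin n → W) (c : Fin n → ℂ) (H : Finset (Fin n))
    {φ φ₀ : ExteriorAlgebra ℂ (RowSpace n) →ₗ[ℂ] ℂ}
    (hφ₀ : IsPfaffian (rowForm (rowMatrix η σ K ε 0)) φ₀)
    (hφ : IsPfaffian (rowForm (rowMatrix η σ K ε fun i => if i ∈ H then c i else 0)) φ)
    {z : Subalgebra.center ℂ (ExteriorAlgebra ℂ (RowSpace n))}
    (hz : ∀ i ∈ H, del (coord (.mom i)) (z : ExteriorAlgebra ℂ (RowSpace n)) = 0 ∧
      del (coord (.pol i)) (z : ExteriorAlgebra ℂ (RowSpace n)) = 0) :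
    φ ((∏ i ∈ H, gravitonPair i) * z : Subalgebra.center ℂ _) =
      φ₀ ((∏ i ∈ H, (gravitonPair i + algebraMap ℂ _ (c i))) * z : Subalgebra.center ℂ _) := by
  induction H using Finset.induction_on generalizing φ z with
  | empty =>
    have : φ = φ₀ := hφ.unique (rowForm_self (rowMatrix_skew hη _ _ _ _)) (by
      simp only [Finset.notMem_empty, if_false]; exact hφ₀)
    rw [this]; simp
  | insert a H ha ih =>
    obtain ⟨ψ, hψ⟩ := exists_isPfaffian (rowForm_self (rowMatrix_skew hη σ K ε
      fun i => if i ∈ H then c i else 0))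
    -- Switching on the diagonal entry of a single graviton `a` adds a form of rank two, supported
    -- on the two rows of `a`.
    have hB : rowForm (rowMatrix η σ K ε fun i => if i ∈ insert a H then c i else 0) =
        rowForm (rowMatrix η σ K ε fun i => if i ∈ H then c i else 0) +
          wedge (c a • coord (.mom a)) (coord (.pol a)) := by
      refine form_ext fun r s => ?_
      rw [LinearMap.add_apply, LinearMap.add_apply, wedge_apply, rowForm_row, rowForm_row]
      simp only [LinearMap.smul_apply, LinearMap.sub_apply, coord_row, smul_eq_mul]
      cases r with
      | mom i => cases s with
        | mom j => simp [rowMatrix]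
        | pol j =>
          by_cases hij : i = j
          · subst hij
            by_cases hi : i = a
            · subst hi; simp [rowMatrix, ha]
            · simp [rowMatrix, hi]
          · have : ¬ (i = a ∧ j = a) := fun h => hij (h.1.trans h.2.symm)
            simp only [rowMatrix, hij, if_false]
            by_cases hi : i = a
            · have hj : j ≠ a := fun h => this ⟨hi, h⟩
              simp [hj]
            · simp [hi]
      | pol i => cases s with
        | mom j =>
          by_cases hij : i = j
          · subst hij
            by_cases hi : i = a
            · subst hi; simp [rowMatrix, ha]
            · simp [rowMatrix, hi]
          · have : ¬ (i = a ∧ j = a) := fun h => hij (h.1.trans h.2.symm)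
            simp only [rowMatrix, hij, if_false]
            by_cases hi : i = a
            · have hj : j ≠ a := fun h => this ⟨hi, h⟩
              simp [hj]
            · simp [hi]
        | pol j => simp [rowMatrix]
    rw [hB] at hφ
    have hself : ∀ x, (rowForm (rowMatrix η σ K ε fun i => if i ∈ H then c i else 0) +
          wedge (c a • coord (.mom a)) (coord (.pol a))) x x = 0 := by
      rw [← hB]; exact rowForm_self (rowMatrix_skew hη _ _ _ _)
    rw [hφ.unique hself (hψ.add_wedge _ _), Finset.prod_insert ha, Finset.prod_insert ha]
    have hz' : ∀ i ∈ H,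
        del (coord (.mom i)) (((gravitonPair a + algebraMap ℂ _ (c a)) * z :
          Subalgebra.center ℂ _) : ExteriorAlgebra ℂ (RowSpace n)) = 0 ∧
        del (coord (.pol i)) (((gravitonPair a + algebraMap ℂ _ (c a)) * z :
          Subalgebra.center ℂ _) : ExteriorAlgebra ℂ (RowSpace n)) = 0 := by
      intro i hi
      have hia : a ≠ i := by rintro rfl; exact ha hi
      obtain ⟨h1, h2⟩ := hz i (by simp [hi])
      constructor
      · rw [add_mul, Subalgebra.coe_add, map_add, ← Algebra.smul_def, Subalgebra.coe_smul, map_smul,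
          MulMemClass.coe_mul, gravitonPair, del_evenMul_mul, h1, coord_row, coord_row]
        simp [hia]
      · rw [add_mul, Subalgebra.coe_add, map_add, ← Algebra.smul_def, Subalgebra.coe_smul, map_smul,
          MulMemClass.coe_mul, gravitonPair, del_evenMul_mul, h2, coord_row, coord_row]
        simp [hia]
    have h1 := ih hψ hz'
    rw [show (gravitonPair a + algebraMap ℂ _ (c a)) * (∏ i ∈ H, (gravitonPair i +
      algebraMap ℂ _ (c i))) * z = (∏ i ∈ H, (gravitonPair i + algebraMap ℂ _ (c i))) *
      ((gravitonPair a + algebraMap ℂ _ (c a)) * z) by ring, ← h1]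
    have h2 : ∀ d, (∀ i ∈ H, d (row (.mom i)) = 0 ∧ d (row (.pol i)) = 0) →
        del d (z : ExteriorAlgebra ℂ (RowSpace n)) = 0 →
        del d (((∏ i ∈ H, gravitonPair i) * z : Subalgebra.center ℂ _) :
          ExteriorAlgebra ℂ (RowSpace n)) = 0 := by
      intro d hd h
      rw [MulMemClass.coe_mul]
      unfold gravitonPair
      rw [del_prod_evenMul_mul _ _ _ _ (fun i hi => (hd i hi).1) (fun i hi => (hd i hi).2), h,
        mul_zero]
    have hne : ∀ i ∈ H, i ≠ a := by rintro i hi rfl; exact ha hi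
    have h3 := h2 (coord (.mom a)) (fun i hi => by simp [coord_row, hne i hi])
      (hz a (by simp)).1
    have h4 := h2 (coord (.pol a)) (fun i hi => by simp [coord_row, hne i hi])
      (hz a (by simp)).2
    -- These rows occur only in the pair of `a`, so the double contraction removes this pair and
    -- leaves the factor `c a`. Together with the uncorrected term it gives the pair plus `c a`.
    have h5 : del (coord (.pol a)) (del (c a • coord (.mom a))
        (((gravitonPair a * ∏ i ∈ H, gravitonPair i) * z : Subalgebra.center ℂ _) :
          ExteriorAlgebra ℂ (RowSpace n))) =
        (((∏ i ∈ H, gravitonPair i) * (algebraMap ℂ _ (c a) * z) : Subalgebra.center ℂ _) :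
          ExteriorAlgebra ℂ (RowSpace n)) := by
      rw [mul_left_comm, ← Algebra.smul_def, mul_assoc, MulMemClass.coe_mul, map_smul,
        LinearMap.smul_apply, map_smul]
      nth_rw 1 [gravitonPair]
      rw [del_evenMul_mul, h3, coord_row, coord_row]
      simp only [if_true, one_smul, mul_zero, add_zero, reduceCtorEq, if_false, zero_smul, sub_zero]
      rw [del_vec_mul, h4, coord_row]
      simp
    rw [LinearMap.add_apply, LinearMap.comp_apply, LinearMap.comp_apply, h5, ← map_add,
      ← Subalgebra.coe_add]
    congr 2
    ring

end shift

theorem coord_mom_traceVec {n : ℕ} (i : Fin n) (T : Finset (Fin n)) :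
    coord (.mom i) (traceVec T) = if i ∈ T then 1 else 0 := by
  simp [traceVec, map_sum, coord_row]

theorem coord_mom_traceVec' {n : ℕ} (σ : Fin n → ℂ) (i : Fin n) (T : Finset (Fin n)) :
    coord (.mom i) (traceVec' σ T) = if i ∈ T then σ i else 0 := by
  simp [traceVec', map_sum, coord_row]

theorem coord_pol_traceVec {n : ℕ} (i : Fin n) (T : Finset (Fin n)) :
    coord (.pol i) (traceVec T) = 0 := by
  simp [traceVec, map_sum, coord_row]

theorem coord_pol_traceVec' {n : ℕ} (σ : Fin n → ℂ) (i : Fin n) (T : Finset (Fin n)) :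
    coord (.pol i) (traceVec' σ T) = 0 := by
  simp [traceVec', map_sum, coord_row]

/-- For a single label the two rows are proportional, and for the empty set they vanish. Such sets
occur as fibres of retractions but not as parts of allowed partitions. -/
theorem tracePair_eq_zero {n : ℕ} (σ : Fin n → ℂ) {T : Finset (Fin n)} (hT : T.card < 2) :
    tracePair σ T = 0 := by
  rw [tracePair]
  rcases Nat.le_one_iff_eq_zero_or_eq_one.1 (Nat.lt_succ_iff.1 hT) with h | h
  · rw [Finset.card_eq_zero.1 h]
    exact Subtype.ext (by simp [evenMul_coe, traceVec])
  · obtain ⟨u, rfl⟩ := Finset.card_eq_one.1 h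
    rw [traceVec, traceVec', Finset.sum_singleton, Finset.sum_singleton, evenMul_comm,
      evenMul_smul_left, evenMul_self]
    simp

/-- The product of all rows, in pairs. -/
def rowProduct {n : ℕ} (σ : Fin n → ℂ) (h : Finset (Fin n)) (𝒯 : Finset (Finset (Fin n))) :
    Subalgebra.center ℂ (ExteriorAlgebra ℂ (RowSpace n)) :=
  (∏ i ∈ h, gravitonPair i) * ∏ T ∈ 𝒯, tracePair σ T

end CombSusy
end

/-! ### Retractions and partitions with one untilded gluon in each part -/

noncomputable section
namespace CombSusy

section partitions

variable {α : Type*} [Fintype α] [DecidableEq α] {S U : Finset α}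

theorem fibre_retraction (hSU : Disjoint S U) {f : α → α} (hf : f ∈ retractions S U) {u : α}
    (hu : u ∈ U) : fibre f u ⊆ S ∪ U ∧ fibre f u ∩ U = {u} := by
  rw [mem_retractions] at hf
  refine ⟨fun j hj => ?_, ?_⟩
  · rw [mem_fibre] at hj
    by_cases h : j ∈ S
    · exact Finset.mem_union_left _ h
    · rw [hf.2 j h] at hj; exact Finset.mem_union_right _ (hj ▸ hu)
  · ext j
    rw [Finset.mem_inter, mem_fibre, Finset.mem_singleton]
    constructor
    · rintro ⟨h, hj⟩
      exact (hf.2 j (Finset.disjoint_right.1 hSU hj)).symm.trans h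
    · rintro rfl
      exact ⟨hf.2 j (Finset.disjoint_right.1 hSU hu), hu⟩

theorem fibre_injOn (hSU : Disjoint S U) {f : α → α} (hf : f ∈ retractions S U) :
    Set.InjOn (fibre f) U := by
  intro u hu v hv h
  have h1 := (fibre_retraction hSU hf hu).2
  rw [h, (fibre_retraction hSU hf hv).2] at h1
  exact (Finset.singleton_injective h1).symm

/-- The partition into the fibres of a retraction. -/
def fibrePartition (hSU : Disjoint S U) {f : α → α} (hf : f ∈ retractions S U) :
    Finpartition (S ∪ U) where
  parts := U.image (fibre f)
  supIndep := by
    rw [Finset.supIndep_iff_pairwiseDisjoint]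
    rintro _ hT _ hT' hne
    obtain ⟨u, -, rfl⟩ := Finset.mem_image.1 hT
    obtain ⟨v, -, rfl⟩ := Finset.mem_image.1 hT'
    refine Finset.disjoint_left.2 fun j hj hj' => hne ?_
    rw [id, mem_fibre] at hj hj'
    rw [← hj, ← hj']
  sup_parts := by
    ext j
    rw [Finset.mem_sup]
    constructor
    · rintro ⟨T, hT, hj⟩
      obtain ⟨u, hu, rfl⟩ := Finset.mem_image.1 hT
      exact (fibre_retraction hSU hf hu).1 hj
    · intro hj
      refine ⟨fibre f (f j), Finset.mem_image_of_mem _ ?_, mem_fibre.2 rfl⟩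
      rw [mem_retractions] at hf
      by_cases h : j ∈ S
      · exact hf.1 j h
      · rw [hf.2 j h]; exact (Finset.mem_union.1 hj).resolve_left h
  bot_notMem := by
    intro h
    obtain ⟨u, hu, h⟩ := Finset.mem_image.1 h
    have := (fibre_retraction hSU hf hu).2
    rw [h] at this
    simp at this

/-- The retraction of a partition with one element of `U` in every part. -/
def partitionRetraction (U : Finset α) {A : Finset α} (p : Finpartition A) (j : α) : α :=
  if h : (p.part j ∩ U).Nonempty then h.choose else j

omit [Fintype α] in
theorem partitionRetraction_eq {A : Finset α} {p : Finpartition A} {T : Finset α} (hT : T ∈ p.parts)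
    {u j : α} (hu : T ∩ U = {u}) (hj : j ∈ T) : partitionRetraction U p j = u := by
  have h1 : p.part j = T := p.part_eq_of_mem hT hj
  have h2 : (p.part j ∩ U).Nonempty := by rw [h1, hu]; simp
  rw [partitionRetraction, dif_pos h2]
  have h3 : ∀ w ∈ p.part j ∩ U, w = u := by
    intro w hw
    rw [h1, hu] at hw
    exact Finset.mem_singleton.1 hw
  exact h3 _ h2.choose_spec

omit [Fintype α] in
theorem partitionRetraction_of_notMem {A : Finset α} {p : Finpartition A} {j : α} (hj : j ∉ A) :
    partitionRetraction U p j = j := by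
  rw [partitionRetraction, dif_neg]
  rw [p.part_eq_empty.2 hj]
  simp

theorem partitionRetraction_mem {p : Finpartition (S ∪ U)}
    (hp : ∀ T ∈ p.parts, (T ∩ U).card = 1) : partitionRetraction U p ∈ retractions S U := by
  rw [mem_retractions]
  have key : ∀ j ∈ S ∪ U, ∃ u, p.part j ∩ U = {u} ∧ partitionRetraction U p j = u := by
    intro j hj
    have hT := p.part_mem.2 hj
    obtain ⟨u, hu⟩ := Finset.card_eq_one.1 (hp _ hT)
    exact ⟨u, hu, partitionRetraction_eq hT hu (p.mem_part hj)⟩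
  constructor
  · intro j hj
    obtain ⟨u, hu, h⟩ := key j (Finset.mem_union_left _ hj)
    rw [h]
    have : u ∈ p.part j ∩ U := by rw [hu]; simp
    exact (Finset.mem_inter.1 this).2
  · intro j hj
    by_cases hjU : j ∈ U
    · obtain ⟨u, hu, h⟩ := key j (Finset.mem_union_right _ hjU)
      have : j ∈ p.part j ∩ U := Finset.mem_inter.2 ⟨p.mem_part (Finset.mem_union_right _ hjU), hjU⟩
      rw [hu, Finset.mem_singleton] at this
      rw [h, this]
    · exact partitionRetraction_of_notMem (by simp [hj, hjU])

theorem image_fibre_partitionRetraction (hSU : Disjoint S U) {p : Finpartition (S ∪ U)}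
    (hp : ∀ T ∈ p.parts, (T ∩ U).card = 1) :
    U.image (fibre (partitionRetraction U p)) = p.parts := by
  have hf := partitionRetraction_mem hp
  have key : ∀ T ∈ p.parts, ∀ u, T ∩ U = {u} → fibre (partitionRetraction U p) u = T := by
    intro T hT u hu
    have huT : u ∈ T ∩ U := by rw [hu]; simp
    rw [Finset.mem_inter] at huT
    ext j
    rw [mem_fibre]
    constructor
    · intro hj
      have hjA : j ∈ S ∪ U := (fibre_retraction hSU hf huT.2).1 (mem_fibre.2 hj)
      have hT' := p.part_mem.2 hjA
      obtain ⟨v, hv⟩ := Finset.card_eq_one.1 (hp _ hT')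
      rw [partitionRetraction_eq hT' hv (p.mem_part hjA)] at hj
      subst hj
      have hvT : v ∈ p.part j ∩ U := by rw [hv]; simp
      rw [Finset.mem_inter] at hvT
      rw [← p.eq_of_mem_parts hT' hT hvT.1 huT.1]
      exact p.mem_part hjA
    · exact fun hj => partitionRetraction_eq hT hu hj
  ext T
  rw [Finset.mem_image]
  constructor
  · rintro ⟨u, hu, rfl⟩
    have huA : u ∈ S ∪ U := Finset.mem_union_right _ hu
    have hT := p.part_mem.2 huA
    obtain ⟨v, hv⟩ := Finset.card_eq_one.1 (hp _ hT)
    have : u ∈ p.part u ∩ U := Finset.mem_inter.2 ⟨p.mem_part huA, hu⟩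
    rw [hv, Finset.mem_singleton] at this
    rw [key _ hT u (by rw [hv, this])]
    exact hT
  · intro hT
    obtain ⟨v, hv⟩ := Finset.card_eq_one.1 (hp _ hT)
    have : v ∈ T ∩ U := by rw [hv]; simp
    exact ⟨v, (Finset.mem_inter.1 this).2, key _ hT v hv⟩

/-- A sum over retractions as a sum over partitions with one element of `U` in every part, for
summands that vanish if a part has one element. -/
theorem sum_retractions {E : Type*} [AddCommMonoid E] (hSU : Disjoint S U)
    (Φ : Finset (Finset α) → E) (hΦ : ∀ 𝒯, (∃ T ∈ 𝒯, T.card < 2) → Φ 𝒯 = 0) :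
    ∑ f ∈ retractions S U, Φ (U.image (fibre f)) =
      ∑ p : Finpartition (S ∪ U) with p.parts.card = U.card ∧ ∀ T ∈ p.parts,
        2 ≤ T.card ∧ (T ∩ U).card = 1, Φ p.parts := by
  symm
  refine Finset.sum_of_injOn (partitionRetraction U) ?_ ?_ ?_ ?_
  · intro p hp q hq h
    simp only [Finset.coe_filter, Finset.mem_univ, true_and, Set.mem_ofPred_eq] at hp hq
    ext1
    rw [← image_fibre_partitionRetraction hSU fun T hT => (hp.2 T hT).2,
      ← image_fibre_partitionRetraction hSU fun T hT => (hq.2 T hT).2, h]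
  · intro p hp
    simp only [Finset.coe_filter, Finset.mem_univ, true_and, Set.mem_ofPred_eq] at hp
    exact partitionRetraction_mem fun T hT => (hp.2 T hT).2
  -- The fibres of any retraction form a partition with one element of `U` in each part. It fails to
  -- be allowed only because of a singleton, and then the summand vanishes.
  · intro f hf hf'
    by_contra hne
    apply hf'
    have hp : ∀ T ∈ (fibrePartition hSU hf).parts, (T ∩ U).card = 1 := by
      intro T hT
      obtain ⟨u, hu, rfl⟩ := Finset.mem_image.1 hT
      rw [(fibre_retraction hSU hf hu).2, Finset.card_singleton]
    refine ⟨fibrePartition hSU hf, ?_, ?_⟩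
    · simp only [Finset.coe_filter, Finset.mem_univ, true_and, Set.mem_ofPred_eq]
      refine ⟨Finset.card_image_of_injOn (fibre_injOn hSU hf), fun T hT => ⟨?_, hp T hT⟩⟩
      by_contra h
      exact hne (hΦ _ ⟨T, hT, not_le.1 h⟩)
    · funext j
      by_cases hj : j ∈ S ∪ U
      · have hu : f j ∈ U := by
          rw [mem_retractions] at hf
          by_cases h : j ∈ S
          · exact hf.1 j h
          · rw [hf.2 j h]; exact (Finset.mem_union.1 hj).resolve_left h
        exact partitionRetraction_eq (p := fibrePartition hSU hf) (T := fibre f (f j))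
          (Finset.mem_image_of_mem _ hu)
          (fibre_retraction hSU hf hu).2 (mem_fibre.2 rfl)
      · rw [partitionRetraction_of_notMem hj]
        rw [mem_retractions] at hf
        exact (hf.2 j fun h => hj (Finset.mem_union_left _ h)).symm
  · intro p hp
    simp only [Finset.mem_filter, Finset.mem_univ, true_and] at hp
    rw [image_fibre_partitionRetraction hSU fun T hT => (hp.2 T hT).2]

end partitions

end CombSusy
end

/-! ### The correlator of integrated operators as a sum of Pfaffians -/

noncomputable section
namespace CombSusy
namespace MatterData
open WickFunctional

variable {n : ℕ} {V 𝔤 ι : Type*} [AddCommGroup V] [Module ℂ V]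
    [LieRing 𝔤] [LieAlgebra ℂ 𝔤] [Fintype ι] [DecidableEq ι] (M : MatterData n V 𝔤 ι)

theorem η_comm (x y : V) : M.η x y = M.η y x := by simpa using M.η_symm.eq x y

/-- The fields with coefficients `K i` and `ε i` that belong to the rows. -/
def rowField (K ε : Fin n → V) : RowSpace n →ₗ[ℂ] M.F.Alg :=
  Finsupp.linearCombination ℂ fun r => match r with
    | .mom i => M.psi i (K i)
    | .pol i => M.psi i (ε i)

theorem rowField_mom (K ε : Fin n → V) (i : Fin n) :
    M.rowField K ε (row (.mom i)) = M.psi i (K i) := by simp [rowField, row]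

theorem rowField_pol (K ε : Fin n → V) (i : Fin n) :
    M.rowField K ε (row (.pol i)) = M.psi i (ε i) := by simp [rowField, row]

theorem rowField_mem (K ε : Fin n → V) (u : RowSpace n) : M.rowField K ε u ∈ M.F.oddPart := by
  have : LinearMap.range (M.rowField K ε) ≤ M.F.oddPart := by
    rw [rowField, Finsupp.range_linearCombination, Submodule.span_le]
    rintro _ ⟨r, rfl⟩
    cases r <;> exact M.psi_mem _ _
  exact this ⟨u, rfl⟩

/-- The fermions as an image of the exterior algebra of the rows. -/
def rowHom (K ε : Fin n → V) : ExteriorAlgebra ℂ (RowSpace n) →ₐ[ℂ] M.F.Alg :=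
  ExteriorAlgebra.lift ℂ ⟨M.rowField K ε, fun u => odd_mul_self (M.rowField_mem K ε u)⟩

theorem rowHom_vec (K ε : Fin n → V) (u : RowSpace n) :
    M.rowHom K ε (vec u) = M.rowField K ε u :=
  ExteriorAlgebra.lift_ι_apply ℂ _ (fun u => odd_mul_self (M.rowField_mem K ε u)) u

/-- The letter of a row. -/
def rowLetter (K ε : Fin n → V) : Row n → Field V 𝔤 × Fin n
  | .mom i => (.psi (K i), i)
  | .pol i => (.psi (ε i), i)

theorem rowField_row (K ε : Fin n → V) (r : Row n) :
    M.rowField K ε (row r) = M.F.gen (rowLetter K ε r) := by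
  cases r with
  | mom i => rw [rowField_mom]; rfl
  | pol i => rw [rowField_pol]; rfl

theorem rowLetter_par (K ε : Fin n → V) (r : Row n) : M.F.par (rowLetter K ε r) = true := by
  cases r <;> rfl

theorem contr_rowLetter (K ε : Fin n → V) (r s : Row n) :
    M.F.c (rowLetter K ε r) (rowLetter K ε s) = rowMatrix M.η M.σ K ε 0 r s := by
  cases r <;> cases s <;> simp [F_c, contraction, rowLetter, rowMatrix, opeCoeff]

theorem contr_rowHom (K ε : Fin n → V) (r : Row n) (w : ExteriorAlgebra ℂ (RowSpace n)) :
    M.F.contr (rowLetter K ε r) (M.rowHom K ε w) =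
      M.rowHom K ε (del (rowForm (rowMatrix M.η M.σ K ε 0) (row r)) w) := by
  have h0 : ∀ u, M.F.contr (rowLetter K ε r) (M.rowField K ε u) =
      algebraMap ℂ _ (rowForm (rowMatrix M.η M.σ K ε 0) (row r) u) := by
    have : M.F.contr (rowLetter K ε r) ∘ₗ M.rowField K ε = (Algebra.linearMap ℂ M.F.Alg) ∘ₗ
        rowForm (rowMatrix M.η M.σ K ε 0) (row r) := by
      refine Finsupp.lhom_ext' fun s => LinearMap.ext_ring ?_
      change M.F.contr (rowLetter K ε r) (M.rowField K ε (row s)) =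
        algebraMap ℂ _ (rowForm (rowMatrix M.η M.σ K ε 0) (row r) (row s))
      rw [rowField_row, contr_gen, rowForm_row, contr_rowLetter]
    exact fun u => LinearMap.congr_fun this u
  induction w using ext_induction with
  | h0 a => rw [AlgHom.commutes, contr_algebraMap, Algebra.algebraMap_eq_smul_one, map_smul, del_one]
            simp
  | ha x y hx hy => simp only [map_add, hx, hy]
  | hm u w h =>
    rw [map_mul, rowHom_vec, contr_mul _ (M.rowLetter_par K ε r), h, h0, del_vec_mul, map_sub,
      map_smul, map_mul, rowHom_vec, (M.rowField_mem K ε u).1, Algebra.smul_def, neg_mul,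
      sub_eq_add_neg]

/-- The expectation values of products of the fermions `Ψ` are Pfaffians. -/
theorem isPfaffian_ev (K ε : Fin n → V) :
    IsPfaffian (rowForm (rowMatrix M.η M.σ K ε 0)) (M.F.ev ∘ₗ (M.rowHom K ε).toLinearMap) := by
  refine ⟨by simp [ev_one], fun u w => ?_⟩
  have : (M.F.ev ∘ₗ LinearMap.mulRight ℂ (M.rowHom K ε w)) ∘ₗ M.rowField K ε =
      (M.F.ev ∘ₗ (M.rowHom K ε).toLinearMap) ∘ₗ (del.flip w) ∘ₗ
        rowForm (rowMatrix M.η M.σ K ε 0) := by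
    refine Finsupp.lhom_ext' fun s => LinearMap.ext_ring ?_
    change M.F.ev (M.rowField K ε (row s) * M.rowHom K ε w) = M.F.ev (M.rowHom K ε
      (del (rowForm (rowMatrix M.η M.σ K ε 0) (row s)) w))
    rw [rowField_row, ev_gen_mul, contr_rowHom]
  have h := LinearMap.congr_fun this u
  simp only [LinearMap.comp_apply, LinearMap.mulRight_apply, AlgHom.toLinearMap_apply,
    LinearMap.flip_apply] at h ⊢
  rw [map_mul, rowHom_vec, h]

/-- The fermion `v · Ψ` as a colourless odd element. -/
def psiOdd (i : Fin n) (v : V) : M.colourlessOdd := ⟨M.psi i v, M.psi_mem_colourlessOdd i v⟩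

theorem rowHom_gravitonPair (K ε : Fin n → V) (i : Fin n) :
    M.rowHom K ε (gravitonPair i : ExteriorAlgebra ℂ (RowSpace n)) =
      M.oddMul (M.psiOdd i (K i)) (M.psiOdd i (ε i)) := by
  rw [gravitonPair, evenMul_coe, map_mul, rowHom_vec, rowHom_vec, rowField_mom, rowField_pol]
  rfl

/-- For `l = 1` the weight `σ_d - σ_c` is all that depends on the two ends besides the fermions, and
the antisymmetrized double sum factorizes into the two rows of the trace. -/
theorem rowHom_tracePair (K ε : Fin n → V) (T : Finset (Fin n)) :
    M.rowHom K ε (tracePair M.σ T : ExteriorAlgebra ℂ (RowSpace n)) =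
      M.ends (fun i => M.psiOdd i (K i)) 1 T := by
  rw [tracePair, traceVec, traceVec', evenMul_sum_sum, ends]
  simp only [AddSubmonoidClass.coe_finsetSum, map_sum, Subalgebra.coe_smul, map_smul, evenMul_coe,
    map_mul, rowHom_vec, rowField_mom, Pi.one_apply, Finset.prod_const_one, mul_one]
  rfl

theorem rowHom_prod (K ε : Fin n → V) {α : Type*} (s : Finset α)
    {x : α → Subalgebra.center ℂ (ExteriorAlgebra ℂ (RowSpace n))} {g : α → M.F.evenCenter}
    (h : ∀ i ∈ s, M.rowHom K ε (x i : ExteriorAlgebra ℂ (RowSpace n)) = g i) :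
    M.rowHom K ε ((∏ i ∈ s, x i : Subalgebra.center ℂ _) : ExteriorAlgebra ℂ (RowSpace n)) =
      (∏ i ∈ s, g i : M.F.evenCenter) := by
  classical
  induction s using Finset.induction_on with
  | empty => simp
  | insert a s ha ih =>
    rw [Finset.prod_insert ha, Finset.prod_insert ha, MulMemClass.coe_mul, MulMemClass.coe_mul,
      map_mul, h a (by simp), ih fun i hi => h i (by simp [hi])]

/-- The expectation value of the product of integrated vertex operators with arbitrary momentum
vectors. -/
theorem evEven_amplitude (hσ : Function.Injective M.σ) (b : Fin n → Bool) (h S U : Finset (Fin n))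
    (hS : ∀ j ∈ S, b j = true) (hU : ∀ j ∈ U, b j = false) (hSU : Disjoint S U)
    (hh : Disjoint h (S ∪ U)) (K ε : Fin n → V) (c : Fin n → ℂ) (hc : ∀ i ∉ h, c i = 0)
    (t : Fin n → 𝔤) {φ : ExteriorAlgebra ℂ (RowSpace n) →ₗ[ℂ] ℂ}
    (hφ : IsPfaffian (rowForm (rowMatrix M.η M.σ K ε c)) φ) :
    M.evEven ((∏ i ∈ h, (M.oddMul (M.psiOdd i (K i)) (M.psiOdd i (ε i)) + algebraMap ℂ _ (c i))) *
      ∏ j ∈ S ∪ U, M.vertex (b j) (M.psiOdd j (K j)) 1 (t j) j) =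
      (-1) ^ ((S ∪ U).card + U.card) *
      ∑ p : Finpartition (S ∪ U) with p.parts.card = U.card ∧ ∀ T ∈ p.parts,
        2 ≤ T.card ∧ (T ∩ U).card = 1, (∏ T ∈ p.parts, M.col t T) *
          φ (rowProduct M.σ h p.parts) := by
  have hY : ∏ i ∈ h, (M.oddMul (M.psiOdd i (K i)) (M.psiOdd i (ε i)) + algebraMap ℂ _ (c i)) ∈
      M.colourlessEven := Subalgebra.prod_mem _ fun i _ =>
    Subalgebra.add_mem _ (M.oddMul_mem _ _) (Subalgebra.algebraMap_mem _ _)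
  have hc' : (fun i => if i ∈ h then c i else 0) = c := by
    funext i
    by_cases hi : i ∈ h
    · rw [if_pos hi]
    · rw [if_neg hi, hc i hi]
  have h1 := M.evEven_prod_vertex hσ b S U hS hU (fun j => M.psiOdd j (K j)) 1 t hY
  simp only [Pi.one_apply] at h1
  rw [h1, traceSum, Finset.mul_sum, map_sum]
  have h2 : ∀ f ∈ retractions S U, M.evEven ((∏ i ∈ h, (M.oddMul (M.psiOdd i (K i))
      (M.psiOdd i (ε i)) + algebraMap ℂ _ (c i))) *
      ∏ u ∈ U, M.trace (fun j => M.psiOdd j (K j)) 1 t (fibre f u)) =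
      (fun 𝒯 : Finset (Finset (Fin n)) => (∏ T ∈ 𝒯, ((-1) ^ (T.card + 1) * M.col t T)) *
        φ (rowProduct M.σ h 𝒯)) (U.image (fibre f)) := by
    intro f hf
    have hfib : ∀ i ∈ h, ∀ T ∈ U.image (fibre f), i ∉ T := by
      intro i hi T hT hiT
      obtain ⟨u, hu, rfl⟩ := Finset.mem_image.1 hT
      exact Finset.disjoint_left.1 hh hi ((fibre_retraction hSU hf hu).1 hiT)
    -- The constants `c i` are absorbed into the diagonal of the matrix. The traces do not involve
    -- the rows of gravitons, as the required contractions show.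
    have h3 := IsPfaffian.apply_prod_gravitonPair M.η_comm M.σ K ε c h (M.isPfaffian_ev K ε)
      (φ := φ) (hc'.symm ▸ hφ) (z := ∏ T ∈ U.image (fibre f), tracePair M.σ T) (by
        intro i hi
        have key : ∀ d : Module.Dual ℂ (RowSpace n), (∀ T ∈ U.image (fibre f),
            d (traceVec T) = 0 ∧ d (traceVec' M.σ T) = 0) → del d ((∏ T ∈ U.image (fibre f),
            tracePair M.σ T : Subalgebra.center ℂ _) : ExteriorAlgebra ℂ (RowSpace n)) = 0 := by
          intro d hd
          have := del_prod_evenMul_mul d (U.image (fibre f)) traceVec (traceVec' M.σ)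
            (fun T hT => (hd T hT).1) (fun T hT => (hd T hT).2) 1
          rw [mul_one, del_one, mul_zero] at this
          exact this
        refine ⟨key _ fun T hT => ?_, key _ fun T hT => ?_⟩
        · rw [coord_mom_traceVec, coord_mom_traceVec', if_neg (hfib i hi T hT),
            if_neg (hfib i hi T hT)]
          exact ⟨rfl, rfl⟩
        · rw [coord_pol_traceVec, coord_pol_traceVec']
          exact ⟨rfl, rfl⟩)
    have h4 : ∏ u ∈ U, M.trace (fun j => M.psiOdd j (K j)) 1 t (fibre f u) =
        ∏ T ∈ U.image (fibre f), M.trace (fun j => M.psiOdd j (K j)) 1 t T :=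
      (Finset.prod_image (fibre_injOn hSU hf)).symm
    rw [h4]
    unfold trace
    rw [Finset.prod_smul, mul_smul_comm, map_smul, smul_eq_mul]
    congr 1
    rw [rowProduct, h3, LinearMap.comp_apply, AlgHom.toLinearMap_apply, MulMemClass.coe_mul,
      map_mul (M.rowHom K ε), M.rowHom_prod K ε h (g := fun i => M.oddMul (M.psiOdd i (K i)) (M.psiOdd i (ε i)) +
        algebraMap ℂ _ (c i)), M.rowHom_prod K ε (U.image (fibre f))
        fun T _ => M.rowHom_tracePair K ε T]
    · rfl
    · intro i _
      rw [Subalgebra.coe_add, Subalgebra.coe_add, map_add, rowHom_gravitonPair]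
      congr 1
      exact AlgHom.commutes _ _
  refine (Finset.sum_congr rfl h2).trans ((sum_retractions hSU
    (fun 𝒯 : Finset (Finset (Fin n)) => (∏ T ∈ 𝒯, ((-1) ^ (T.card + 1) * M.col t T)) *
      φ (rowProduct M.σ h 𝒯)) ?_).trans ?_)
  swap
  · rw [Finset.mul_sum]
    refine Finset.sum_congr rfl fun p hp => ?_
    simp only [Finset.mem_filter, Finset.mem_univ, true_and] at hp
    rw [Finset.prod_mul_distrib, Finset.prod_pow_eq_pow_sum, Finset.sum_add_distrib,
      p.sum_card_parts, Finset.sum_const, smul_eq_mul, mul_one, hp.1, mul_assoc]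
  · rintro 𝒯 ⟨T, hT, hT2⟩
    rw [rowProduct, Finset.prod_eq_zero hT (tracePair_eq_zero _ hT2)]
    simp

end MatterData
end CombSusy
end

/-! ### Null vectors and independence of the removed rows -/

noncomputable section
namespace CombSusy
namespace Insertions

variable {n : ℕ} {V 𝔤 : Type*} [AddCommGroup V] [Module ℂ V]
  (D : Insertions n V 𝔤) {η : BilinForm ℂ V}

/-- The polarizations, set to zero for gluons. -/
def eps (i : Fin n) : V := if D.species i = .graviton then D.ε i else 0

variable (η) in
/-- The matrix of all contractions, without the polarization rows of gluons. -/
def kinMatrix : Row n → Row n → ℂ :=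
  rowMatrix η D.σ D.k D.eps fun i => η (D.eps i) (D.P i)

omit [AddCommGroup V] [Module ℂ V] in
theorem mem_gravitons {i : Fin n} : i ∈ D.gravitons ↔ D.species i = .graviton := by
  simp [gravitons]

omit [AddCommGroup V] [Module ℂ V] in
theorem mem_gluons {i : Fin n} : i ∈ D.gluons ↔ D.species i ≠ .graviton := by
  simp [gluons]

omit [AddCommGroup V] [Module ℂ V] in
theorem mem_untilded {i : Fin n} : i ∈ D.untilded ↔ D.species i = .gluon := by
  simp [untilded]

omit [AddCommGroup V] [Module ℂ V] in
theorem disjoint_gravitons_gluons : Disjoint D.gravitons D.gluons :=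
  Finset.disjoint_left.2 fun _ h h' => D.mem_gluons.1 h' (D.mem_gravitons.1 h)

omit [AddCommGroup V] [Module ℂ V] in
theorem gravitons_union_gluons : D.gravitons ∪ D.gluons = Finset.univ := by
  ext i
  simp only [Finset.mem_union, mem_gravitons, mem_gluons, Finset.mem_univ, iff_true]
  exact em _

theorem sum_momenta (x : V) (j : Fin n) :
    ∑ i ∈ Finset.univ.erase j, η (D.k i) x / (D.σ i - D.σ j) = -η (D.P j) x := by
  rw [P, map_sum, LinearMap.sum_apply, ← Finset.sum_neg_distrib]
  refine Finset.sum_congr rfl fun i _ => ?_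
  rw [map_smul, LinearMap.smul_apply, smul_eq_mul, ← neg_sub (D.σ j), div_neg, div_eq_inv_mul]

theorem sum_weighted_momenta (hD : D.OnShell η) (x : V) (j : Fin n) :
    ∑ i ∈ Finset.univ.erase j, D.σ i * (η (D.k i) x / (D.σ i - D.σ j)) =
      -η (D.k j) x - D.σ j * η (D.P j) x := by
  have h1 : ∀ i ∈ Finset.univ.erase j, D.σ i * (η (D.k i) x / (D.σ i - D.σ j)) =
      η (D.k i) x + D.σ j * (η (D.k i) x / (D.σ i - D.σ j)) := by
    intro i hi
    have : D.σ i - D.σ j ≠ 0 := sub_ne_zero.2 fun h => Finset.ne_of_mem_erase hi (hD.distinct h)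
    field_simp
    ring
  have h2 : ∑ i ∈ Finset.univ.erase j, η (D.k i) x = -η (D.k j) x := by
    rw [eq_neg_iff_add_eq_zero, Finset.sum_erase_add _ _ (Finset.mem_univ j),
      ← LinearMap.sum_apply, ← map_sum, hD.conservation]
    simp
  rw [Finset.sum_congr rfl h1, Finset.sum_add_distrib, h2, ← Finset.mul_sum, sum_momenta]
  ring

theorem eps_momentum (hD : D.OnShell η) (i : Fin n) : η (D.eps i) (D.k i) = 0 := by
  rw [eps]
  split_ifs with h
  · exact hD.transverse i (D.mem_gravitons.2 h)
  · simp

/-- Against a momentum row this is the scattering equation. Against a polarization row, the diagonal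
entry `ε·P` cancels the sum of the others. -/
theorem sum_kinMatrix (hη : ∀ x y, η x y = η y x) (hD : D.OnShell η) (s : Row n) :
    ∑ i, D.kinMatrix η (.mom i) s = 0 := by
  cases s with
  | mom j =>
    rw [← Finset.add_sum_erase _ _ (Finset.mem_univ j), Finset.sum_congr rfl (g := fun i =>
      η (D.k i) (D.k j) / (D.σ i - D.σ j)) fun i hi => by
        simp [kinMatrix, rowMatrix, Finset.ne_of_mem_erase hi], sum_momenta, hη, hD.scattering]
    simp [kinMatrix, rowMatrix]
  | pol j =>
    rw [← Finset.add_sum_erase _ _ (Finset.mem_univ j), Finset.sum_congr rfl (g := fun i =>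
      η (D.k i) (D.eps j) / (D.σ i - D.σ j)) fun i hi => by
        simp [kinMatrix, rowMatrix, Finset.ne_of_mem_erase hi], sum_momenta, hη]
    simp [kinMatrix, rowMatrix]

/-- Write `σ_i = (σ_i - σ_j) + σ_j`. The first part gives a sum of momenta, which momentum
conservation reduces to the product with `k_j`; this vanishes by nullity or transversality. The
second part is treated as without weights. -/
theorem sum_weighted_kinMatrix (hη : ∀ x y, η x y = η y x) (hD : D.OnShell η) (s : Row n) :
    ∑ i, D.σ i * D.kinMatrix η (.mom i) s = 0 := by
  cases s with
  | mom j =>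
    rw [← Finset.add_sum_erase _ _ (Finset.mem_univ j), Finset.sum_congr rfl (g := fun i =>
      D.σ i * (η (D.k i) (D.k j) / (D.σ i - D.σ j))) fun i hi => by
        simp [kinMatrix, rowMatrix, Finset.ne_of_mem_erase hi], sum_weighted_momenta D hD, hD.null,
        hη (D.P j), hD.scattering]
    simp [kinMatrix, rowMatrix]
  | pol j =>
    rw [← Finset.add_sum_erase _ _ (Finset.mem_univ j), Finset.sum_congr rfl (g := fun i =>
      D.σ i * (η (D.k i) (D.eps j) / (D.σ i - D.σ j))) fun i hi => by
        simp [kinMatrix, rowMatrix, Finset.ne_of_mem_erase hi], sum_weighted_momenta D hD,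
        hη (D.P j), hη (D.k j), eps_momentum D hD]
    simp [kinMatrix, rowMatrix]

theorem kinForm_traceVec (hη : ∀ x y, η x y = η y x) (hD : D.OnShell η) :
    rowForm (D.kinMatrix η) (traceVec Finset.univ) = 0 := by
  refine dual_ext fun s => ?_
  simp only [traceVec, map_sum, LinearMap.sum_apply, rowForm_row, LinearMap.zero_apply]
  exact D.sum_kinMatrix hη hD s

theorem kinForm_traceVec' (hη : ∀ x y, η x y = η y x) (hD : D.OnShell η) :
    rowForm (D.kinMatrix η) (traceVec' D.σ Finset.univ) = 0 := by
  refine dual_ext fun s => ?_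
  simp only [traceVec', map_sum, LinearMap.sum_apply, rowForm_row, LinearMap.zero_apply, map_smul,
    LinearMap.smul_apply, smul_eq_mul]
  exact D.sum_weighted_kinMatrix hη hD s

end Insertions

section

variable {n : ℕ} (σ : Fin n → ℂ) {h : Finset (Fin n)}

theorem vec_mom_mul_rowProduct {𝒯 : Finset (Finset (Fin n))} {i : Fin n} (hi : i ∈ h) :
    vec (row (.mom i)) * (rowProduct σ h 𝒯 : ExteriorAlgebra ℂ (RowSpace n)) = 0 := by
  rw [rowProduct, ← Finset.mul_prod_erase _ _ hi, mul_assoc, MulMemClass.coe_mul, ← mul_assoc,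
    gravitonPair, vec_mul_evenMul_left, zero_mul]

theorem vec_traceVec_mul_rowProduct {𝒯 : Finset (Finset (Fin n))} {T : Finset (Fin n)}
    (hT : T ∈ 𝒯) : vec (traceVec T) * (rowProduct σ h 𝒯 : ExteriorAlgebra ℂ (RowSpace n)) = 0 := by
  rw [rowProduct, mul_comm, ← Finset.mul_prod_erase _ _ hT, mul_assoc, MulMemClass.coe_mul,
    ← mul_assoc, tracePair, vec_mul_evenMul_left, zero_mul]

theorem vec_traceVec'_mul_rowProduct {𝒯 : Finset (Finset (Fin n))} {T : Finset (Fin n)}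
    (hT : T ∈ 𝒯) : vec (traceVec' σ T) * (rowProduct σ h 𝒯 : ExteriorAlgebra ℂ (RowSpace n)) = 0 := by
  rw [rowProduct, mul_comm, ← Finset.mul_prod_erase _ _ hT, mul_assoc, MulMemClass.coe_mul,
    ← mul_assoc, tracePair, vec_mul_evenMul_right, zero_mul]

theorem sum_gravitons_parts {E : Type*} [AddCommMonoid E] {A : Finset (Fin n)} (hA : Disjoint h A)
    (hu : h ∪ A = Finset.univ) (p : Finpartition A) (x : Fin n → E) :
    ∑ i, x i = ∑ i ∈ h, x i + ∑ T ∈ p.parts, ∑ i ∈ T, x i := by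
  rw [← hu, Finset.sum_union hA]
  congr 1
  conv_lhs => rw [← p.biUnion_parts]
  rw [Finset.sum_biUnion p.disjoint]
  rfl

/-- The vector is a sum of graviton momentum rows and trace rows, and each of these is a factor of
the product. -/
theorem vec_null_mul_rowProduct {A : Finset (Fin n)} (hA : Disjoint h A)
    (hu : h ∪ A = Finset.univ) (p : Finpartition A) :
    vec (traceVec Finset.univ) * (rowProduct σ h p.parts : ExteriorAlgebra ℂ (RowSpace n)) = 0 := by
  rw [traceVec, sum_gravitons_parts hA hu p, map_add, add_mul, map_sum, map_sum, Finset.sum_mul,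
    Finset.sum_mul, Finset.sum_eq_zero fun i hi => vec_mom_mul_rowProduct σ hi,
    zero_add]
  exact Finset.sum_eq_zero fun T hT => vec_traceVec_mul_rowProduct σ hT

theorem vec_null'_mul_rowProduct {A : Finset (Fin n)} (hA : Disjoint h A)
    (hu : h ∪ A = Finset.univ) (p : Finpartition A) :
    vec (traceVec' σ Finset.univ) *
      (rowProduct σ h p.parts : ExteriorAlgebra ℂ (RowSpace n)) = 0 := by
  rw [traceVec', sum_gravitons_parts hA hu p, map_add, add_mul, map_sum, map_sum, Finset.sum_mul,
    Finset.sum_mul, Finset.sum_eq_zero fun i hi => by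
      rw [map_smul, smul_mul_assoc, vec_mom_mul_rowProduct σ hi, smul_zero],
    zero_add]
  exact Finset.sum_eq_zero fun T hT => vec_traceVec'_mul_rowProduct σ hT

end

namespace Insertions

variable {n : ℕ} {V 𝔤 : Type*} [AddCommGroup V] [Module ℂ V]
  (D : Insertions n V 𝔤) {η : BilinForm ℂ V}

/-- The minor of two functionals on the two null vectors. -/
def minor (d d' : Module.Dual ℂ (RowSpace n)) : ℂ :=
  d (traceVec Finset.univ) * d' (traceVec' D.σ Finset.univ) -
    d (traceVec' D.σ Finset.univ) * d' (traceVec Finset.univ)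

omit [AddCommGroup V] [Module ℂ V] in
theorem minor_mom (a b : Fin n) : D.minor (coord (.mom a)) (coord (.mom b)) = D.σ b - D.σ a := by
  simp [minor, coord_mom_traceVec, coord_mom_traceVec']

/-- All ways to remove two rows give the same reduced Pfaffian. -/
theorem reduced_eq (hη : ∀ x y, η x y = η y x) (hD : D.OnShell η)
    {φ : ExteriorAlgebra ℂ (RowSpace n) →ₗ[ℂ] ℂ} (hφ : IsPfaffian (rowForm (D.kinMatrix η)) φ)
    (p : Finpartition D.gluons) {d₁ d₂ d₃ d₄ : Module.Dual ℂ (RowSpace n)}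
    (h : D.minor d₁ d₂ ≠ 0) (h' : D.minor d₃ d₄ ≠ 0) :
    φ (del d₁ (del d₂ (rowProduct D.σ D.gravitons p.parts : ExteriorAlgebra ℂ (RowSpace n)))) /
        D.minor d₁ d₂ =
      φ (del d₃ (del d₄ (rowProduct D.σ D.gravitons p.parts : ExteriorAlgebra ℂ (RowSpace n)))) /
        D.minor d₃ d₄ := by
  rw [div_eq_div_iff h h']
  exact hφ.plucker (D.kinForm_traceVec hη hD) (D.kinForm_traceVec' hη hD)
    (vec_null_mul_rowProduct _ D.disjoint_gravitons_gluons D.gravitons_union_gluons p)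
    (vec_null'_mul_rowProduct _ D.disjoint_gravitons_gluons D.gravitons_union_gluons p) _ _ _ _

end Insertions
end CombSusy
end

/-! ### Signs of row orderings and the sum over pairs in each trace -/

noncomputable section
namespace CombSusy

section

variable {E : Type*} [AddCommGroup E] [Module ℂ E]

theorem vecProd_map {R R' : Type*} (f : R → R') (v : R' → E) (l : List R) :
    vecProd v (l.map f) = vecProd (v ∘ f) l := by
  simp [vecProd, Function.comp_def]

/-- The sign that arises when the rows are collected in pairs. -/
theorem vecProd_four {R R' : Type*} (x x' : R → E) (y y' : R' → E) (l : List R) (l' : List R') :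
    vecProd x l * vecProd y l' * vecProd y' l' * vecProd x' l =
      ((-1 : ℂ) ^ (l.length * (l.length - 1) / 2) * (-1) ^ (l'.length * (l'.length - 1) / 2)) •
        (((l.map fun r => evenMul (x r) (x' r)).prod * (l'.map fun r => evenMul (y r) (y' r)).prod :
          Subalgebra.center ℂ (ExteriorAlgebra ℂ E)) : ExteriorAlgebra ℂ E) := by
  have h := ((l'.map fun r => evenMul (y r) (y' r)).prod).2
  rw [Subalgebra.mem_center_iff] at h
  rw [mul_assoc (vecProd x l), vecProd_mul_vecProd y y', mul_smul_comm, smul_mul_assoc, h, mul_assoc,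
    vecProd_mul_vecProd x x', mul_smul_comm, smul_smul, MulMemClass.coe_mul, mul_comm (_ ^ _)]
  congr 1
  exact ((((l'.map fun r => evenMul (y r) (y' r)).prod).2).comm _).eq

end

theorem prod_map_sort {n : ℕ} {A : Type*} [CommMonoid A] (s : Finset (Fin n)) (f : Fin n → A) :
    ((s.sort (· ≤ ·)).map f).prod = ∏ i ∈ s, f i := by
  rw [Finset.prod_eq_multiset_prod, ← Finset.sort_eq s (· ≤ ·), Multiset.map_coe, Multiset.prod_coe]

theorem prod_map_toList' {α : Type*} {A : Type*} [CommMonoid A] (s : Finset α) (f : α → A) :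
    (s.toList.map f).prod = ∏ i ∈ s, f i := by
  rw [Finset.prod_map_toList]

theorem idxOf_map_lt {n : ℕ} {R : Type*} [DecidableEq R] {f : Fin n → R}
    (hf : Function.Injective f) {l : List (Fin n)} (hl : l.Pairwise (· < ·)) {a b : Fin n}
    (ha : a ∈ l) (hb : b ∈ l) (hab : a < b) :
    (l.map f).idxOf (f a) < (l.map f).idxOf (f b) := by
  induction l with
  | nil => simp at ha
  | cons x l ih =>
    rw [List.pairwise_cons] at hl
    rw [List.map_cons]
    by_cases hxa : x = a
    · subst hxa
      rw [List.idxOf_cons_self, List.idxOf_cons_ne _ (fun h => hab.ne (hf h))]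
      omega
    · have ha' := (List.mem_cons.1 ha).resolve_left (Ne.symm hxa)
      have hxb : x ≠ b := by
        rintro rfl
        exact absurd (hl.1 a ha') (not_lt.2 hab.le)
      have hb' := (List.mem_cons.1 hb).resolve_left (Ne.symm hxb)
      rw [List.idxOf_cons_ne _ (fun h => hxa (hf h)), List.idxOf_cons_ne _ (fun h => hxb (hf h))]
      have := ih hl.2 ha' hb'
      omega

namespace Insertions

section

variable {n : ℕ} {V 𝔤 : Type*} [AddCommGroup V] [Module ℂ V]
  (D : Insertions n V 𝔤) {η : BilinForm ℂ V}

/-- The rows other than polarizations of gluons. -/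
def IsPhysical : Row n → Prop
  | .mom _ => True
  | .pol i => i ∈ D.gravitons

theorem matrixEntry_eq (hη : ∀ x y, η x y = η y x) {r s : Row n} (hr : D.IsPhysical r)
    (hs : D.IsPhysical s) : D.matrixEntry η r s = D.kinMatrix η r s := by
  have heps : ∀ i ∈ D.gravitons, D.eps i = D.ε i := fun i hi => if_pos (D.mem_gravitons.1 hi)
  cases r with
  | mom i => cases s with
    | mom j => rfl
    | pol j =>
      rw [kinMatrix, rowMatrix, matrixEntry, matrixEntry.C]
      by_cases h : i = j
      · subst h; rw [if_pos rfl, if_pos rfl, neg_neg, heps i hs]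
      · rw [if_neg h, if_neg (Ne.symm h), heps j hs, hη, ← div_neg, neg_sub]
  | pol i => cases s with
    | mom j =>
      rw [kinMatrix, rowMatrix, matrixEntry, matrixEntry.C]
      by_cases h : i = j
      · subst h; rw [if_pos rfl, if_pos rfl, heps i hr]
      · rw [if_neg h, if_neg h, heps i hr]
    | pol j =>
      rw [kinMatrix, rowMatrix, matrixEntry, heps i hr, heps j hs]

theorem pfaffian_matrixEntry (hη : ∀ x y, η x y = η y x)
    {φ : ExteriorAlgebra ℂ (RowSpace n) →ₗ[ℂ] ℂ} (hφ : IsPfaffian (rowForm (D.kinMatrix η)) φ)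
    {l : List (Row n)} (hl : ∀ r ∈ l, D.IsPhysical r) :
    pfaffian (D.matrixEntry η) l = φ (vecProd row l) := by
  rw [hφ.apply_vecProd]
  refine pfaffian_congr fun r hr s hs => ?_
  rw [rowForm_row, D.matrixEntry_eq hη (hl r hr) (hl s hs)]

/-- The sign of the rearrangement of all rows, for a given number of traces. -/
def rowSign (m : ℕ) : ℂ :=
  (-1) ^ (D.gravitons.card * (D.gravitons.card - 1) / 2) * (-1) ^ (m * (m - 1) / 2)

omit [AddCommGroup V] [Module ℂ V] in
theorem vecProd_pairRows (S : Finset (Finset (Fin n))) (cd : S → Fin n × Fin n) :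
    vecProd row (D.pairRows S cd) = D.rowSign S.card • (((∏ i ∈ D.gravitons, gravitonPair i) *
      ∏ T : S, evenMul (row (.mom (cd T).1)) (row (.mom (cd T).2)) : Subalgebra.center ℂ _) :
        ExteriorAlgebra ℂ (RowSpace n)) := by
  rw [pairRows, vecProd_append, vecProd_append, vecProd_append, vecProd_map, vecProd_map, vecProd_map,
    vecProd_map, vecProd_four, prod_map_sort, prod_map_toList', Finset.length_sort,
    Finset.length_toList, Finset.card_attach]
  rfl

omit [AddCommGroup V] [Module ℂ V] in
theorem pairRows_physical {S : Finset (Finset (Fin n))} {cd : S → Fin n × Fin n} {r : Row n}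
    (hr : r ∈ D.pairRows S cd) : D.IsPhysical r := by
  cases r with
  | mom i => trivial
  | pol i => simpa [pairRows, IsPhysical] using hr

end

section

variable {n : ℕ} {V 𝔤 : Type*} [AddCommGroup V] [Module ℂ V] [LieRing 𝔤] [LieAlgebra ℂ 𝔤]
  (D : Insertions n V 𝔤) {η : BilinForm ℂ V} (κ : BilinForm ℂ 𝔤)

omit [AddCommGroup V] [Module ℂ V] in
/-- The sum over the pairs `c < d` in every trace. -/
theorem sum_pairChoices (S : Finset (Finset (Fin n)))
    (ψ : Subalgebra.center ℂ (ExteriorAlgebra ℂ (RowSpace n)) →ₗ[ℂ] ℂ) :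
    ∑ cd ∈ pairChoices S, (∏ T, D.comb κ (cd T).1 (cd T).2 T) *
      ψ (∏ T : S, evenMul (row (.mom (cd T).1)) (row (.mom (cd T).2))) =
      (∏ T ∈ S, D.colour κ T) * ψ (∏ T ∈ S, tracePair D.σ T) := by
  have h1 : ∏ T ∈ S, tracePair D.σ T = ∑ cd ∈ pairChoices S,
      (∏ T : S, (D.σ (cd T).2 - D.σ (cd T).1)) •
        ∏ T : S, evenMul (row (.mom (cd T).1)) (row (.mom (cd T).2)) := by
    rw [← Finset.prod_coe_sort]
    unfold tracePair traceVec traceVec'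
    simp only [evenMul_sum_sum_lt]
    rw [Finset.prod_univ_sum]
    refine Finset.sum_congr rfl fun cd _ => ?_
    rw [Finset.prod_smul]
  rw [h1, map_sum, Finset.mul_sum]
  refine Finset.sum_congr rfl fun cd _ => ?_
  rw [map_smul, smul_eq_mul, ← mul_assoc]
  congr 1
  unfold comb
  rw [Finset.prod_mul_distrib, Finset.prod_coe_sort, mul_comm]

end

end Insertions
end CombSusy
end

/-! ### Reduction by two gravitons or by a trace -/

noncomputable section
namespace CombSusy
namespace Insertions

variable {n : ℕ} {V 𝔤 : Type*} [AddCommGroup V] [Module ℂ V] [LieRing 𝔤] [LieAlgebra ℂ 𝔤]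
  (D : Insertions n V 𝔤) {η : BilinForm ℂ V} (κ : BilinForm ℂ 𝔤)

omit [AddCommGroup V] [Module ℂ V] [LieRing 𝔤] [LieAlgebra ℂ 𝔤] in
theorem part_subset_gluons (p : Finpartition D.gluons) {T : Finset (Fin n)} (hT : T ∈ p.parts) :
    T ⊆ D.gluons := p.le hT

/-- A graviton's momentum row occurs only once, so contraction with its coordinate deletes it. The
minus sign turns the minor `σ_b - σ_a` into the denominator `σ_ab`. -/
theorem contributionGravitons_eq (hη : ∀ x y, η x y = η y x)
    {φ : ExteriorAlgebra ℂ (RowSpace n) →ₗ[ℂ] ℂ} (hφ : IsPfaffian (rowForm (D.kinMatrix η)) φ)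
    (p : Finpartition D.gluons) {a b : Fin n} (ha : a ∈ D.gravitons) (hb : b ∈ D.gravitons)
    (hab : a < b) : D.contributionGravitons η κ p a b =
      D.rowSign p.parts.card * ((∏ T ∈ p.parts, D.colour κ T) *
        -(φ (del (coord (.mom a)) (del (coord (.mom b)) (rowProduct D.σ D.gravitons p.parts :
          ExteriorAlgebra ℂ (RowSpace n)))) / D.minor (coord (.mom a)) (coord (.mom b)))) := by
  have hmom : Function.Injective (Row.mom : Fin n → Row n) := fun _ _ h => Row.mom.inj h
  have key : ∀ cd ∈ pairChoices p.parts,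
      (-1) ^ ((D.pairRows p.parts cd).idxOf (.mom a) + (D.pairRows p.parts cd).idxOf (.mom b)) *
        pfaffian (D.matrixEntry η) (((D.pairRows p.parts cd).erase (.mom a)).erase (.mom b)) =
      φ (del (coord (.mom a)) (del (coord (.mom b)) (vecProd row (D.pairRows p.parts cd)))) := by
    intro cd hcd
    have hcd' : ∀ T : p.parts, (cd T).1 ∈ D.gluons ∧ (cd T).2 ∈ D.gluons := by
      intro T
      have h := Fintype.mem_piFinset.1 hcd T
      rw [Finset.mem_filter, Finset.mem_product] at h
      exact ⟨D.part_subset_gluons p T.2 h.1.1, D.part_subset_gluons p T.2 h.1.2⟩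
    have hsplit : D.pairRows p.parts cd = (D.gravitons.sort (· ≤ ·)).map .mom ++
        (p.parts.attach.toList.map (fun T => .mom (cd T).1) ++
        (p.parts.attach.toList.map (fun T => .mom (cd T).2) ++
          (D.gravitons.sort (· ≤ ·)).map .pol)) := by
      rw [pairRows, List.append_assoc, List.append_assoc]
    have hmem : ∀ c ∈ D.gravitons, Row.mom c ∈ (D.gravitons.sort (· ≤ ·)).map Row.mom :=
      fun c hc => List.mem_map_of_mem ((Finset.mem_sort _).2 hc)
    have hnot : ∀ c ∈ D.gravitons, Row.mom c ∉ (D.pairRows p.parts cd).erase (Row.mom c) := by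
      intro c hc
      have hc' : ∀ T : p.parts, (cd T).1 ≠ c ∧ (cd T).2 ≠ c := fun T =>
        ⟨fun h => Finset.disjoint_left.1 D.disjoint_gravitons_gluons hc (h ▸ (hcd' T).1),
          fun h => Finset.disjoint_left.1 D.disjoint_gravitons_gluons hc (h ▸ (hcd' T).2)⟩
      rw [hsplit, List.erase_append_left _ (hmem c hc), List.mem_append, not_or]
      refine ⟨((Finset.sort_nodup _ _).map hmom).not_mem_erase, ?_⟩
      simp only [List.mem_append, List.mem_map, not_or]
      refine ⟨?_, ?_, ?_⟩
      · rintro ⟨T, -, h⟩; exact (hc' T).1 (hmom h)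
      · rintro ⟨T, -, h⟩; exact (hc' T).2 (hmom h)
      · rintro ⟨T, -, h⟩; cases h
    have hidx : (D.pairRows p.parts cd).idxOf (.mom a) < (D.pairRows p.parts cd).idxOf (.mom b) := by
      rw [hsplit, List.idxOf_append_of_mem (hmem a ha), List.idxOf_append_of_mem (hmem b hb)]
      exact idxOf_map_lt hmom (Finset.sortedLT_sort _).pairwise ((Finset.mem_sort _).2 ha)
        ((Finset.mem_sort _).2 hb) hab
    have hdual : ∀ (c : Fin n), ∀ z ∈ D.pairRows p.parts cd, z ≠ .mom c →
        coord (.mom c) (row z) = 0 := fun c z _ hz => by rw [coord_row, if_neg hz]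
    rw [del_del_vecProd (coord (.mom a)) (coord (.mom b)) row (hnot a ha) (hnot b hb)
      (by rw [hsplit]; exact List.mem_append_left _ (hmem a ha))
      (by rw [hsplit]; exact List.mem_append_left _ (hmem b hb)) hidx
      (by rw [coord_row, if_pos rfl]) (hdual a) (by rw [coord_row, if_pos rfl]) (hdual b),
      map_smul, smul_eq_mul, D.pfaffian_matrixEntry hη hφ fun r hr =>
        D.pairRows_physical (List.mem_of_mem_erase (List.mem_of_mem_erase hr))]
  have hsum := D.sum_pairChoices κ p.parts (φ ∘ₗ del (coord (.mom a)) ∘ₗ del (coord (.mom b)) ∘ₗ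
    (Subalgebra.center ℂ (ExteriorAlgebra ℂ (RowSpace n))).val.toLinearMap ∘ₗ
      LinearMap.mulLeft ℂ (∏ i ∈ D.gravitons, gravitonPair i))
  simp only [LinearMap.comp_apply, LinearMap.mulLeft_apply, AlgHom.toLinearMap_apply,
    Subalgebra.val_apply] at hsum
  rw [D.minor_mom, rowProduct, ← neg_sub (D.σ a), div_neg, neg_neg, ← mul_div_assoc, ← hsum,
    Finset.sum_div, Finset.mul_sum, contributionGravitons]
  refine Finset.sum_congr rfl fun cd hcd => ?_
  rw [div_mul_eq_mul_div, key cd hcd, vecProd_pairRows, map_smul, map_smul, map_smul, smul_eq_mul]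
  ring

omit [AddCommGroup V] [Module ℂ V] [LieRing 𝔤] [LieAlgebra ℂ 𝔤] in
/-- A functional dual to the first row of a trace. -/
theorem exists_dual (hσ : Function.Injective D.σ) {T : Finset (Fin n)} (hT : 2 ≤ T.card)
    (x y : ℂ) : ∃ d : Module.Dual ℂ (RowSpace n), d (traceVec T) = x ∧ d (traceVec' D.σ T) = y ∧
      (∀ T', T ⊆ T' → d (traceVec T') = x ∧ d (traceVec' D.σ T') = y) ∧
      (∀ T', Disjoint T T' → d (traceVec T') = 0 ∧ d (traceVec' D.σ T') = 0) ∧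
      (∀ i ∉ T, d (row (.mom i)) = 0) ∧ ∀ i, d (row (.pol i)) = 0 := by
  obtain ⟨c, hc, e, he, hce⟩ := Finset.one_lt_card.1 hT
  have hne : D.σ e - D.σ c ≠ 0 := sub_ne_zero.2 fun h => hce (hσ h).symm
  -- The two coefficients solve a linear system for two labels `c`, `e` of `T`: their sum is `x` and
  -- their sum weighted with `σ` is `y`. It is solvable because the punctures differ.
  have key : ∀ T', T ⊆ T' → ((x * D.σ e - y) / (D.σ e - D.σ c)) *
      coord (.mom c) (traceVec T') + ((y - x * D.σ c) / (D.σ e - D.σ c)) *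
      coord (.mom e) (traceVec T') = x ∧ ((x * D.σ e - y) / (D.σ e - D.σ c)) *
      coord (.mom c) (traceVec' D.σ T') + ((y - x * D.σ c) / (D.σ e - D.σ c)) *
      coord (.mom e) (traceVec' D.σ T') = y := by
    intro T' hT'
    rw [coord_mom_traceVec, coord_mom_traceVec, coord_mom_traceVec', coord_mom_traceVec',
      if_pos (hT' hc), if_pos (hT' hc), if_pos (hT' he), if_pos (hT' he)]
    constructor <;> (field_simp; ring)
  refine ⟨((x * D.σ e - y) / (D.σ e - D.σ c)) • coord (.mom c) +
    ((y - x * D.σ c) / (D.σ e - D.σ c)) • coord (.mom e), (key T subset_rfl).1,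
    (key T subset_rfl).2, key, fun T' hT' => ?_, fun i hi => ?_, fun i => ?_⟩
  · have h1 := Finset.disjoint_left.1 hT' hc
    have h2 := Finset.disjoint_left.1 hT' he
    simp [coord_mom_traceVec, coord_mom_traceVec', h1, h2]
  · have h1 : i ≠ c := by rintro rfl; exact hi hc
    have h2 : i ≠ e := by rintro rfl; exact hi he
    simp [coord_row, h1, h2]
  · simp [coord_row]

/-- Choose `d`, `d'` dual to the two rows of `T₀` and zero on all other factors. Their minor on the
null vectors is `1`, and their double contraction removes the pair of `T₀`. -/
theorem contributionTrace_eq (hη : ∀ x y, η x y = η y x) (hσ : Function.Injective D.σ)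
    {φ : ExteriorAlgebra ℂ (RowSpace n) →ₗ[ℂ] ℂ} (hφ : IsPfaffian (rowForm (D.kinMatrix η)) φ)
    (p : Finpartition D.gluons) {T₀ : Finset (Fin n)} (hT₀ : T₀ ∈ p.parts) (hT₀' : 2 ≤ T₀.card) :
    ∃ d d' : Module.Dual ℂ (RowSpace n), D.minor d d' ≠ 0 ∧ D.contributionTrace η κ p T₀ =
      D.rowSign p.parts.card * ((∏ T ∈ p.parts, D.colour κ T) *
        -(φ (del d (del d' (rowProduct D.σ D.gravitons p.parts :
          ExteriorAlgebra ℂ (RowSpace n)))) / D.minor d d')) := by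
  obtain ⟨d, h1, h2, h3, h4, h5, h6⟩ := D.exists_dual hσ hT₀' 1 0
  obtain ⟨d', h1', h2', h3', h4', h5', h6'⟩ := D.exists_dual hσ hT₀' 0 1
  have hmin : D.minor d d' = 1 := by
    rw [minor, (h3 _ (Finset.subset_univ _)).1, (h3 _ (Finset.subset_univ _)).2,
      (h3' _ (Finset.subset_univ _)).1, (h3' _ (Finset.subset_univ _)).2]
    norm_num
  refine ⟨d, d', by rw [hmin]; exact one_ne_zero, ?_⟩
  have hgrav : ∀ i ∈ D.gravitons, i ∉ T₀ := fun i hi h =>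
    Finset.disjoint_left.1 D.disjoint_gravitons_gluons hi (D.part_subset_gluons p hT₀ h)
  have hdisj : ∀ T ∈ p.parts.erase T₀, Disjoint T₀ T := fun T hT =>
    p.disjoint hT₀ (Finset.mem_of_mem_erase hT) (Finset.ne_of_mem_erase hT).symm
  set R : Subalgebra.center ℂ (ExteriorAlgebra ℂ (RowSpace n)) :=
    (∏ i ∈ D.gravitons, gravitonPair i) * ∏ T ∈ p.parts.erase T₀, tracePair D.σ T with hR
  have hdel : ∀ f : Module.Dual ℂ (RowSpace n), (∀ T', Disjoint T₀ T' → f (traceVec T') = 0 ∧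
      f (traceVec' D.σ T') = 0) → (∀ i ∉ T₀, f (row (.mom i)) = 0) → (∀ i, f (row (.pol i)) = 0) →
      del f (R : ExteriorAlgebra ℂ (RowSpace n)) = 0 := by
    intro f hf1 hf2 hf3
    have h7 := del_prod_evenMul_mul f (p.parts.erase T₀) traceVec (traceVec' D.σ)
      (fun T hT => (hf1 T (hdisj T hT)).1) (fun T hT => (hf1 T (hdisj T hT)).2) 1
    rw [mul_one, del_one, mul_zero] at h7
    rw [hR, MulMemClass.coe_mul]
    unfold gravitonPair
    rw [del_prod_evenMul_mul f _ _ _ (fun i hi => hf2 i (hgrav i hi)) (fun i _ => hf3 i)]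
    unfold tracePair
    rw [h7, mul_zero]
  have hprod : rowProduct D.σ D.gravitons p.parts = tracePair D.σ T₀ * R := by
    rw [rowProduct, ← Finset.mul_prod_erase _ _ hT₀, mul_left_comm]
  have hred : del d (del d' (rowProduct D.σ D.gravitons p.parts : ExteriorAlgebra ℂ (RowSpace n))) =
      -(R : ExteriorAlgebra ℂ (RowSpace n)) := by
    rw [hprod, MulMemClass.coe_mul, tracePair, del_evenMul_mul, hdel d' h4' h5' h6', h1', h2',
      zero_smul, mul_zero, add_zero, zero_sub, one_smul, map_neg, del_vec_mul, h1,
      hdel d h4 h5 h6, mul_zero, sub_zero, one_smul]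
  have hsum := D.sum_pairChoices κ (p.parts.erase T₀) (φ ∘ₗ
    (Subalgebra.center ℂ (ExteriorAlgebra ℂ (RowSpace n))).val.toLinearMap ∘ₗ
      LinearMap.mulLeft ℂ (∏ i ∈ D.gravitons, gravitonPair i))
  simp only [LinearMap.comp_apply, LinearMap.mulLeft_apply, AlgHom.toLinearMap_apply,
    Subalgebra.val_apply] at hsum
  -- The triangular numbers in the row signs for `m` and `m - 1` traces differ by `m - 1`, which has
  -- the parity of `m + 1`.
  have hsign : (-1 : ℂ) ^ (p.parts.card + 1) * D.rowSign (p.parts.erase T₀).card =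
      D.rowSign p.parts.card := by
    have : p.parts.card = (p.parts.erase T₀).card + 1 := (Finset.card_erase_add_one hT₀).symm
    rw [this, rowSign, rowSign, Nat.triangle_succ]
    ring
  rw [hred, hmin, div_one, map_neg, neg_neg, ← Finset.mul_prod_erase _ _ hT₀, hR, mul_assoc,
    ← hsum, ← hsign, Finset.mul_sum, Finset.mul_sum, contributionTrace, Finset.mul_sum]
  refine Finset.sum_congr rfl fun cd _ => ?_
  rw [D.pfaffian_matrixEntry hη hφ fun r hr => D.pairRows_physical hr, vecProd_pairRows, map_smul,
    smul_eq_mul]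
  ring

end Insertions
end CombSusy
end

/-! ### The matrix `Π` and its reductions -/

noncomputable section
namespace CombSusy

theorem bilin_list_sum {E α β : Type*} [AddCommGroup E] [Module ℂ E] (B : E →ₗ[ℂ] E →ₗ[ℂ] ℂ)
    (f : α → E) (g : β → E) (l : List α) (l' : List β) :
    B (l.map f).sum (l'.map g).sum = (l.map fun x => (l'.map fun y => B (f x) (g y)).sum).sum := by
  induction l with
  | nil => simp
  | cons x l ih =>
    rw [List.map_cons, List.sum_cons, map_add, LinearMap.add_apply, ih, List.map_cons, List.sum_cons,
      map_list_sum, List.map_map]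
    rfl

namespace Insertions

section

variable {n : ℕ} {V 𝔤 : Type*} (D : Insertions n V 𝔤)

/-- The rows of the matrix `Π` as vectors. -/
def traceRow : TraceRow n → RowSpace n
  | .mom a => row (.mom a)
  | .trace T => traceVec T
  | .trace' T => traceVec' D.σ T
  | .pol a => row (.pol a)

/-- The values of the functional dual to a row of `Π` on the two null vectors. -/
def nullValues : TraceRow n → ℂ × ℂ
  | .mom a => (1, D.σ a)
  | .trace _ => (1, 0)
  | .trace' _ => (0, 1)
  | .pol _ => (0, 0)

/-- The prescribed denominators are the negatives of the minors of the dual functionals on the two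
null vectors. -/
theorem reductionFactor_eq {x y : TraceRow n} (h : D.reductionFactor x y ≠ 0) :
    D.reductionFactor x y = -((D.nullValues x).1 * (D.nullValues y).2 -
      (D.nullValues x).2 * (D.nullValues y).1) := by
  cases x <;> cases y <;> simp_all [reductionFactor, nullValues]

theorem sum_map_sort {E : Type*} [AddCommMonoid E] (T : Finset (Fin n)) (f : Fin n → E) :
    ((T.sort (· ≤ ·)).map f).sum = ∑ i ∈ T, f i := by
  rw [Finset.sum_eq_multiset_sum, ← Finset.sort_eq T (· ≤ ·), Multiset.map_coe, Multiset.sum_coe]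

theorem traceRow_eq (r : TraceRow n) :
    D.traceRow r = ((D.rowCombination r).map fun x => x.1 • row x.2).sum := by
  cases r with
  | mom a => simp [traceRow, rowCombination]
  | pol a => simp [traceRow, rowCombination]
  | trace T =>
    rw [traceRow, rowCombination, List.map_map, sum_map_sort]
    simp [traceVec]
  | trace' T =>
    rw [traceRow, rowCombination, List.map_map, sum_map_sort]
    simp [traceVec']

theorem vecProd_piRows (p : Finpartition D.gluons) :
    vecProd D.traceRow (D.piRows p) = D.rowSign p.parts.card •
      (rowProduct D.σ D.gravitons p.parts : ExteriorAlgebra ℂ (RowSpace n)) := by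
  rw [piRows, vecProd_append, vecProd_append, vecProd_append, vecProd_map, vecProd_map, vecProd_map,
    vecProd_map, vecProd_four, prod_map_sort, prod_map_toList', Finset.length_sort,
    Finset.length_toList]
  rfl

theorem mem_piRows {p : Finpartition D.gluons} {z : TraceRow n} : z ∈ D.piRows p ↔
    match z with
    | .mom a => a ∈ D.gravitons
    | .trace T => T ∈ p.parts
    | .trace' T => T ∈ p.parts
    | .pol a => a ∈ D.gravitons := by
  cases z <;> simp [piRows]

theorem nodup_piRows (p : Finpartition D.gluons) : (D.piRows p).Nodup := by
  have h1 : (D.gravitons.sort (· ≤ ·)).Nodup := Finset.sort_nodup _ _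
  have h2 : p.parts.toList.Nodup := Finset.nodup_toList _
  rw [piRows, List.append_assoc, List.append_assoc, List.nodup_append', List.nodup_append',
    List.nodup_append']
  refine ⟨h1.map fun _ _ h => TraceRow.mom.inj h, ⟨h2.map fun _ _ h => TraceRow.trace.inj h,
    ⟨h2.map fun _ _ h => TraceRow.trace'.inj h, h1.map fun _ _ h => TraceRow.pol.inj h, ?_⟩, ?_⟩, ?_⟩
  all_goals
    rw [List.disjoint_left]
    simp

/-- A momentum row has its coordinate as dual functional. For a trace, two labels of the part
suffice to separate its two rows. A null vector restricts on each part to the corresponding trace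
row, which gives the last two values. -/
theorem exists_rowDual (hσ : Function.Injective D.σ) {p : Finpartition D.gluons}
    (hp : ∀ T ∈ p.parts, 2 ≤ T.card) {x : TraceRow n} (hx : x ∈ D.piRows p)
    (hpol : ∀ a, x ≠ .pol a) : ∃ d : Module.Dual ℂ (RowSpace n), d (D.traceRow x) = 1 ∧
      (∀ z ∈ D.piRows p, z ≠ x → d (D.traceRow z) = 0) ∧
      d (traceVec Finset.univ) = (D.nullValues x).1 ∧
      d (traceVec' D.σ Finset.univ) = (D.nullValues x).2 := by
  have hgrav : ∀ i ∈ D.gravitons, ∀ T ∈ p.parts, i ∉ T := fun i hi T hT h =>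
    Finset.disjoint_left.1 D.disjoint_gravitons_gluons hi (D.part_subset_gluons p hT h)
  cases x with
  | pol a => exact absurd rfl (hpol a)
  | mom a =>
    have ha : a ∈ D.gravitons := D.mem_piRows.1 hx
    refine ⟨coord (.mom a), by simp [traceRow, coord_row], fun z hz hzx => ?_, ?_, ?_⟩
    · have hz' := D.mem_piRows.1 hz
      cases z with
      | mom b =>
        have : b ≠ a := fun h => hzx (h ▸ rfl)
        simp [traceRow, coord_row, this]
      | trace T => simp [traceRow, coord_mom_traceVec, hgrav a ha T hz']
      | trace' T => simp [traceRow, coord_mom_traceVec', hgrav a ha T hz']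
      | pol b => simp [traceRow, coord_row]
    · simp [coord_mom_traceVec, nullValues]
    · simp [coord_mom_traceVec', nullValues]
  | trace T =>
    have hT : T ∈ p.parts := D.mem_piRows.1 hx
    obtain ⟨d, h1, h2, h3, h4, h5, h6⟩ := D.exists_dual hσ (hp T hT) 1 0
    refine ⟨d, h1, fun z hz hzx => ?_, (h3 _ (Finset.subset_univ _)).1,
      (h3 _ (Finset.subset_univ _)).2⟩
    have hz' := D.mem_piRows.1 hz
    cases z with
    | mom b => exact h5 b (hgrav b hz' T hT)
    | trace T' => exact (h4 T' (p.disjoint hT hz' fun h => hzx (h ▸ rfl))).1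
    | trace' T' =>
      by_cases h : T = T'
      · subst h; exact h2
      · exact (h4 T' (p.disjoint hT hz' h)).2
    | pol b => exact h6 b
  | trace' T =>
    have hT : T ∈ p.parts := D.mem_piRows.1 hx
    obtain ⟨d, h1, h2, h3, h4, h5, h6⟩ := D.exists_dual hσ (hp T hT) 0 1
    refine ⟨d, h2, fun z hz hzx => ?_, (h3 _ (Finset.subset_univ _)).1,
      (h3 _ (Finset.subset_univ _)).2⟩
    have hz' := D.mem_piRows.1 hz
    cases z with
    | mom b => exact h5 b (hgrav b hz' T hT)
    | trace' T' => exact (h4 T' (p.disjoint hT hz' fun h => hzx (h ▸ rfl))).2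
    | trace T' =>
      by_cases h : T = T'
      · subst h; exact h1
      · exact (h4 T' (p.disjoint hT hz' h)).1
    | pol b => exact h6 b

end

variable {n : ℕ} {V 𝔤 : Type*} [AddCommGroup V] [Module ℂ V]
  (D : Insertions n V 𝔤) {η : BilinForm ℂ V}

theorem piEntry_eq (hη : ∀ x y, η x y = η y x) {p : Finpartition D.gluons} {r s : TraceRow n}
    (hr : r ∈ D.piRows p) (hs : s ∈ D.piRows p) : D.piEntry η r s =
      rowForm (D.kinMatrix η) (D.traceRow r) (D.traceRow s) := by
  have key : ∀ r ∈ D.piRows p, ∀ x ∈ D.rowCombination r, D.IsPhysical x.2 := by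
    intro r hr x hx
    have hr' := D.mem_piRows.1 hr
    cases r with
    | mom a => simp [rowCombination] at hx; subst hx; trivial
    | pol a => simp [rowCombination] at hx; subst hx; exact hr'
    | trace T =>
      obtain ⟨c, -, rfl⟩ := List.mem_map.1 hx
      trivial
    | trace' T =>
      obtain ⟨c, -, rfl⟩ := List.mem_map.1 hx
      trivial
  rw [traceRow_eq, traceRow_eq, bilin_list_sum, piEntry]
  congr 1
  refine List.map_congr_left fun x hx => ?_
  congr 1
  refine List.map_congr_left fun y hy => ?_
  rw [D.matrixEntry_eq hη (key r hr x hx) (key s hs y hy), map_smul, map_smul, LinearMap.smul_apply,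
    rowForm_row, smul_eq_mul, smul_eq_mul]
  ring

/-- The entries of `Π` are values of the contraction form on its row vectors. Deleting two rows is
therefore a double contraction of the full product with dual functionals. -/
theorem reducedPfaffian_eq (hη : ∀ x y, η x y = η y x) (hσ : Function.Injective D.σ)
    {φ : ExteriorAlgebra ℂ (RowSpace n) →ₗ[ℂ] ℂ} (hφ : IsPfaffian (rowForm (D.kinMatrix η)) φ)
    (p : Finpartition D.gluons) (hp : ∀ T ∈ p.parts, 2 ≤ T.card) {x y : TraceRow n}
    (hxy : D.Removable p x y) :
    ∃ d d' : Module.Dual ℂ (RowSpace n), D.minor d d' ≠ 0 ∧ D.reducedPfaffian η p x y =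
      D.rowSign p.parts.card *
        -(φ (del d (del d' (rowProduct D.σ D.gravitons p.parts :
          ExteriorAlgebra ℂ (RowSpace n)))) / D.minor d d') := by
  obtain ⟨hx, hy, hidx, hred⟩ := hxy
  obtain ⟨d, h1, h2, h3, h4⟩ := D.exists_rowDual hσ hp hx (by
    rintro a rfl; cases y <;> simp [reductionFactor] at hred)
  obtain ⟨d', h1', h2', h3', h4'⟩ := D.exists_rowDual hσ hp hy (by
    rintro a rfl; cases x <;> simp [reductionFactor] at hred)
  have hmin : D.reductionFactor x y = -D.minor d d' := by
    rw [D.reductionFactor_eq hred, minor, h3, h4, h3', h4']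
  refine ⟨d, d', fun h => hred (by rw [hmin, h, neg_zero]), ?_⟩
  have hnd := D.nodup_piRows p
  have h := del_del_vecProd d d' D.traceRow hnd.not_mem_erase hnd.not_mem_erase hx hy hidx h1 h2 h1' h2'
  have hpf : pfaffian (D.piEntry η) (((D.piRows p).erase x).erase y) =
      φ (vecProd D.traceRow (((D.piRows p).erase x).erase y)) := by
    rw [hφ.apply_vecProd]
    exact pfaffian_congr fun r hr s hs => D.piEntry_eq hη
      (List.mem_of_mem_erase (List.mem_of_mem_erase hr))
      (List.mem_of_mem_erase (List.mem_of_mem_erase hs))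
  have h5 := congrArg φ h
  rw [vecProd_piRows, map_smul, map_smul, map_smul, map_smul, smul_eq_mul, smul_eq_mul, ← hpf] at h5
  rw [reducedPfaffian, div_mul_eq_mul_div, ← h5, hmin, div_neg, mul_div_assoc, mul_neg]

end Insertions
end CombSusy
end

/-! ### Auxiliary fermions and ordered products with two odd factors -/

noncomputable section
namespace CombSusy
namespace WickFunctional

section embedding

variable {G G' : Type*} (F : WickFunctional G) (F' : WickFunctional G') (f : G → G')

/-- The homomorphism of free algebras induced by a map of the letters. -/
def freeMap : FreeAlgebra ℂ G →ₐ[ℂ] FreeAlgebra ℂ G' :=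
  FreeAlgebra.lift ℂ fun X => FreeAlgebra.ι ℂ (f X)

theorem freeMap_ι (X : G) : freeMap f (FreeAlgebra.ι ℂ X) = FreeAlgebra.ι ℂ (f X) := by
  simp [freeMap]

variable {F F' f}

theorem contract_freeMap (hpar : ∀ X, F'.par (f X) = F.par X)
    (hc : ∀ X Y, F'.c (f X) (f Y) = F.c X Y) (X : G) (x : FreeAlgebra ℂ G) :
    contract F'.par F'.c (f X) (freeMap f x) = freeMap f (contract F.par F.c X x) := by
  refine freeAlgebra_left_induction (LinearMap.eqLocus
    (contract F'.par F'.c (f X) ∘ₗ (freeMap f).toLinearMap)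
    ((freeMap f).toLinearMap ∘ₗ contract F.par F.c X)) (by simp [contract, twistedDer_one]) ?_ x
  intro Y b hb
  simp only [LinearMap.mem_eqLocus, LinearMap.comp_apply, AlgHom.toLinearMap_apply] at hb ⊢
  rw [map_mul, freeMap_ι, contract_ι_mul, contract_ι_mul, hb, map_add, map_smul, map_smul, map_mul,
    freeMap_ι, hc, hpar, hpar]

/-- An embedding of the letters that respects contractions respects expectation values. -/
theorem W_freeMap (hpar : ∀ X, F'.par (f X) = F.par X)
    (hc : ∀ X Y, F'.c (f X) (f Y) = F.c X Y) (x : FreeAlgebra ℂ G) :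
    F'.W (freeMap f x) = F.W x := by
  refine freeAlgebra_length_induction (LinearMap.eqLocus (F'.W ∘ₗ (freeMap f).toLinearMap) F.W)
    (by simp [W_one]) ?_ x
  intro N hN X a ha
  have h := hN (F.contract_mem_degLE X ha)
  simp only [LinearMap.mem_eqLocus, LinearMap.comp_apply, AlgHom.toLinearMap_apply] at h ⊢
  rw [map_mul, freeMap_ι, W_ι_mul, contract_freeMap hpar hc, h, W_ι_mul]

theorem contr_freeMap_eq_zero {Z : G'} (hZ : ∀ X, F'.c Z (f X) = 0) (x : FreeAlgebra ℂ G) :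
    F'.contr Z (F'.proj (freeMap f x)) = 0 := by
  rw [contr_proj]
  have : contract F'.par F'.c Z (freeMap f x) = 0 := by
    refine freeAlgebra_left_induction (LinearMap.ker
      (contract F'.par F'.c Z ∘ₗ (freeMap f).toLinearMap)) (by simp [contract, twistedDer_one]) ?_ x
    intro Y b hb
    simp only [LinearMap.mem_ker, LinearMap.comp_apply, AlgHom.toLinearMap_apply] at hb ⊢
    rw [map_mul, freeMap_ι, contract_ι_mul, hb, hZ]
    simp
  rw [this, map_zero]

/-- Two additional fermions that are only contracted with each other factor out. -/
theorem ev_gen_mul_gen_mul_freeMap (hpar : ∀ X, F'.par (f X) = F.par X)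
    (hc : ∀ X Y, F'.c (f X) (f Y) = F.c X Y) {Z Z' : G'} (hp : F'.par Z = true)
    (hZ : ∀ X, F'.c Z (f X) = 0) (x : FreeAlgebra ℂ G) :
    F'.ev (F'.gen Z * F'.gen Z' * F'.proj (freeMap f x)) = F'.c Z Z' * F.W x := by
  rw [mul_assoc, ev_gen_mul, contr_mul _ hp, contr_gen, contr_freeMap_eq_zero hZ, mul_zero, add_zero,
    ← Algebra.smul_def, map_smul, ev_proj, W_freeMap hpar hc, smul_eq_mul]

end embedding

section ordering

variable {G : Type*} {F : WickFunctional G}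

theorem coe_prod_map {α : Type*} (l : List α) {X : α → F.Alg} {w : α → F.evenCenter}
    (h : ∀ i ∈ l, X i = w i) : (l.map X).prod = ((l.map w).prod : F.evenCenter) := by
  induction l with
  | nil => simp
  | cons i l ih =>
    rw [List.map_cons, List.map_cons, List.prod_cons, List.prod_cons, MulMemClass.coe_mul,
      h i (by simp), ih fun j hj => h j (List.mem_cons_of_mem _ hj)]

/-- Two odd factors of an ordered product are completed to even ones. -/
theorem odd_mul_odd_mul_prod_ofFn {n : ℕ} {a b : Fin n} (hab : a < b) {X : Fin n → F.Alg}
    {w : Fin n → F.evenCenter} {Za Zb : F.Alg} (hZb : Zb ∈ F.oddPart) (hXa : X a ∈ F.oddPart)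
    (hw : ∀ i, i ≠ a → i ≠ b → X i = w i) (hwa : (w a : F.Alg) = Za * X a)
    (hwb : (w b : F.Alg) = Zb * X b) :
    Za * Zb * (List.ofFn X).prod = -(∏ i, w i : F.evenCenter) := by
  obtain ⟨l₁, t, ht⟩ := List.append_of_mem (List.mem_finRange a)
  have hpw : (List.finRange n).Pairwise (· < ·) := List.pairwise_lt_finRange n
  have hbt : b ∈ t := by
    have hb := List.mem_finRange b
    rw [ht, List.mem_append, List.mem_cons] at hb
    rw [ht, List.pairwise_append] at hpw
    rcases hb with hb | hb | hb
    · exact absurd (hpw.2.2 b hb a (by simp)) (not_lt.2 hab.le)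
    · exact absurd hb hab.ne'
    · exact hb
  obtain ⟨l₂, l₃, rfl⟩ := List.append_of_mem hbt
  have hnd : (List.finRange n).Nodup := List.nodup_finRange n
  rw [ht] at hnd
  have hne : ∀ i ∈ l₁ ++ (l₂ ++ l₃), i ≠ a ∧ i ≠ b := by
    intro i hi
    constructor
    · rintro rfl
      have := (List.nodup_middle.1 hnd)
      rw [List.nodup_cons] at this
      refine this.1 ?_
      simp only [List.mem_append, List.mem_cons] at hi ⊢
      tauto
    · rintro rfl
      rw [show l₁ ++ a :: (l₂ ++ i :: l₃) = (l₁ ++ a :: l₂) ++ i :: l₃ by simp] at hnd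
      have := (List.nodup_middle.1 hnd)
      rw [List.nodup_cons] at this
      refine this.1 ?_
      simp only [List.mem_append, List.mem_cons] at hi ⊢
      tauto
  have hX : ∀ l : List (Fin n), (∀ i ∈ l, i ∈ l₁ ++ (l₂ ++ l₃)) →
      (l.map X).prod = ((l.map w).prod : F.evenCenter) := fun l hl =>
    coe_prod_map l fun i hi => hw i (hne i (hl i hi)).1 (hne i (hl i hi)).2
  rw [Fin.prod_univ_def, List.ofFn_eq_map, ht]
  simp only [List.map_append, List.map_cons, List.prod_append, List.prod_cons, MulMemClass.coe_mul,
    hwa, hwb]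
  rw [hX l₁ fun i hi => by simp [hi], hX l₂ fun i hi => by simp [hi],
    hX l₃ fun i hi => by simp [hi]]
  have c₁ := ((l₁.map w).prod).2.2
  have c₂ := ((l₂.map w).prod).2.2
  generalize (((l₁.map w).prod : F.evenCenter) : F.Alg) = p₁ at *
  generalize (((l₂.map w).prod : F.evenCenter) : F.Alg) = p₂ at *
  generalize (((l₃.map w).prod : F.evenCenter) : F.Alg) = p₃ at *
  -- The products `p₁`, `p₂`, `p₃` are even and central, so the only sign comes from exchanging `Zb`
  -- and `X a`.
  calc Za * Zb * (p₁ * (X a * (p₂ * (X b * p₃))))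
      = (Za * Zb * p₁) * (X a * (p₂ * (X b * p₃))) := by rw [mul_assoc (Za * Zb)]
    _ = p₁ * (Za * ((Zb * X a) * p₂) * (X b * p₃)) := by rw [c₁]; simp only [mul_assoc]
    _ = -(p₁ * (Za * X a * ((Zb * p₂) * (X b * p₃)))) := by
      rw [odd_mul_odd hZb hXa]; simp only [neg_mul, mul_neg, mul_assoc]
    _ = _ := by rw [c₂]; simp only [mul_assoc]

end ordering

end WickFunctional
end CombSusy
end

/-! ### Fixed operators in an extended space-time -/

noncomputable section
namespace CombSusy

/-- The form on space-time extended by one direction of negative norm. -/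
def ghostForm {V : Type*} [AddCommGroup V] [Module ℂ V] (η : BilinForm ℂ V) :
    BilinForm ℂ (V × ℂ) :=
  LinearMap.mk₂ ℂ (fun v w => η v.1 w.1 - v.2 * w.2)
    (fun v v' w => by simp; ring) (fun r v w => by simp; ring)
    (fun v w w' => by simp; ring) (fun r v w => by simp; ring)

theorem ghostForm_apply {V : Type*} [AddCommGroup V] [Module ℂ V] (η : BilinForm ℂ V)
    (v w : V × ℂ) : ghostForm η v w = η v.1 w.1 - v.2 * w.2 := rfl

theorem ghostForm_isSymm {V : Type*} [AddCommGroup V] [Module ℂ V] {η : BilinForm ℂ V}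
    (hη : η.IsSymm) : (ghostForm η).IsSymm := by
  refine ⟨fun v w => ?_⟩
  have := hη.eq v.1 w.1
  simpa [ghostForm_apply, mul_comm] using this

/-- Fields of the original system as fields of the extended system. -/
def Field.extend {V 𝔤 : Type*} : Field V 𝔤 → Field (V × ℂ) 𝔤
  | .psi v => .psi (v, 0)
  | .rho t => .rho t
  | .rhoTilde t => .rhoTilde t
  | .q t => .q t
  | .y t => .y t

/-- Letters of the original system as letters of the extended system. -/
def extendLetter {n : ℕ} {V 𝔤 : Type*} (X : Field V 𝔤 × Fin n) : Field (V × ℂ) 𝔤 × Fin n :=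
  (X.1.extend, X.2)

namespace Insertions
open WickFunctional MatterData

variable {n : ℕ} {V 𝔤 ι : Type*} [AddCommGroup V] [Module ℂ V] [LieRing 𝔤] [LieAlgebra ℂ 𝔤]
  [Fintype ι] [DecidableEq ι] (D : Insertions n V 𝔤)
  {η : BilinForm ℂ V} (hη : η.IsSymm) {κ : BilinForm ℂ 𝔤} (hκ : κ.Nondegenerate)
  (hκs : κ.IsSymm) (hκi : κ.lieInvariant 𝔤) (e : Basis ι ℂ 𝔤)

/-- The extended matter system. -/
def ghostData : MatterData n (V × ℂ) 𝔤 ι where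
  η := ghostForm η
  η_symm := ghostForm_isSymm hη
  κ := κ
  κ_nondeg := hκ
  κ_symm := hκs
  κ_inv := hκi
  e := e
  σ := D.σ

local notation "𝕄" => ghostData D hη hκ hκs hκi e

/-- The image of an operator in the algebra of the extended system. -/
def toGhost : FieldPoly n V 𝔤 →ₐ[ℂ] (𝕄).F.Alg := (𝕄).F.proj.comp (freeMap extendLetter)

theorem toGhost_fld (X : Field V 𝔤) (i : Fin n) :
    D.toGhost hη hκ hκs hκi e (fld X i) = (𝕄).F.gen (X.extend, i) := by
  rw [toGhost, AlgHom.comp_apply, fld, freeMap_ι]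
  rfl

theorem extend_par (X : Field V 𝔤 × Fin n) :
    (𝕄).F.par (extendLetter X) = (matterWick η κ D.σ hη hκs).par X := by
  obtain ⟨X, i⟩ := X
  cases X <;> rfl

theorem extend_c (X Y : Field V 𝔤 × Fin n) :
    (𝕄).F.c (extendLetter X) (extendLetter Y) = (matterWick η κ D.σ hη hκs).c X Y := by
  obtain ⟨X, i⟩ := X
  obtain ⟨Y, j⟩ := Y
  rw [F_c]
  change _ = contraction η κ D.σ _ _
  by_cases h : i = j <;> cases X <;> cases Y <;>
    simp [contraction, extendLetter, Field.extend, opeCoeff, ghostData, ghostForm_apply, h]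

theorem ghost_c_extend (i : Fin n) (X : Field V 𝔤 × Fin n) :
    (𝕄).F.c (.psi (0, 1), i) (extendLetter X) = 0 := by
  obtain ⟨X, j⟩ := X
  rw [F_c]
  cases X <;> simp [contraction, extendLetter, Field.extend, opeCoeff, ghostData, ghostForm_apply]

/-- The fermions along the additional direction have no contractions with the original fields, so
their two-point function factors out. -/
theorem ev_ghost_mul_ghost_mul {a b : Fin n} (hab : a ≠ b) (x : FieldPoly n V 𝔤) :
    (𝕄).F.ev ((𝕄).psi a (0, 1) * (𝕄).psi b (0, 1) * D.toGhost hη hκ hκs hκi e x) =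
      -(D.σ a - D.σ b)⁻¹ * matterCorrelator η κ D.σ x := by
  have h := ev_gen_mul_gen_mul_freeMap (F := matterWick η κ D.σ hη hκs) (F' := (𝕄).F)
    (f := extendLetter) (D.extend_par hη hκ hκs hκi e) (D.extend_c hη hκ hκs hκi e)
    (Z := (.psi (0, 1), a)) (Z' := (.psi (0, 1), b)) rfl (D.ghost_c_extend hη hκ hκs hκi e a) x
  rw [psi_apply, psi_apply]
  refine h.trans ?_
  congr 1
  rw [F_c]
  simp [contraction, hab, opeCoeff, ghostData, ghostForm_apply, neg_div]

/-- The `i`-th vertex operator of the extended system with an arbitrary vector in place of the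
momentum. -/
def opVertex (i : Fin n) (K : V × ℂ) : (𝕄).F.evenCenter :=
  if D.species i = .graviton then
    (𝕄).oddMul ((𝕄).psiOdd i K) ((𝕄).psiOdd i (D.eps i, 0)) + algebraMap ℂ _ (η (D.eps i) (D.P i))
  else (𝕄).vertex (D.species i = .gluonTilde) ((𝕄).psiOdd i K) 1 (D.t i) i

/-- The fermion of the `i`-th vertex operator. -/
def fermion (i : Fin n) : Field V 𝔤 :=
  match D.species i with
  | .graviton => .psi (D.ε i)
  | .gluon => .rho (D.t i)
  | .gluonTilde => .rhoTilde (D.t i)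

theorem toGhost_vertexMatter_of_mem {i : Fin n} (hi : i ∈ D.fixed) :
    D.toGhost hη hκ hκs hκi e (D.vertexMatter η κ hκ e i) = (𝕄).F.gen (D.fermion i |>.extend, i) := by
  rw [← toGhost_fld, vertexMatter, fermion]
  cases D.species i <;> simp [hi]

theorem gen_fermion_mem (i : Fin n) : (𝕄).F.gen (D.fermion i |>.extend, i) ∈ (𝕄).F.oddPart := by
  rw [fermion]
  cases D.species i <;> exact gen_mem_oddPart rfl

theorem toGhost_bracketOp (A B : 𝔤 → Field V 𝔤) (A' B' : 𝔤 →ₗ[ℂ] (𝕄).F.Alg) (t : 𝔤) (i : Fin n)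
    (hA : ∀ s, A' s = (𝕄).F.gen ((A s).extend, i)) (hB : ∀ s, B' s = (𝕄).F.gen ((B s).extend, i)) :
    D.toGhost hη hκ hκs hκi e (bracketOp κ hκ e A B t i) = (𝕄).bil A' B' t := by
  simp only [bracketOp, bil, map_sum, map_smul, map_mul, toGhost_fld, hA, hB]
  rfl

theorem toGhost_vertexMatter_of_notMem {i : Fin n} (hi : i ∉ D.fixed) :
    D.toGhost hη hκ hκs hκi e (D.vertexMatter η κ hκ e i) =
      D.opVertex hη hκ hκs hκi e i (D.k i, 0) := by
  rw [vertexMatter, opVertex]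
  cases h : D.species i with
  | graviton =>
    simp only [hi, if_false, if_true, map_add, map_mul, toGhost_fld, AlgHom.commutes, eps, h]
    rw [add_comm]
    rfl
  | gluon =>
    simp only [hi, if_false, map_add, map_mul, map_smul, toGhost_fld]
    rw [D.toGhost_bracketOp hη hκ hκs hκi e _ _ ((𝕄).rho i) ((𝕄).rho i) _ _ (fun _ => rfl)
      (fun _ => rfl)]
    simp [vertex_untilded_coe]
    rfl
  | gluonTilde =>
    simp only [hi, if_false, map_add, map_mul, toGhost_fld]
    rw [D.toGhost_bracketOp hη hκ hκs hκi e _ _ ((𝕄).rho i) ((𝕄).rhoT i) _ _ (fun _ => rfl)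
      (fun _ => rfl), D.toGhost_bracketOp hη hκ hκs hκi e _ _ ((𝕄).q i) ((𝕄).y i) _ _ (fun _ => rfl)
      (fun _ => rfl)]
    simp [vertex_tilde_coe]
    rfl

/-- An integrated vertex is affine in its momentum vector. Subtracting its value at zero removes the
current or the constant `ε·P` and leaves the auxiliary fermion times the fixed operator; all species
are treated alike. -/
theorem ghost_mul_fermion (i : Fin n) :
    ((D.opVertex hη hκ hκs hκi e i (0, 1) - D.opVertex hη hκ hκs hκi e i 0 : (𝕄).F.evenCenter) :
      (𝕄).F.Alg) = (𝕄).psi i (0, 1) * (𝕄).F.gen (D.fermion i |>.extend, i) := by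
  have h0 : ((𝕄).psiOdd i 0 : (𝕄).F.Alg) = 0 := map_zero ((𝕄).psi i)
  rw [fermion, opVertex, opVertex]
  cases h : D.species i with
  | graviton =>
    simp only [if_true, eps, h, add_sub_add_right_eq_sub, Subalgebra.coe_sub, oddMul, h0, zero_mul,
      sub_zero]
    rfl
  | gluon =>
    simp [vertex_untilded_coe, h0]
    rfl
  | gluonTilde =>
    simp [vertex_tilde_coe, h0]
    rfl

/-- The correlator of the matter fields as one of even operators in the extended system. -/
theorem evEven_ghost {a b : Fin n} (hab : a < b) (hfix : D.fixed = {a, b})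
    (hσ : Function.Injective D.σ) :
    matterCorrelator η κ D.σ (List.ofFn (D.vertexMatter η κ hκ e)).prod =
      (D.σ a - D.σ b) * (𝕄).evEven (∏ i, if i = a ∨ i = b then
        D.opVertex hη hκ hκs hκi e i (0, 1) - D.opVertex hη hκ hκs hκi e i 0 else
        D.opVertex hη hκ hκs hκi e i (D.k i, 0)) := by
  have h1 := D.ev_ghost_mul_ghost_mul hη hκ hκs hκi e hab.ne
    (List.ofFn (D.vertexMatter η κ hκ e)).prod
  have hne : D.σ a - D.σ b ≠ 0 := sub_ne_zero.2 fun h => hab.ne (hσ h)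
  rw [map_list_prod, List.map_ofFn] at h1
  rw [odd_mul_odd_mul_prod_ofFn hab (psi_mem _ _ _) (w := fun i => if i = a ∨ i = b then
        D.opVertex hη hκ hκs hκi e i (0, 1) - D.opVertex hη hκ hκs hκi e i 0 else
        D.opVertex hη hκ hκs hκi e i (D.k i, 0))] at h1
  · rw [map_neg, neg_mul, neg_inj] at h1
    rw [evEven_apply, h1, mul_inv_cancel_left₀ hne]
  · rw [Function.comp_apply, toGhost_vertexMatter_of_mem _ _ _ _ _ _ (by simp [hfix])]
    exact D.gen_fermion_mem hη hκ hκs hκi e a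
  · intro i hia hib
    rw [Function.comp_apply, toGhost_vertexMatter_of_notMem _ _ _ _ _ _ (by simp [hfix, hia, hib]),
      if_neg (by simp [hia, hib])]
  · rw [Function.comp_apply, toGhost_vertexMatter_of_mem _ _ _ _ _ _ (by simp [hfix]),
      if_pos (Or.inl rfl), ghost_mul_fermion]
  · rw [Function.comp_apply, toGhost_vertexMatter_of_mem _ _ _ _ _ _ (by simp [hfix]),
      if_pos (Or.inr rfl), ghost_mul_fermion]

end Insertions
end CombSusy
end

/-! ### The matter correlator with two fixed operators -/

noncomputable section
namespace CombSusy

section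

variable {n : ℕ}

/-- Changing one row and the corresponding column of a skew matrix adds a form of rank two. -/
theorem rowForm_eq_add_wedge {N N' : Row n → Row n → ℂ} (hN : ∀ r s, N r s = -N s r)
    (hN' : ∀ r s, N' r s = -N' s r) {x : Row n} (h : ∀ r s, r ≠ x → s ≠ x → N r s = N' r s) :
    rowForm N' = rowForm N + wedge (rowForm N (row x) - rowForm N' (row x)) (coord x) := by
  refine form_ext fun r s => ?_
  simp only [LinearMap.add_apply, wedge_apply, LinearMap.sub_apply, LinearMap.smul_apply,
    rowForm_row, coord_row, smul_eq_mul]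
  by_cases hr : r = x <;> by_cases hs : s = x
  · rw [hr, hs]
    have h1 := hN x x
    have h2 := hN' x x
    simp only [if_true]
    linear_combination (h2 - h1) / 2
  · subst hr
    simp [hs]
  · subst hs
    simp [hr]
    rw [hN, hN' r s]
    ring
  · simp [hr, hs, h r s hr hs]

/-- Matrices that agree away from two rows have the same Pfaffian on forms without these rows. -/
theorem IsPfaffian.apply_eq_of_rows {N N' : Row n → Row n → ℂ} (hN : ∀ r s, N r s = -N s r)
    (hN' : ∀ r s, N' r s = -N' s r) {x y : Row n}
    (h : ∀ r s, r ≠ x → r ≠ y → s ≠ x → s ≠ y → N r s = N' r s)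
    {φ φ' : ExteriorAlgebra ℂ (RowSpace n) →ₗ[ℂ] ℂ} (hφ : IsPfaffian (rowForm N) φ)
    (hφ' : IsPfaffian (rowForm N') φ') (w : ExteriorAlgebra ℂ (RowSpace n)) :
    φ (del (coord x) (del (coord y) w)) = φ' (del (coord x) (del (coord y) w)) := by
  classical
  -- The intermediate matrix agrees with `N` in row and column `x` and with `N'` elsewhere. It
  -- differs from `N` only in row and column `y`, and from `N'` only in row and column `x`.
  have hM : ∀ r s, (if r = x ∨ s = x then N r s else N' r s) =
      -(if s = x ∨ r = x then N s r else N' s r) := by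
    intro r s
    by_cases hr : r = x <;> by_cases hs : s = x <;> simp only [hr, hs, true_or, or_true, or_self,
      if_true, if_false] <;> first | exact hN _ _ | exact hN' _ _
  obtain ⟨ψ, hψ⟩ := exists_isPfaffian (rowForm_self (N := fun r s =>
    if r = x ∨ s = x then N r s else N' r s) hM)
  have h1 := hφ.apply_eq_of_del_eq_zero (rowForm_self hM) hψ
    (rowForm_eq_add_wedge hN hM (x := y) fun r s hr hs => by
      split_ifs with hx
      · rfl
      · rw [not_or] at hx
        exact h r s hx.1 hr hx.2 hs)
    (w := del (coord x) (del (coord y) w)) (by rw [del_comm, del_self, map_zero, neg_zero])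
  have h2 := hψ.apply_eq_of_del_eq_zero (rowForm_self hN') hφ'
    (rowForm_eq_add_wedge hM hN' (x := x) fun r s hr hs => by simp [hr, hs])
    (w := del (coord x) (del (coord y) w)) (del_self _ _)
  rw [← h1, h2]

end

namespace Insertions
open WickFunctional MatterData

variable {n : ℕ} {V 𝔤 ι : Type*} [AddCommGroup V] [Module ℂ V] [LieRing 𝔤] [LieAlgebra ℂ 𝔤]
  [Fintype ι] [DecidableEq ι] (D : Insertions n V 𝔤)
  {η : BilinForm ℂ V} (hη : η.IsSymm) {κ : BilinForm ℂ 𝔤} (hκ : κ.Nondegenerate)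
  (hκs : κ.IsSymm) (hκi : κ.lieInvariant 𝔤) (e : Basis ι ℂ 𝔤)

local notation "𝕄" => ghostData D hη hκ hκs hκi e

omit [AddCommGroup V] [Module ℂ V] [Fintype ι] [DecidableEq ι] in
theorem colour_congr {W : Type*} {D' : Insertions n V 𝔤} {D : Insertions n W 𝔤}
    (κ : BilinForm ℂ 𝔤) (hσ : D.σ = D'.σ) (ht : D.t = D'.t) {T : Finset (Fin n)} :
    D.colour κ T = D'.colour κ T := by
  have h : ∀ w, D.nested w = D'.nested w := by
    intro w
    induction w with
    | nil => simp only [nested]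
    | cons i w ih =>
      cases w with
      | nil => simp only [nested, ht]
      | cons j w => simp only [nested, ht] at ih ⊢; rw [ih]
  simp only [colour, combTerm, h, hσ, ht]

variable (η) in
/-- The matrix of contractions for vectors `K i` in place of the momenta. -/
def ghostMatrix (K : Fin n → V × ℂ) : Row n → Row n → ℂ :=
  rowMatrix (ghostForm η) D.σ K (fun i => (D.eps i, 0)) fun i => η (D.eps i) (D.P i)

omit [LieRing 𝔤] [LieAlgebra ℂ 𝔤] in
theorem ghostMatrix_skew (hη : η.IsSymm) (K : Fin n → V × ℂ) (r s : Row n) :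
    D.ghostMatrix η K r s = -D.ghostMatrix η K s r :=
  rowMatrix_skew (fun x y => by simpa using (ghostForm_isSymm hη).eq x y) _ _ _ _ r s

theorem evEven_prod_opVertex (hσ : Function.Injective D.σ) (K : Fin n → V × ℂ)
    {φ : ExteriorAlgebra ℂ (RowSpace n) →ₗ[ℂ] ℂ} (hφ : IsPfaffian (rowForm (D.ghostMatrix η K)) φ) :
    (𝕄).evEven (∏ i, D.opVertex hη hκ hκs hκi e i (K i)) =
      (-1) ^ (D.gluons.card + D.untilded.card) * ∑ p ∈ D.allowedPartitions,
        (∏ T ∈ p.parts, D.colour κ T) * φ (rowProduct D.σ D.gravitons p.parts) := by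
  have hsub : D.untilded ⊆ D.gluons := fun i hi => by
    rw [mem_gluons, D.mem_untilded.1 hi]
    simp
  obtain ⟨A, hA⟩ : ∃ A, A = D.gluons \ D.untilded := ⟨_, rfl⟩
  have hAU : A ∪ D.untilded = D.gluons := hA ▸ Finset.sdiff_union_of_subset hsub
  have hdis : Disjoint A D.untilded := hA ▸ Finset.sdiff_disjoint
  have hmain := (𝕄).evEven_amplitude hσ (fun i => decide (D.species i = .gluonTilde)) D.gravitons A
    D.untilded (fun j hj => by
      rw [hA, Finset.mem_sdiff, mem_gluons, mem_untilded] at hj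
      cases h : D.species j <;> simp_all)
    (fun j hj => by simp [D.mem_untilded.1 hj]) hdis (hAU ▸ D.disjoint_gravitons_gluons)
    K (fun i => (D.eps i, 0)) (fun i => η (D.eps i) (D.P i)) (fun i hi => by
      rw [mem_gravitons] at hi
      simp [eps, hi]) D.t hφ
  have hprod : ∏ i, D.opVertex hη hκ hκs hκi e i (K i) =
      (∏ i ∈ D.gravitons, ((𝕄).oddMul ((𝕄).psiOdd i (K i)) ((𝕄).psiOdd i (D.eps i, 0)) +
        algebraMap ℂ _ (η (D.eps i) (D.P i)))) * ∏ j ∈ A ∪ D.untilded,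
        (𝕄).vertex (decide (D.species j = .gluonTilde)) ((𝕄).psiOdd j (K j)) 1 (D.t j) j := by
    rw [← D.gravitons_union_gluons, Finset.prod_union D.disjoint_gravitons_gluons, hAU]
    congr 1
    · refine Finset.prod_congr rfl fun i hi => ?_
      rw [opVertex, if_pos (D.mem_gravitons.1 hi)]
    · refine Finset.prod_congr rfl fun i hi => ?_
      rw [opVertex, if_neg (D.mem_gluons.1 hi)]
  rw [hprod, hmain]
  clear hmain hprod
  have hcol : ∀ T, (𝕄).col D.t T = D.colour κ T := fun T => by
    rw [MatterData.col]
    refine colour_congr (D' := D) κ ?_ ?_ <;> rfl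
  simp only [hcol]
  have key : ∀ B, B = D.gluons → (-1 : ℂ) ^ (B.card + D.untilded.card) *
      ∑ p : Finpartition B with p.parts.card = D.untilded.card ∧ ∀ T ∈ p.parts,
        2 ≤ T.card ∧ (T ∩ D.untilded).card = 1,
        (∏ T ∈ p.parts, D.colour κ T) * φ (rowProduct D.σ D.gravitons p.parts) =
      (-1) ^ (D.gluons.card + D.untilded.card) * ∑ p ∈ D.allowedPartitions,
        (∏ T ∈ p.parts, D.colour κ T) * φ (rowProduct D.σ D.gravitons p.parts) := by
    rintro B rfl
    congr 1
  exact key _ hAU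

/-- The momenta with ghost vectors at two places. -/
def ghostMomenta (a b : Fin n) (x y : ℂ) (i : Fin n) : V × ℂ :=
  if i = a then (0, x) else if i = b then (0, y) else (D.k i, 0)

omit [LieRing 𝔤] [LieAlgebra ℂ 𝔤] in
-- The additional direction is orthogonal to space-time, so the two vectors along it pair only with
-- each other. The norm `-1` gives the entry `-xy / σ_ab`.
theorem rowForm_ghostMatrix {a b : Fin n} (hab : a ≠ b) (x y : ℂ) :
    rowForm (D.ghostMatrix η (D.ghostMomenta a b x y)) =
      rowForm (D.ghostMatrix η (D.ghostMomenta a b 0 0)) +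
        wedge ((-(x * y) / (D.σ a - D.σ b)) • coord (.mom a)) (coord (.mom b)) := by
  refine form_ext fun r s => ?_
  simp only [LinearMap.add_apply, wedge_apply, LinearMap.sub_apply, LinearMap.smul_apply,
    rowForm_row, coord_row, smul_eq_mul]
  have hba := hab.symm
  have hsub : D.σ b - D.σ a = -(D.σ a - D.σ b) := by ring
  rcases r with i | i <;> rcases s with j | j <;>
    simp only [ghostMatrix, rowMatrix, ghostMomenta, Row.mom.injEq, reduceCtorEq, if_false]
  · by_cases hij : i = j
    · subst hij
      by_cases hia : i = a <;> by_cases hib : i = b <;> simp_all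
    · by_cases hia : i = a <;> by_cases hib : i = b <;> by_cases hja : j = a <;>
        by_cases hjb : j = b <;> simp_all [ghostForm_apply, neg_div, mul_comm]
      rw [← div_neg, neg_sub]
  · by_cases hia : i = a <;> by_cases hib : i = b <;> simp_all [ghostForm_apply]
  · by_cases hia : j = a <;> by_cases hib : j = b <;> simp_all [ghostForm_apply]
  · simp

omit [LieRing 𝔤] [LieAlgebra ℂ 𝔤] in
theorem ghostMatrix_eq_kinMatrix {a b : Fin n} (r s : Row n) (hra : r ≠ .mom a) (hrb : r ≠ .mom b)
    (hsa : s ≠ .mom a) (hsb : s ≠ .mom b) :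
    D.ghostMatrix η (D.ghostMomenta a b 0 0) r s = D.kinMatrix η r s := by
  rcases r with i | i <;> rcases s with j | j <;>
    simp_all [ghostMatrix, kinMatrix, rowMatrix, ghostMomenta, ghostForm_apply]

omit [LieRing 𝔤] [LieAlgebra ℂ 𝔤] in
theorem kinMatrix_skew (hη : η.IsSymm) (r s : Row n) : D.kinMatrix η r s = -D.kinMatrix η s r :=
  rowMatrix_skew (fun x y => by simpa using hη.eq x y) _ _ _ _ r s

include hη hκs hκi in
/-- The matter correlator with two fixed operators. -/
theorem matterCorrelator_eq (hσ : Function.Injective D.σ) {a b : Fin n} (hab : a < b)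
    (hfix : D.fixed = {a, b}) {φ : ExteriorAlgebra ℂ (RowSpace n) →ₗ[ℂ] ℂ}
    (hφ : IsPfaffian (rowForm (D.kinMatrix η)) φ) :
    matterCorrelator η κ D.σ (List.ofFn (D.vertexMatter η κ hκ e)).prod =
      (-1) ^ (D.gluons.card + D.untilded.card) * ∑ p ∈ D.allowedPartitions,
        (∏ T ∈ p.parts, D.colour κ T) * φ (del (coord (.mom a)) (del (coord (.mom b))
          (rowProduct D.σ D.gravitons p.parts : ExteriorAlgebra ℂ (RowSpace n)))) := by
  have hne : D.σ a - D.σ b ≠ 0 := sub_ne_zero.2 fun h => hab.ne (hσ h)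
  obtain ⟨ψ, hψ⟩ := exists_isPfaffian (rowForm_self
    (D.ghostMatrix_skew hη (D.ghostMomenta a b 0 0)))
  -- The rank-two update makes the dependence on `x` and `y` explicit: a constant plus a multiple of
  -- `xy`.
  have hZ : ∀ x y, (𝕄).evEven (∏ i, D.opVertex hη hκ hκs hκi e i (D.ghostMomenta a b x y i)) =
      (-1) ^ (D.gluons.card + D.untilded.card) * ∑ p ∈ D.allowedPartitions,
        (∏ T ∈ p.parts, D.colour κ T) * (ψ (rowProduct D.σ D.gravitons p.parts) +
          x * y / (D.σ a - D.σ b) * ψ (del (coord (.mom a)) (del (coord (.mom b))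
          (rowProduct D.σ D.gravitons p.parts : ExteriorAlgebra ℂ (RowSpace n))))) := by
    intro x y
    have hψ' := hψ.add_wedge ((-(x * y) / (D.σ a - D.σ b)) • coord (.mom a)) (coord (.mom b))
    rw [← D.rowForm_ghostMatrix hab.ne] at hψ'
    rw [D.evEven_prod_opVertex hη hκ hκs hκi e hσ _ hψ']
    congr 1
    refine Finset.sum_congr rfl fun p _ => ?_
    congr 1
    rw [LinearMap.add_apply, LinearMap.comp_apply, LinearMap.comp_apply, map_smul,
      LinearMap.smul_apply, map_smul, map_smul, del_comm, map_neg, smul_eq_mul]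
    ring
  -- The product with both differences is the second difference in `x` and `y`, which isolates the
  -- coefficient of `xy`.
  have hexp : (∏ i, if i = a ∨ i = b then
        D.opVertex hη hκ hκs hκi e i (0, 1) - D.opVertex hη hκ hκs hκi e i 0 else
        D.opVertex hη hκ hκs hκi e i (D.k i, 0)) =
      (∏ i, D.opVertex hη hκ hκs hκi e i (D.ghostMomenta a b 1 1 i)) -
      (∏ i, D.opVertex hη hκ hκs hκi e i (D.ghostMomenta a b 1 0 i)) -
      (∏ i, D.opVertex hη hκ hκs hκi e i (D.ghostMomenta a b 0 1 i)) +
      ∏ i, D.opVertex hη hκ hκs hκi e i (D.ghostMomenta a b 0 0 i) := by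
    have hb : b ∈ Finset.univ.erase a := by simp [hab.ne']
    have hR : ∀ x y, ∏ i, D.opVertex hη hκ hκs hκi e i (D.ghostMomenta a b x y i) =
        D.opVertex hη hκ hκs hκi e a (0, x) * (D.opVertex hη hκ hκs hκi e b (0, y) *
          ∏ i ∈ (Finset.univ.erase a).erase b, D.opVertex hη hκ hκs hκi e i (D.k i, 0)) := by
      intro x y
      rw [← Finset.mul_prod_erase _ _ (Finset.mem_univ a), ← Finset.mul_prod_erase _ _ hb]
      congr 1
      · simp [ghostMomenta]
      · congr 1
        · simp [ghostMomenta, hab.ne']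
        · refine Finset.prod_congr rfl fun i hi => ?_
          simp only [Finset.mem_erase] at hi
          simp [ghostMomenta, hi.1, hi.2.1]
    rw [hR, hR, hR, hR, ← Finset.mul_prod_erase _ _ (Finset.mem_univ a),
      ← Finset.mul_prod_erase _ _ hb, if_pos (Or.inl rfl), if_pos (Or.inr rfl),
      Finset.prod_congr rfl (g := fun i => D.opVertex hη hκ hκs hκi e i (D.k i, 0)) fun i hi => by
        simp only [Finset.mem_erase] at hi
        simp [hi.1, hi.2.1], ← Prod.mk_zero_zero]
    ring
  rw [D.evEven_ghost hη hκ hκs hκi e hab hfix hσ, hexp, map_add, map_sub, map_sub, hZ, hZ, hZ, hZ,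
    ← mul_sub, ← mul_sub, ← mul_add, ← Finset.sum_sub_distrib, ← Finset.sum_sub_distrib,
    ← Finset.sum_add_distrib, mul_left_comm, Finset.mul_sum]
  congr 1
  refine Finset.sum_congr rfl fun p _ => ?_
  -- The contractions have removed the momentum rows `a` and `b`, so the zero vectors there may be
  -- replaced by `k_a` and `k_b`.
  rw [← hψ.apply_eq_of_rows (D.ghostMatrix_skew hη _) (D.kinMatrix_skew hη)
    (fun r s h1 h2 h3 h4 => D.ghostMatrix_eq_kinMatrix r s h1 h2 h3 h4) hφ]
  field_simp
  ring

end Insertions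
end CombSusy
end

/-! ### The ghost correlator, the overall sign and the theorem -/

noncomputable section
namespace CombSusy

theorem finrank_ghostZeroModes : Module.finrank ℂ ghostZeroModes = 2 := by
  rw [ghostZeroModes, (Polynomial.degreeLTEquiv ℂ 2).finrank_eq, Module.finrank_fin_fun]

namespace Insertions
open WickFunctional MatterData

variable {n : ℕ} {V 𝔤 ι : Type*} [AddCommGroup V] [Module ℂ V] [LieRing 𝔤] [LieAlgebra ℂ 𝔤]
  [Fintype ι] [DecidableEq ι] (D : Insertions n V 𝔤)

omit [AddCommGroup V] [Module ℂ V] [LieRing 𝔤] [LieAlgebra ℂ 𝔤] in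
theorem sum_charge : ∑ i, D.charge i = -(D.fixed.card : ℤ) := by
  simp [charge]

omit [AddCommGroup V] [Module ℂ V] [LieRing 𝔤] [LieAlgebra ℂ 𝔤] in
theorem ghostCorrelator_eq_zero (h : D.fixed.card ≠ 2) : ghostCorrelator D.σ D.charge = 0 := by
  rw [ghostCorrelator, sum_charge, finrank_ghostZeroModes, if_neg]
  omega

omit [AddCommGroup V] [Module ℂ V] [LieRing 𝔤] [LieAlgebra ℂ 𝔤] in
theorem ghostCorrelator_pair {a b : Fin n} (hab : a < b) (h : D.fixed = {a, b}) :
    ghostCorrelator D.σ D.charge = (D.σ a - D.σ b)⁻¹ := by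
  rw [ghostCorrelator, sum_charge, finrank_ghostZeroModes, h, Finset.card_pair hab.ne, if_pos (by
    norm_num), Finset.prod_eq_single (a, b)]
  · simp [charge, h]
  · rintro ⟨i, j⟩ hij hne
    simp only [Finset.mem_filter, Finset.mem_univ, true_and] at hij
    have : D.charge i * D.charge j = 0 := by
      simp only [charge, h, Finset.mem_insert, Finset.mem_singleton]
      by_contra hc
      have hi : i = a ∨ i = b := by by_contra hi; simp [hi] at hc
      have hj : j = a ∨ j = b := by by_contra hj; simp [hj] at hc
      rcases hi with rfl | rfl <;> rcases hj with rfl | rfl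
      · exact lt_irrefl _ hij
      · exact hne rfl
      · exact lt_asymm hab hij
      · exact lt_irrefl _ hij
    simp [this]
  · intro hn
    simp [hab] at hn

omit [AddCommGroup V] [Module ℂ V] [LieRing 𝔤] [LieAlgebra ℂ 𝔤] in
-- The graviton signs cancel, and `m(m+1)/2 = m(m-1)/2 + m` leaves the sign of the product of
-- traces, where a trace `T` carries `(-1)^(|T|+1)`.
theorem overallSign_mul_rowSign :
    D.overallSign * D.rowSign D.untilded.card = (-1) ^ (D.gluons.card + D.untilded.card) := by
  have h : D.untilded.card * (D.untilded.card + 1) / 2 =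
      D.untilded.card * (D.untilded.card - 1) / 2 + D.untilded.card := by
    have := Nat.triangle_succ D.untilded.card
    rwa [Nat.add_sub_cancel, mul_comm] at this
  have hsq : ∀ k : ℕ, ((-1 : ℂ) ^ k) * (-1) ^ k = 1 := fun k => by
    rw [← mul_pow]; norm_num
  rw [overallSign, rowSign, h]
  simp only [pow_add]
  linear_combination ((-1 : ℂ) ^ D.gluons.card * (-1) ^ D.untilded.card) *
    ((-1) ^ (D.gravitons.card * (D.gravitons.card - 1) / 2) *
      (-1) ^ (D.gravitons.card * (D.gravitons.card - 1) / 2) *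
      hsq (D.untilded.card * (D.untilded.card - 1) / 2) +
    hsq (D.gravitons.card * (D.gravitons.card - 1) / 2))

variable {η : BilinForm ℂ V} {κ : BilinForm ℂ 𝔤}

/-- The correlator in terms of the reduced Pfaffian for an arbitrary choice of the removed rows. -/
theorem correlator_eq (hη : η.IsSymm) (hκ : κ.Nondegenerate) (hκs : κ.IsSymm)
    (hκi : κ.lieInvariant 𝔤) (e : Basis ι ℂ 𝔤) (hD : D.OnShell η) (hfix : D.fixed.card = 2)
    {φ : ExteriorAlgebra ℂ (RowSpace n) →ₗ[ℂ] ℂ} (hφ : IsPfaffian (rowForm (D.kinMatrix η)) φ)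
    (X : Finpartition D.gluons → ℂ)
    (hX : ∀ p ∈ D.allowedPartitions, ∃ d d', D.minor d d' ≠ 0 ∧
      X p = D.rowSign p.parts.card * ((∏ T ∈ p.parts, D.colour κ T) *
        -(φ (del d (del d' (rowProduct D.σ D.gravitons p.parts : ExteriorAlgebra ℂ (RowSpace n)))) /
          D.minor d d'))) :
    D.correlator η κ hκ e = D.overallSign * ∑ p ∈ D.allowedPartitions, X p := by
  have hηs : ∀ x y, η x y = η y x := fun x y => by simpa using hη.eq x y
  obtain ⟨a, b, hab, hf⟩ : ∃ a b : Fin n, a < b ∧ D.fixed = {a, b} := by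
    obtain ⟨a, b, hne, hf⟩ := Finset.card_eq_two.1 hfix
    rcases lt_or_gt_of_ne hne with h | h
    · exact ⟨a, b, h, hf⟩
    · exact ⟨b, a, h, hf.trans (Finset.pair_comm a b)⟩
  have hne : D.minor (coord (.mom a)) (coord (.mom b)) ≠ 0 := by
    rw [minor_mom]
    exact sub_ne_zero.2 fun h => hab.ne (hD.distinct h).symm
  rw [correlator, D.ghostCorrelator_pair hab hf,
    D.matterCorrelator_eq hη hκ hκs hκi e hD.distinct hab hf hφ, Finset.mul_sum, Finset.mul_sum,
    Finset.mul_sum]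
  refine Finset.sum_congr rfl fun p hp => ?_
  obtain ⟨d, d', hd, h⟩ := hX p hp
  have hm : p.parts.card = D.untilded.card := (Finset.mem_filter.1 hp).2.1
  -- The given reduction is traded for the one at the two fixed punctures. Its denominator, minus
  -- the minor, is `σ_ab`, matching the ghost correlator.
  rw [h, ← D.reduced_eq hηs hD hφ p hne hd, ← mul_assoc D.overallSign, hm,
    overallSign_mul_rowSign, minor_mom, ← neg_sub (D.σ a), div_neg, neg_neg, div_eq_mul_inv]
  ring

end Insertions
end CombSusy
end

theorem mainTheorem2 {n : ℕ} {V 𝔤 ι : Type*} [AddCommGroup V] [Module ℂ V]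
    [LieRing 𝔤] [LieAlgebra ℂ 𝔤] [Fintype ι] [DecidableEq ι]
    (η : LinearMap.BilinForm ℂ V) (hη : η.IsSymm)
    (κ : LinearMap.BilinForm ℂ 𝔤) (hκ : κ.Nondegenerate) (hκs : κ.IsSymm)
    (hκi : κ.lieInvariant 𝔤) (e : Module.Basis ι ℂ 𝔤)
    (D : CombSusy.Insertions n V 𝔤) (hD : D.OnShell η) :
    (D.correlator η κ hκ e ≠ 0 → D.fixed.card = 2) ∧
    (D.fixed.card = 2 →
      (∀ a ∈ D.gravitons, ∀ b ∈ D.gravitons, a < b →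
        D.correlator η κ hκ e =
          D.overallSign * ∑ p ∈ D.allowedPartitions, D.contributionGravitons η κ p a b) ∧
      (∀ T₀ : Finpartition D.gluons → Finset (Fin n),
        (∀ p ∈ D.allowedPartitions, T₀ p ∈ p.parts) →
        D.correlator η κ hκ e =
          D.overallSign * ∑ p ∈ D.allowedPartitions, D.contributionTrace η κ p (T₀ p)) ∧
      (∀ x y : Finpartition D.gluons → CombSusy.TraceRow n,
        (∀ p ∈ D.allowedPartitions, D.Removable p (x p) (y p)) →
        D.correlator η κ hκ e =
          D.overallSign * ∑ p ∈ D.allowedPartitions,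
            (∏ T ∈ p.parts, D.colour κ T) * D.reducedPfaffian η p (x p) (y p))) := by
  have hηs : ∀ x y, η x y = η y x := fun x y => by simpa using hη.eq x y
  obtain ⟨φ, hφ⟩ := CombSusy.exists_isPfaffian (CombSusy.rowForm_self (D.kinMatrix_skew hη))
  have hcard : ∀ p ∈ D.allowedPartitions, ∀ T ∈ p.parts, 2 ≤ T.card := fun p hp T hT =>
    ((Finset.mem_filter.1 hp).2.2 T hT).1
  refine ⟨fun h => ?_, fun hfix => ⟨fun a ha b hb hab => ?_, fun T₀ hT₀ => ?_, fun x y hxy => ?_⟩⟩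
  · by_contra hc
    exact h (by rw [CombSusy.Insertions.correlator, D.ghostCorrelator_eq_zero hc, zero_mul])
  · refine D.correlator_eq hη hκ hκs hκi e hD hfix hφ _ fun p _ => ⟨_, _, ?_,
      D.contributionGravitons_eq κ hηs hφ p ha hb hab⟩
    rw [D.minor_mom]
    exact sub_ne_zero.2 fun h => hab.ne (hD.distinct h).symm
  · exact D.correlator_eq hη hκ hκs hκi e hD hfix hφ _ fun p hp =>
      D.contributionTrace_eq κ hηs hD.distinct hφ p (hT₀ p hp) (hcard p hp _ (hT₀ p hp))
  · refine D.correlator_eq hη hκ hκs hκi e hD hfix hφ _ fun p hp => ?_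
    obtain ⟨d, d', hd, h⟩ := D.reducedPfaffian_eq hηs hD.distinct hφ p (hcard p hp) (hxy p hp)
    exact ⟨d, d', hd, by rw [h, mul_left_comm]⟩
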